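/- Let $K$ be an algebraically closed field and $H\subset\mathbb P^3=\mathbb P^3_K$ a fixed plane. A *star configuration* is a set of $A$ general lines in $H$, with its $\binom A2$ nodes; a *sub-star* $P(A,b)$ is its set of nodes with $b$ nodes omitted in such a way that each line contains at most one omitted node. A *cross* is a union of two lines meeting in one point, its vertex. Let $B(d;L,C,(A,b))$ denote the type of reduced schemes in $\mathbb P^3$ consisting of $L$ general lines, $C$ crosses with general vertices in $H$, and a sub-star $P(A,b)$ in $H$; let $Y(d;\ell,p)$ denote the type of schemes consisting of $\ell$ general lines and $p$ points on a further general line. In both cases $d$ records the degree of the forms considered. "General" always means: with parameters in an arbitrary prescribed nonempty Zariski open subset of the parameter space. Let $\sigma$ be a type of degree $d\ge1$ with $L$ lines, $C$ crosses, sub-star $P(A,b)$ and $p$ collinear points. A *specialization step* $S(l,s,h,c)$, with $l+2s\le L$ and $c+h\le C$, leads from $\sigma$ to the type $$\sigma'=B\bigl(d-1;\;L-l-2s+h,\;C-c-h+s,\;(l+2c+h,\,c)\bigr)$$ if a general scheme $Y$ of type $\sigma$ specializes to a scheme $Y_0$, in a flat family over the affine line having $Y$ and $Y_0$ as members and all but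 finitely many of whose members are general schemes of type $\sigma$, such that * the trace $Y_0\cap H$ is the union of $l+2c+h$ general lines of $H$, $s$ general double points of $H$, $C-c-h$ schemes of length $2$ supported at general points of $H$, a sub-star $P(A,b)$, $L-l-2s$ general points of $H$, and $p$ points on a general line of $H$; * the residual scheme of $Y_0$ with respect to $H$ (with ideal sheaf $\mathcal I_{Y_0}:\mathcal I_H$) is a general scheme of type $\sigma'$. For $k\ge3$ let the *reduction schemes* be, for odd $k$, $$R_0(k)=B\bigl(3k;\tfrac{k(k+5)+4}2,\tfrac{k^2-1}2,(k+1,\tfrac{k+1}2)\bigr),\quad R_1(k)=B\bigl(3k-1;\tfrac{k(k+5)}2+4,\tfrac{k(k-1)}2-2,(k+1,2)\bigr),\quad R_2(k)=B\bigl(3k-2;\tfrac{k(k+5)}2-1,\tfrac{(k-1)^2}2,(k,\tfrac{k-1}2)\bigr),$$ and, for even $k$, $$R_0(k)=B\bigl(3k;\tfrac{k(k+5)+2}2,\tfrac{k^2}2,(k+1,\tfrac k2)\bigr),\quad R_1(k)=B\bigl(3k-1;\tfrac{k(k+5)}2+2,\tfrac{k(k-1)}2-1,(k+1,1)\bigr),\quad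 R_2(k)=B\bigl(3k-2;\tfrac{k(k+5)}2,\tfrac{k(k-2)}2,(k,\tfrac k2)\bigr).$$ **Proposition (Initial specialization).** Let $d=3k+\varepsilon\ge 12$ with $\varepsilon\in\{0,1,2\}$, and put $\ell=\tfrac12(3k+5+2\varepsilon)k+1+\varepsilon$, and $p=k+1$ if $\varepsilon=2$, $p=0$ otherwise. Then there is a chain of at most three specialization steps which leads from $Y(d;\ell,p)$ to one of the schemes $R_0(k'),R_1(k'),R_2(k'),R_0(k'-1)$ with $k'\ge4$. The chain can be chosen such that every scheme in it, of degree $e$ with $L$ lines, $C$ crosses, sub-star $P(A,b)$ and $p$ collinear points, has the expected number of conditions $L(e+1)+C(2e+1)+\binom A2-b+p=\binom{e+3}3$. -/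

import Mathlib

namespace LinesInSpace

open MvPolynomial

/-! Conventions.  `S = K[x₀,x₁,x₂,x₃]` is the coordinate ring of `ℙ³` over the field `K`, and a closed
subscheme of `ℙ³` is represented by its saturated homogeneous ideal in `S`.  The fixed plane `H` is
`{x₃ = 0}`; every plane is of this form in suitable coordinates. -/

/-! ### Numerical types of schemes -/

/-- The numerical data of a scheme in `ℙ³` together with the degree `deg` of the forms considered:
`lines` general lines, `crosses` crosses with general vertices in `H`, a sub-star of `H` given by a
star configuration of `starLines` lines with `omitted` of its nodes left out, and `collinear` points
on a general line. -/
structure SchemeType where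
  deg : ℕ
  lines : ℕ
  crosses : ℕ
  starLines : ℕ
  omitted : ℕ
  collinear : ℕ

/-- The type `B(d; L, C, (A, b))`. -/
def typeB (d L C A b : ℕ) : SchemeType := ⟨d, L, C, A, b, 0⟩

/-- The type `Y(ℓ, p)`, for forms of degree `d`: `ℓ` general lines and `p` collinear points. -/
def typeY (d l p : ℕ) : SchemeType := ⟨d, l, 0, 0, 0, p⟩

/-- The expected number of conditions imposed on forms of degree `deg`. -/
def SchemeType.conditions (σ : SchemeType) : ℕ :=
  σ.lines * (σ.deg + 1) + σ.crosses * (2 * σ.deg + 1) + (σ.starLines.choose 2 - σ.omitted)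
    + σ.collinear

/-- The numerical data of a trace scheme `T(n, s, q, (A, b), r)` in `H`: `lines` lines, `doubles`
double points, `lengthTwo` schemes of length two, a sub-star `P(starLines, omitted)`, `points` general
points, and moreover `collinear` points on a general line of `H`. -/
structure TraceType where
  lines : ℕ
  doubles : ℕ
  lengthTwo : ℕ
  starLines : ℕ
  omitted : ℕ
  points : ℕ
  collinear : ℕ

/-! ### Parameter spaces -/

/-- Coordinates of the affine parameter space of the schemes of type `σ`. -/
inductive Coord (σ : SchemeType) : Type
  /-- two points spanning the `i`-th line -/
  | line (i : Fin σ.lines) (e : Fin 2) (j : Fin 4)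
  /-- the vertex in `H` of the `i`-th cross -/
  | vertex (i : Fin σ.crosses) (j : Fin 3)
  /-- a second point on each of the two lines of the `i`-th cross -/
  | arm (i : Fin σ.crosses) (e : Fin 2) (j : Fin 4)
  /-- the coefficients of the equation in `H` of the `i`-th line of the star configuration -/
  | star (i : Fin σ.starLines) (j : Fin 3)
  /-- two points spanning the line which contains the collinear points -/
  | axis (e : Fin 2) (j : Fin 4)
  /-- the position of the `i`-th collinear point on its line -/
  | pt (i : Fin σ.collinear) (e : Fin 2)

/-- Coordinates of the affine parameter space of the trace schemes of type `τ`. -/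
inductive TraceCoord (τ : TraceType) : Type
  /-- the coefficients of the equation in `H` of the `i`-th line -/
  | line (i : Fin τ.lines) (j : Fin 3)
  /-- the support of the `i`-th double point -/
  | double (i : Fin τ.doubles) (j : Fin 3)
  /-- the support of the `i`-th scheme of length two -/
  | support (i : Fin τ.lengthTwo) (j : Fin 3)
  /-- a second point on the line spanned by the `i`-th scheme of length two -/
  | direction (i : Fin τ.lengthTwo) (j : Fin 3)
  /-- the coefficients of the equation in `H` of the `i`-th line of the star configuration -/
  | star (i : Fin τ.starLines) (j : Fin 3)
  /-- the `i`-th general point -/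
  | point (i : Fin τ.points) (j : Fin 3)
  /-- two points spanning the line which contains the collinear points -/
  | axis (e : Fin 2) (j : Fin 3)
  /-- the position of the `i`-th collinear point on its line -/
  | pt (i : Fin τ.collinear) (e : Fin 2)

section Geometry

variable {K : Type*} [Field K]

/-- `P` holds for the general point of the affine space with coordinates `ι`, that is, on a nonempty
Zariski open subset of it. -/
def ForGeneral {ι : Type} (P : (ι → K) → Prop) : Prop :=
  ∃ f : MvPolynomial ι K, f ≠ 0 ∧ ∀ x : ι → K, eval x f ≠ 0 → P x

/-! ### Affine cones of the pieces -/

/-- The point of `H = {x₃ = 0}` with the given three coordinates. -/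
def inPlane (v : Fin 3 → K) : Fin 4 → K := ![v 0, v 1, v 2, 0]

/-- The linear subspace spanned by two vectors: the cone over a line (or, if `v = u`, over a point). -/
def spanPair (u v : Fin 4 → K) : Set (Fin 4 → K) := Submodule.span K {u, v}

/-- The cone over a point. -/
def pointCone (u : Fin 4 → K) : Set (Fin 4 → K) := Submodule.span K {u}

/-- The cone over the line of `H` with equation `a₀x₀ + a₁x₁ + a₂x₂ = 0`. -/
def planeLine (a : Fin 3 → K) : Set (Fin 4 → K) :=
  {w | w 3 = 0 ∧ a 0 * w 0 + a 1 * w 1 + a 2 * w 2 = 0}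

/-- The node of lines `i` and `j` of a star configuration is kept, where the omitted nodes are those
of the `b` pairs of lines `{0,1}, {2,3}, …, {2b-2, 2b-1}`.  As the lines are general, this is, up to
numbering them, any choice of `b` nodes such that each line contains at most one of them. -/
def IsKept (b i j : ℕ) : Prop :=
  i < j ∧ ¬ ∃ m < b, i = 2 * m ∧ j = 2 * m + 1

/-- The cone over the sub-star `P(A, b)` of the star configuration of the lines `a i` of `H`. -/
def subStarCone {A : ℕ} (a : Fin A → Fin 3 → K) (b : ℕ) : Set (Fin 4 → K) :=
  ⋃ (i : Fin A) (j : Fin A) (_ : IsKept b i j), planeLine (a i) ∩ planeLine (a j)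

/-! ### The schemes -/

/-- The ideal of the scheme of type `σ` with parameters `x`: the (reduced) union of the lines, the
crosses, the points of the sub-star, and the collinear points. -/
noncomputable def schemeIdeal {σ : SchemeType} (x : Coord σ → K) : Ideal (MvPolynomial (Fin 4) K) :=
  vanishingIdeal K
    ((⋃ i : Fin σ.lines, spanPair (fun j => x (.line i 0 j)) (fun j => x (.line i 1 j))) ∪
     (⋃ (i : Fin σ.crosses) (e : Fin 2),
        spanPair (inPlane fun j => x (.vertex i j)) (fun j => x (.arm i e j))) ∪
     subStarCone (fun i j => x (.star i j)) σ.omitted ∪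
     (⋃ i : Fin σ.collinear,
        pointCone fun j => x (.pt i 0) * x (.axis 0 j) + x (.pt i 1) * x (.axis 1 j)))

/-- The ideal of the double point (first infinitesimal neighbourhood) of `H` at the point `p`. -/
noncomputable def doublePointIdeal (p : Fin 3 → K) : Ideal (MvPolynomial (Fin 4) K) :=
  Ideal.span {X 3} ⊔ vanishingIdeal K (pointCone (inPlane p)) ^ 2

/-- The ideal of the scheme of length two supported at `p ∈ H` on the line joining `p` and `q ∈ H`. -/
noncomputable def lengthTwoIdeal (p q : Fin 3 → K) : Ideal (MvPolynomial (Fin 4) K) :=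
  vanishingIdeal K (spanPair (inPlane p) (inPlane q)) ⊔
    vanishingIdeal K (pointCone (inPlane p)) ^ 2

/-- The ideal in `K[x₀,…,x₃]` of the scheme in `H` of type `τ` with parameters `z`. -/
noncomputable def traceIdeal {τ : TraceType} (z : TraceCoord τ → K) :
    Ideal (MvPolynomial (Fin 4) K) :=
  vanishingIdeal K
    ((⋃ i : Fin τ.lines, planeLine fun j => z (.line i j)) ∪
     subStarCone (fun i j => z (.star i j)) τ.omitted ∪
     (⋃ i : Fin τ.points, pointCone (inPlane fun j => z (.point i j))) ∪
     (⋃ i : Fin τ.collinear,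
        pointCone (inPlane fun j => z (.pt i 0) * z (.axis 0 j) + z (.pt i 1) * z (.axis 1 j)))) ⊓
  (⨅ i : Fin τ.doubles, doublePointIdeal fun j => z (.double i j)) ⊓
  (⨅ i : Fin τ.lengthTwo,
    lengthTwoIdeal (fun j => z (.support i j)) (fun j => z (.direction i j)))

/-! ### Saturation, residual scheme and trace, flat families -/

/-- The saturation of `I` with respect to the irrelevant ideal `(x₀,x₁,x₂,x₃)`. -/
noncomputable def saturation (I : Ideal (MvPolynomial (Fin 4) K)) :
    Ideal (MvPolynomial (Fin 4) K) :=
  ⨆ n : ℕ, Submodule.colon I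
    ((Ideal.span (Set.range X) ^ n : Ideal (MvPolynomial (Fin 4) K)) :
      Set (MvPolynomial (Fin 4) K))

/-- The ideal of the residual scheme with respect to `H` of the scheme with ideal `I`. -/
noncomputable def residual (I : Ideal (MvPolynomial (Fin 4) K)) : Ideal (MvPolynomial (Fin 4) K) :=
  Submodule.colon I {X 3}

/-- The ideal (in `ℙ³`) of the trace on `H`, i.e. of the scheme-theoretic intersection with `H`, of
the scheme with ideal `I`. -/
noncomputable def trace (I : Ideal (MvPolynomial (Fin 4) K)) : Ideal (MvPolynomial (Fin 4) K) :=
  saturation (I ⊔ Ideal.span {X 3})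

/-- A homogeneous ideal `J` of `K[t][x₀,…,x₃]` defines a family of closed subschemes of `ℙ³` over the
affine line `Spec K[t]`; it is flat if `K[t][x₀,…,x₃]/J` is flat over `K[t]`.  (Every flat closed
subscheme of `ℙ³ × 𝔸¹`, and of `ℙ³ × U` up to extension over the line for `U ⊆ 𝔸¹` open and nonempty,
is given by such an ideal.) -/
structure IsFlatFamily (J : Ideal (MvPolynomial (Fin 4) (Polynomial K))) : Prop where
  homogeneous : ∀ g ∈ J, ∀ n : ℕ, homogeneousComponent n g ∈ J
  flat : Module.Flat (Polynomial K) (MvPolynomial (Fin 4) (Polynomial K) ⧸ J)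

/-- The (saturated) ideal of the member at `t = a` of the family given by `J`. -/
noncomputable def member (J : Ideal (MvPolynomial (Fin 4) (Polynomial K))) (a : K) :
    Ideal (MvPolynomial (Fin 4) K) :=
  saturation (J.map (MvPolynomial.map (Polynomial.evalRingHom a)))

/-- The scheme with ideal `I` specializes to the one with ideal `I₀` in a flat family over the affine
line: they are the members at `t = 1` and at `t = 0`, and all members, with finitely many exceptions,
are schemes of type `σ` with parameters in the open set `f ≠ 0`. -/
def SpecializesTo (σ : SchemeType) (f : MvPolynomial (Coord σ) K)
    (I I₀ : Ideal (MvPolynomial (Fin 4) K)) : Prop :=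
  ∃ J : Ideal (MvPolynomial (Fin 4) (Polynomial K)), IsFlatFamily J ∧
    member J 1 = I ∧ member J 0 = I₀ ∧
    ∀ᶠ a in Filter.cofinite, ∃ y : Coord σ → K, eval y f ≠ 0 ∧ member J a = schemeIdeal y

end Geometry

/-- The general scheme of type `σ` can be specialized, in a flat family whose general member is a
general scheme of type `σ`, to a scheme whose trace on `H` is a general scheme of type `τ` and whose
residual scheme with respect to `H` is a general scheme of type `σ'`.  Here "general" refers to
arbitrary nonempty Zariski open subsets `f ≠ 0`, `e ≠ 0`, `f' ≠ 0` of the three parameter spaces. -/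
def GeneralSpecialization (K : Type*) [Field K] (σ : SchemeType) (τ : TraceType)
    (σ' : SchemeType) : Prop :=
  ∀ (f : MvPolynomial (Coord σ) K) (e : MvPolynomial (TraceCoord τ) K)
    (f' : MvPolynomial (Coord σ') K), f ≠ 0 → e ≠ 0 → f' ≠ 0 →
    ForGeneral fun x : Coord σ → K =>
      ∃ (z : TraceCoord τ → K) (x' : Coord σ' → K) (I₀ : Ideal (MvPolynomial (Fin 4) K)),
        eval z e ≠ 0 ∧ eval x' f' ≠ 0 ∧ SpecializesTo σ f (schemeIdeal x) I₀ ∧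
          trace I₀ = traceIdeal z ∧ residual I₀ = schemeIdeal x'

/-- The trace type of the specialization `S(l, s, h, c)` of schemes of type `σ` (the collinear points,
if there are any, being specialized to `H` as well). -/
def traceType (σ : SchemeType) (l s h c : ℕ) : TraceType where
  lines := l + 2 * c + h
  doubles := s
  lengthTwo := σ.crosses - c - h
  starLines := σ.starLines
  omitted := σ.omitted
  points := σ.lines - l - 2 * s
  collinear := σ.collinear

/-- The residual type `B(d-1; L-l-2s+h, C-c-h+s, (l+2c+h, c))` of `S(l, s, h, c)`. -/
def residualType (σ : SchemeType) (l s h c : ℕ) : SchemeType :=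
  typeB (σ.deg - 1) (σ.lines - l - 2 * s + h) (σ.crosses - c - h + s) (l + 2 * c + h) c

/-- One specialization step from (general schemes of) type `σ` to type `σ'`: for some `l, s, h, c`
permitted by the numbers of lines and crosses, the specialization `S(l, s, h, c)` with its trace exists,
and its residual scheme, with the degree lowered by one, is of type `σ'`. -/
def Step (K : Type*) [Field K] (σ σ' : SchemeType) : Prop :=
  ∃ l s h c : ℕ, 1 ≤ σ.deg ∧ l + 2 * s ≤ σ.lines ∧ c + h ≤ σ.crosses ∧
    σ' = residualType σ l s h c ∧
    GeneralSpecialization K σ (traceType σ l s h c) σ'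

/-! ### The reduction schemes (all divisions are exact) -/

/-- The scheme `Y_{3k}` from which the reduction to `Y_{3(k-1)}` starts. -/
def reductionScheme₀ (k : ℕ) : SchemeType :=
  if Odd k then typeB (3 * k) ((k * (k + 5) + 4) / 2) ((k ^ 2 - 1) / 2) (k + 1) ((k + 1) / 2)
  else typeB (3 * k) ((k * (k + 5) + 2) / 2) (k ^ 2 / 2) (k + 1) (k / 2)

/-- The scheme in degree `3k - 1` between `Y_{3k}` and `Y_{3(k-1)}`. -/
def reductionScheme₁ (k : ℕ) : SchemeType :=
  if Odd k then typeB (3 * k - 1) (k * (k + 5) / 2 + 4) (k * (k - 1) / 2 - 2) (k + 1) 2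
  else typeB (3 * k - 1) (k * (k + 5) / 2 + 2) (k * (k - 1) / 2 - 1) (k + 1) 1

/-- The scheme in degree `3k - 2` between `Y_{3k}` and `Y_{3(k-1)}`. -/
def reductionScheme₂ (k : ℕ) : SchemeType :=
  if Odd k then typeB (3 * k - 2) (k * (k + 5) / 2 - 1) ((k - 1) ^ 2 / 2) k ((k - 1) / 2)
  else typeB (3 * k - 2) (k * (k + 5) / 2) (k * (k - 2) / 2) k (k / 2)

/-- The schemes which occur in the reductions `Y_{3k} → X₁ → X₂ → Y_{3(k-1)}`, `k ≥ 4`. -/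
def OccursInReduction (σ : SchemeType) : Prop :=
  ∃ k : ℕ, 4 ≤ k ∧ (σ = reductionScheme₀ k ∨ σ = reductionScheme₁ k ∨ σ = reductionScheme₂ k ∨
    σ = reductionScheme₀ (k - 1))

end LinesInSpace

/-! Everything rests on the existence of the specializations S(l, s, 0, c) for all l, s, c permitted
by the numbers of lines and crosses (`generalSpecialization`); the value h = 0 suffices for every
chain needed, and the rest is arithmetic.

Start from a general parameter x and move along an affine line in the parameter space that passes
through x at t = 1. For l of the lines, for c of the crosses and for the axis of the collinear
points, the x₃-coordinates of the spanning points are multiplied by t, so that these pieces fall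
into H at t = 0. In each of s pairs of lines, the second line turns about one of its points until it
passes through the point where the first one meets H. All other pieces stay fixed. The total space
is given by `familyIdeal`; its quotient has no K[t]-torsion and is therefore flat.

Generators of the limit ideal are never computed: the limit is squeezed. It contains the product of
the ideals of the limits of the pieces (`prod_le_memberIdeal`), since each factor extends over the
family, and it is contained in each of these ideals (`memberIdeal_le`). Moreover, if two curves in
the total space meet at t = 0, then the derivatives of elements of the limit in the direction of the
difference of the velocities vanish (`dirDeriv_sub_eq_zero`). Saturation is a local condition at the
points other than the origin (`mem_saturation_iff`), so the bounds may be compared point by point.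
By `Split.General.exists_local`, a point lies on at most one piece, where the bounds agree, unless
it is one of the following. (1) A node of lines of H coming from two different moved pieces. There
the velocities differ by a vertical vector, so x₃F can lie in the limit only if F vanishes at the
node; conversely x₃ times the ideal of the node lies in the product. Thus the residual scheme
acquires the node. The vertex of a moved cross is no such node, because its two lines are a single
piece; these are the c omitted nodes. The trace only sees the union of the two lines. (2) The vertex
of a new cross. The directions of its two lines and the velocity of the moving line span the whole
space, which puts the double point into the trace; conversely, modulo x₃ the product contains the
square of the ideal of the vertex. The residual scheme is just the cross there. This yields
`Split.General.trace_eq` and `Split.General.residual_eq`. The parameters of trace and residual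
scheme are polynomial functions of x defining dominant maps, so open conditions on them pull back to
open conditions on x (`ForGeneral.comap`).

For the chains put k = 2i + 4 or k = 2i + 5. They end at R₂(k) after two steps if ε = 0 and after
three steps if ε = 1, and at R₀(k) after two steps if ε = 2. -/

namespace LinesInSpace

open MvPolynomial

/-! ### Localization at a point, and saturation as a local condition -/

section Local

variable {K : Type*} [Field K]

theorem mem_vanishing {Z : Set (Fin 4 → K)} {F : MvPolynomial (Fin 4) K} :
    F ∈ vanishingIdeal K Z ↔ ∀ w ∈ Z, eval w F = 0 := by
  simp [mem_vanishingIdeal_iff, aeval_eq_eval]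

/-- The polynomials which lie in `I` locally at the point `q`. -/
def localAt (q : Fin 4 → K) (I : Ideal (MvPolynomial (Fin 4) K)) :
    Ideal (MvPolynomial (Fin 4) K) where
  carrier := {F | ∃ g, eval q g ≠ 0 ∧ g * F ∈ I}
  zero_mem' := ⟨1, by simp, by simp⟩
  add_mem' := by
    rintro F F' ⟨g, hg, hF⟩ ⟨g', hg', hF'⟩
    refine ⟨g * g', by simp [hg, hg'], ?_⟩
    have : g * g' * (F + F') = g' * (g * F) + g * (g' * F') := by ring
    rw [this]
    exact I.add_mem (I.mul_mem_left _ hF) (I.mul_mem_left _ hF')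
  smul_mem' := by
    rintro A F ⟨g, hg, hF⟩
    refine ⟨g, hg, ?_⟩
    have : g * (A • F) = A * (g * F) := by simp only [smul_eq_mul]; ring
    rw [this]
    exact I.mul_mem_left _ hF

theorem mem_localAt {q : Fin 4 → K} {I : Ideal (MvPolynomial (Fin 4) K)}
    {F : MvPolynomial (Fin 4) K} : F ∈ localAt q I ↔ ∃ g, eval q g ≠ 0 ∧ g * F ∈ I := Iff.rfl

theorem le_localAt (q : Fin 4 → K) (I : Ideal (MvPolynomial (Fin 4) K)) : I ≤ localAt q I :=
  fun F hF => ⟨1, by simp, by simpa using hF⟩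

theorem localAt_mono {q : Fin 4 → K} {I I' : Ideal (MvPolynomial (Fin 4) K)} (h : I ≤ I') :
    localAt q I ≤ localAt q I' := fun _ ⟨g, hg, hF⟩ => ⟨g, hg, h hF⟩

theorem localAt_localAt (q : Fin 4 → K) (I : Ideal (MvPolynomial (Fin 4) K)) :
    localAt q (localAt q I) ≤ localAt q I := by
  rintro F ⟨g, hg, g', hg', hF⟩
  exact ⟨g' * g, by simp [hg, hg'], by rwa [mul_assoc]⟩

/-- Pieces that miss q become the unit ideal at q; this is how they drop out of a product of ideals.
-/
theorem localAt_eq_top {q : Fin 4 → K} {I : Ideal (MvPolynomial (Fin 4) K)}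
    {g : MvPolynomial (Fin 4) K} (hg : g ∈ I) (hq : eval q g ≠ 0) : localAt q I = ⊤ :=
  (Ideal.eq_top_iff_one _).2 ⟨g, hq, by simpa using hg⟩

theorem localAt_mul_le (q : Fin 4 → K) (I I' : Ideal (MvPolynomial (Fin 4) K)) :
    localAt q I * localAt q I' ≤ localAt q (I * I') := by
  refine Ideal.mul_le.2 ?_
  rintro F ⟨g, hg, hF⟩ F' ⟨g', hg', hF'⟩
  refine ⟨g * g', by simp [hg, hg'], ?_⟩
  rw [mul_mul_mul_comm]
  exact Ideal.mul_mem_mul hF hF'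

theorem prod_localAt_le {ι : Type*} (q : Fin 4 → K) (s : Finset ι)
    (I : ι → Ideal (MvPolynomial (Fin 4) K)) :
    ∏ α ∈ s, localAt q (I α) ≤ localAt q (∏ α ∈ s, I α) := by
  classical
  induction s using Finset.induction_on with
  | empty =>
    simp only [Finset.prod_empty, Ideal.one_eq_top]
    exact le_localAt q _
  | insert a s ha ih =>
    rw [Finset.prod_insert ha, Finset.prod_insert ha]
    exact (Ideal.mul_mono_right ih).trans (localAt_mul_le _ _ _)

/-- Locally at a point which lies on only one of the pieces, the product of the ideals of the pieces
contains the ideal of that piece. -/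
theorem le_localAt_prod {ι : Type*} [Fintype ι] {q : Fin 4 → K}
    {I : ι → Ideal (MvPolynomial (Fin 4) K)} (α : ι)
    (h : ∀ β, β ≠ α → ∃ g ∈ I β, eval q g ≠ 0) :
    I α ≤ localAt q (∏ β, I β) := by
  classical
  refine le_trans ?_ (prod_localAt_le q Finset.univ I)
  rw [← Finset.mul_prod_erase _ _ (Finset.mem_univ α), Finset.prod_eq_one, mul_one]
  · exact le_localAt q _
  · intro β hβ
    obtain ⟨g, hg, hq⟩ := h β (Finset.ne_of_mem_erase hβ)
    rw [localAt_eq_top hg hq, Ideal.one_eq_top]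

/-- The analogue of `le_localAt_prod` for a point which lies on two of the pieces. -/
theorem mul_le_localAt_prod {ι : Type*} [Fintype ι] {q : Fin 4 → K}
    {I : ι → Ideal (MvPolynomial (Fin 4) K)} {α β : ι} (hαβ : α ≠ β)
    (h : ∀ γ, γ ≠ α → γ ≠ β → ∃ g ∈ I γ, eval q g ≠ 0) :
    localAt q (I α) * localAt q (I β) ≤ localAt q (∏ β, I β) := by
  classical
  refine le_trans ?_ (prod_localAt_le q Finset.univ I)
  rw [← Finset.mul_prod_erase _ _ (Finset.mem_univ α),
    ← Finset.mul_prod_erase _ _ (Finset.mem_erase.2 ⟨hαβ.symm, Finset.mem_univ β⟩),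
    Finset.prod_eq_one, mul_one]
  intro γ hγ
  obtain ⟨g, hg, hq⟩ := h γ (Finset.ne_of_mem_erase (Finset.mem_of_mem_erase hγ))
    (Finset.ne_of_mem_erase hγ)
  rw [localAt_eq_top hg hq, Ideal.one_eq_top]

theorem le_saturation (I : Ideal (MvPolynomial (Fin 4) K)) : I ≤ saturation I := by
  refine le_trans ?_ (le_iSup _ 0)
  intro F hF
  rw [Submodule.mem_colon]
  exact fun s _ => I.mul_mem_right s hF

/-- Makes the supremum in `saturation` a union, so that membership is witnessed by a single power.
-/
theorem directed_colon_pow (I : Ideal (MvPolynomial (Fin 4) K)) :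
    Directed (· ≤ ·) fun n : ℕ => Submodule.colon I
      ((Ideal.span (Set.range X) ^ n : Ideal (MvPolynomial (Fin 4) K)) :
        Set (MvPolynomial (Fin 4) K)) := by
  refine Monotone.directed_le fun m n hmn F hF => ?_
  rw [Submodule.mem_colon] at hF ⊢
  exact fun s hs => hF s (Ideal.pow_le_pow_right hmn hs)

/-- Saturation is a local condition at all the points different from the origin. -/
theorem mem_saturation_iff [IsAlgClosed K] {I : Ideal (MvPolynomial (Fin 4) K)}
    {F : MvPolynomial (Fin 4) K} : F ∈ saturation I ↔ ∀ q, q ≠ 0 → F ∈ localAt q I := by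
  rw [saturation, Submodule.mem_iSup_of_directed _ (directed_colon_pow I)]
  constructor
  · rintro ⟨n, hn⟩ q hq
    obtain ⟨i, hi⟩ := Function.ne_iff.1 hq
    refine ⟨X i ^ n, by simpa using fun h => absurd h hi, ?_⟩
    rw [Submodule.mem_colon] at hn
    have := hn (X i ^ n) (Ideal.pow_mem_pow (Ideal.subset_span (Set.mem_range_self i)) n)
    rwa [smul_eq_mul, mul_comm] at this
  · intro h
    -- The multipliers that carry F into I have no common zero except possibly the origin. By the
    -- Nullstellensatz some power of the irrelevant ideal consists of such multipliers.
    let A : Ideal (MvPolynomial (Fin 4) K) := Submodule.colon I {F}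
    have hA : Ideal.span (Set.range X) ≤ A.radical := by
      rw [← vanishingIdeal_zeroLocus_eq_radical (K := K), Ideal.span_le]
      rintro _ ⟨i, rfl⟩
      rw [SetLike.mem_coe, mem_vanishing]
      intro w hw
      by_cases h0 : w = 0
      · simp [h0]
      · obtain ⟨g, hg, hgF⟩ := h w h0
        refine absurd ?_ hg
        have := hw g (by
          rw [Submodule.mem_colon]
          rintro _ rfl
          exact hgF)
        simpa [aeval_eq_eval] using this
    obtain ⟨n, hn⟩ := Ideal.exists_pow_le_of_le_radical_of_fg hA
      (Submodule.fg_span (Set.finite_range _))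
    refine ⟨n, ?_⟩
    rw [Submodule.mem_colon]
    intro s hs
    have := hn hs
    rw [Submodule.mem_colon] at this
    have := this F rfl
    rwa [smul_eq_mul, mul_comm] at this

end Local

/-! ### Restriction to lines and directional derivatives -/

section Restriction

variable {K : Type*} [Field K]

/-- The restriction of a polynomial to the parametrized line `q + t n`. -/
noncomputable def restrictLine (q n : Fin 4 → K) : MvPolynomial (Fin 4) K →ₐ[K] Polynomial K :=
  aeval fun i => Polynomial.C (q i) + Polynomial.X * Polynomial.C (n i)

theorem restrictLine_X (q n : Fin 4 → K) (i : Fin 4) :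
    restrictLine q n (X i) = Polynomial.C (q i) + Polynomial.X * Polynomial.C (n i) :=
  aeval_X _ _

theorem eval_restrictLine (q n : Fin 4 → K) (F : MvPolynomial (Fin 4) K) (t : K) :
    (restrictLine q n F).eval t = eval (q + t • n) F := by
  induction F using MvPolynomial.induction_on with
  | C a => simp [restrictLine]
  | add p r hp hr => simp [hp, hr]
  | mul_X p i hp => 
    rw [map_mul, Polynomial.eval_mul, hp, restrictLine_X, map_mul, eval_X]
    simp only [Polynomial.eval_add, Polynomial.eval_mul, Polynomial.eval_C, Polynomial.eval_X,
      Pi.add_apply, Pi.smul_apply, smul_eq_mul]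

/-- The derivative of `F` at `q` in the direction `n`. -/
noncomputable def dirDeriv (q n : Fin 4 → K) (F : MvPolynomial (Fin 4) K) : K :=
  ∑ i, n i * eval q (pderiv i F)

theorem dirDeriv_add (q n : Fin 4 → K) (F G : MvPolynomial (Fin 4) K) :
    dirDeriv q n (F + G) = dirDeriv q n F + dirDeriv q n G := by
  simp [dirDeriv, mul_add, Finset.sum_add_distrib]

theorem dirDeriv_mul (q n : Fin 4 → K) (F G : MvPolynomial (Fin 4) K) :
    dirDeriv q n (F * G) = eval q F * dirDeriv q n G + eval q G * dirDeriv q n F := by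
  simp only [dirDeriv, Derivation.leibniz, smul_eq_mul, map_add, map_mul, mul_add,
    Finset.sum_add_distrib, Finset.mul_sum]
  congr 1 <;> exact Finset.sum_congr rfl fun i _ => by ring

theorem dirDeriv_X (q n : Fin 4 → K) (i : Fin 4) : dirDeriv q n (X i) = n i := by
  simp [dirDeriv, pderiv_X, Pi.single_apply, apply_ite]

theorem dirDeriv_sum {ι : Type*} (q n : Fin 4 → K) (s : Finset ι)
    (F : ι → MvPolynomial (Fin 4) K) :
    dirDeriv q n (∑ i ∈ s, F i) = ∑ i ∈ s, dirDeriv q n (F i) := by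
  simp only [dirDeriv, map_sum, Finset.mul_sum]
  exact Finset.sum_comm

/-- `dirDeriv` as a linear form in the direction. -/
noncomputable def dirDerivₗ (q : Fin 4 → K) (F : MvPolynomial (Fin 4) K) :
    (Fin 4 → K) →ₗ[K] K where
  toFun n := dirDeriv q n F
  map_add' m n := by simp [dirDeriv, add_mul, Finset.sum_add_distrib]
  map_smul' c n := by simp [dirDeriv, Finset.mul_sum, mul_assoc]

theorem dirDerivₗ_apply (q n : Fin 4 → K) (F : MvPolynomial (Fin 4) K) :
    dirDerivₗ q F n = dirDeriv q n F := rfl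

theorem coeff_zero_restrictLine (q n : Fin 4 → K) (F : MvPolynomial (Fin 4) K) :
    (restrictLine q n F).coeff 0 = eval q F := by
  rw [Polynomial.coeff_zero_eq_eval_zero, eval_restrictLine]; simp

theorem coeff_one_restrictLine (q n : Fin 4 → K) (F : MvPolynomial (Fin 4) K) :
    (restrictLine q n F).coeff 1 = dirDeriv q n F := by
  induction F using MvPolynomial.induction_on with
  | C a => simp [restrictLine, dirDeriv]
  | add p r hp hr => rw [map_add, Polynomial.coeff_add, hp, hr, dirDeriv_add]
  | mul_X p i hp =>
    rw [map_mul, Polynomial.coeff_mul, Finset.Nat.antidiagonal_succ]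
    simp only [Finset.Nat.antidiagonal_zero, Finset.map_singleton, Finset.sum_cons,
      Finset.sum_singleton, Function.Embedding.prodMap, Function.Embedding.coeFn_mk, Prod.map,
      Function.Embedding.refl_apply, Nat.succ_eq_add_one, zero_add, coeff_zero_restrictLine, hp,
      restrictLine_X, dirDeriv_mul, dirDeriv_X]
    simp
    ring

theorem restrictLine_eq_zero [Infinite K] {q n : Fin 4 → K} {F : MvPolynomial (Fin 4) K}
    (h : ∀ t : K, t ≠ 0 → eval (q + t • n) F = 0) : restrictLine q n F = 0 := by
  refine Polynomial.eq_zero_of_infinite_isRoot _ (Set.Infinite.mono ?_ (Set.finite_singleton (0 : K)).infinite_compl)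
  intro t ht
  rw [Set.mem_ofPred, Polynomial.IsRoot, eval_restrictLine]
  exact h t ht

/-- A density argument: it recovers values at the origin, which saturation does not see, and at
points of H, which division by x₃ does not see. -/
theorem eval_eq_zero_of_line [Infinite K] {q n : Fin 4 → K} {F : MvPolynomial (Fin 4) K}
    (h : ∀ t : K, t ≠ 0 → eval (q + t • n) F = 0) : eval q F = 0 := by
  rw [← coeff_zero_restrictLine q n, restrictLine_eq_zero h, Polynomial.coeff_zero]

theorem dirDeriv_eq_zero_of_line [Infinite K] {q n : Fin 4 → K} {F : MvPolynomial (Fin 4) K}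
    (h : ∀ t : K, eval (q + t • n) F = 0) : dirDeriv q n F = 0 := by
  rw [← coeff_one_restrictLine q n, restrictLine_eq_zero fun t _ => h t, Polynomial.coeff_zero]

end Restriction

/-! ### Linear forms and ideals of linear subspaces -/

section LinearForms

variable {K : Type*} [Field K]

/-- A linear form as a polynomial. -/
noncomputable def linearPoly (φ : (Fin 4 → K) →ₗ[K] K) : MvPolynomial (Fin 4) K :=
  ∑ j, C (φ (Pi.single j 1)) * X j

@[simp] theorem eval_linearPoly (φ : (Fin 4 → K) →ₗ[K] K) (w : Fin 4 → K) :
    eval w (linearPoly φ) = φ w := by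
  rw [linearPoly, map_sum]
  conv_rhs => rw [LinearMap.pi_apply_eq_sum_univ φ w]
  refine Finset.sum_congr rfl fun j _ => ?_
  rw [map_mul, eval_C, eval_X, smul_eq_mul, mul_comm]
  congr 2
  ext i
  simp [Pi.single_apply, eq_comm]

theorem dirDeriv_linearPoly (φ : (Fin 4 → K) →ₗ[K] K) (q n : Fin 4 → K) :
    dirDeriv q n (linearPoly φ) = φ n := by
  conv_rhs => rw [← eval_linearPoly]
  have h (c : K) : dirDeriv q n (C c) = 0 := by simp [dirDeriv]
  simp [linearPoly, dirDeriv_sum, dirDeriv_mul, dirDeriv_X, h]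

theorem linearPoly_sum {ι : Type*} (s : Finset ι) (c : ι → K) (φ : ι → (Fin 4 → K) →ₗ[K] K) :
    linearPoly (∑ i ∈ s, c i • φ i) = ∑ i ∈ s, C (c i) * linearPoly (φ i) := by
  simp only [linearPoly, LinearMap.sum_apply, LinearMap.smul_apply, smul_eq_mul, map_sum, map_mul,
    Finset.sum_mul, Finset.mul_sum]
  rw [Finset.sum_comm]
  exact Finset.sum_congr rfl fun i _ => Finset.sum_congr rfl fun j _ => by ring

theorem linearPoly_proj (j : Fin 4) : linearPoly (LinearMap.proj j : (Fin 4 → K) →ₗ[K] K) = X j := by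
  simp [linearPoly, Pi.single_apply, apply_ite]

/-- If a linear projection to `W` is the identity modulo the ideal `I`, then `I` contains the ideal of
`W`. -/
theorem vanishing_le_of_projection [Infinite K] {W : Submodule K (Fin 4 → K)}
    (P : (Fin 4 → K) →ₗ[K] (Fin 4 → K)) (hP : ∀ w, P w ∈ W) {I : Ideal (MvPolynomial (Fin 4) K)}
    (hI : ∀ j, X j - linearPoly (LinearMap.proj j ∘ₗ P) ∈ I) :
    vanishingIdeal K (W : Set (Fin 4 → K)) ≤ I := by
  intro F hF
  rw [mem_vanishing] at hF
  -- The substitution f is composition with P. It kills F because P takes values in W, and it is the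
  -- identity modulo I; hence F is congruent to zero.
  let f : MvPolynomial (Fin 4) K →ₐ[K] MvPolynomial (Fin 4) K :=
    aeval fun j => linearPoly (LinearMap.proj j ∘ₗ P)
  have h0 : f F = 0 := by
    refine MvPolynomial.funext fun w => ?_
    have : eval w (f F) = eval (P w) F := by
      have h : (aeval w : _ →ₐ[K] K).comp f = aeval (P w) := by
        refine MvPolynomial.algHom_ext fun j => ?_
        simp [f, aeval_eq_eval]
      simpa [aeval_eq_eval] using DFunLike.congr_fun h F
    rw [this, map_zero]
    exact hF _ (hP w)
  have h1 : (Ideal.Quotient.mkₐ K I).comp f = Ideal.Quotient.mkₐ K I := by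
    refine MvPolynomial.algHom_ext fun j => ?_
    simp only [AlgHom.comp_apply, f, aeval_X, Ideal.Quotient.mkₐ_eq_mk]
    exact (Ideal.Quotient.eq.2 (hI j)).symm
  have h2 := DFunLike.congr_fun h1 F
  rw [AlgHom.comp_apply, h0, map_zero, eq_comm, Ideal.Quotient.mkₐ_eq_mk,
    Ideal.Quotient.eq_zero_iff_mem] at h2
  exact h2

/-- The coordinate forms of a basis, as polynomials. -/
noncomputable def coordPoly (b : Module.Basis (Fin 4) K (Fin 4 → K)) (i : Fin 4) :
    MvPolynomial (Fin 4) K := linearPoly (b.coord i)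

theorem eval_coordPoly (b : Module.Basis (Fin 4) K (Fin 4 → K)) (i : Fin 4) (w : Fin 4 → K) :
    eval w (coordPoly b i) = b.coord i w := eval_linearPoly _ _

theorem linearPoly_eq_sum_coordPoly (b : Module.Basis (Fin 4) K (Fin 4 → K))
    (φ : (Fin 4 → K) →ₗ[K] K) : linearPoly φ = ∑ i, C (φ (b i)) * coordPoly b i := by
  have : φ = ∑ i, φ (b i) • b.coord i := by
    refine b.ext fun j => ?_
    simp
  conv_lhs => rw [this]
  rw [linearPoly_sum]
  rfl

theorem X_eq_sum_coordPoly (b : Module.Basis (Fin 4) K (Fin 4 → K)) (j : Fin 4) :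
    X j = ∑ i, C (b i j) * coordPoly b i := by
  rw [← linearPoly_proj, linearPoly_eq_sum_coordPoly b]
  rfl

theorem coordPoly_mem_vanishing (b : Module.Basis (Fin 4) K (Fin 4 → K)) {s : Set (Fin 4)}
    {i : Fin 4} (hi : i ∉ s) :
    coordPoly b i ∈ vanishingIdeal K (Submodule.span K (b '' s) : Set (Fin 4 → K)) := by
  rw [mem_vanishing]
  intro w hw
  rw [eval_coordPoly]
  have : Submodule.span K (b '' s) ≤ LinearMap.ker (b.coord i) := by
    rw [Submodule.span_le]
    rintro _ ⟨j, hj, rfl⟩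
    have : j ≠ i := fun h => hi (h ▸ hj)
    simp [this]
  exact this hw

/-- The ideal of a coordinate subspace is generated by the remaining coordinates. -/
theorem vanishing_span_le [Infinite K] (b : Module.Basis (Fin 4) K (Fin 4 → K)) (s : Set (Fin 4)) :
    vanishingIdeal K (Submodule.span K (b '' s) : Set (Fin 4 → K)) ≤
      Ideal.span (coordPoly b '' sᶜ) := by
  classical
  let P : (Fin 4 → K) →ₗ[K] (Fin 4 → K) :=
    ∑ i, if i ∈ s then (b.coord i).smulRight (b i) else 0
  refine vanishing_le_of_projection P (fun w => ?_) fun j => ?_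
  · simp only [P, LinearMap.sum_apply]
    refine Submodule.sum_mem _ fun i _ => ?_
    split_ifs with h
    · exact Submodule.smul_mem _ _ (Submodule.subset_span ⟨i, h, rfl⟩)
    · exact Submodule.zero_mem _
  · rw [X_eq_sum_coordPoly b, linearPoly_eq_sum_coordPoly b, ← Finset.sum_sub_distrib]
    refine Ideal.sum_mem _ fun i _ => ?_
    by_cases h : i ∈ s
    · have : P (b i) = b i := by
        simp only [P, LinearMap.sum_apply]
        rw [Finset.sum_eq_single i]
        · simp [h]
        · intro k _ hk
          split_ifs <;> simp [hk.symm]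
        · simp
      simp [this]
    · exact Ideal.sub_mem _
        (Ideal.mul_mem_left _ _ (Ideal.subset_span ⟨i, h, rfl⟩))
        (Ideal.mul_mem_left _ _ (Ideal.subset_span ⟨i, h, rfl⟩))

end LinearForms

/-! ### Adapted bases and the ideals of points, lines, crosses and their traces -/

section Frames

variable {K : Type*} [Field K]

theorem exists_linearIndependent_cons {r : ℕ} (hr : r < 4) {v : Fin r → Fin 4 → K}
    (hv : LinearIndependent K v) :
    ∃ n : Fin 4 → K, LinearIndependent K (Matrix.vecCons n v) := by
  have h : Submodule.span K (Set.range v) ≠ ⊤ := by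
    intro h
    have h1 := finrank_span_eq_card hv
    rw [h, finrank_top] at h1
    simp at h1
    omega
  obtain ⟨n, hn⟩ : ∃ n, n ∉ Submodule.span K (Set.range v) := by
    by_contra! hc
    exact h (Submodule.eq_top_iff'.2 hc)
  exact ⟨n, linearIndependent_finCons.2 ⟨hv, hn⟩⟩

theorem exists_basis_of_linearIndependent {v : Fin 4 → Fin 4 → K} (hv : LinearIndependent K v) :
    ∃ b : Module.Basis (Fin 4) K (Fin 4 → K), ∀ i, b i = v i :=
  ⟨basisOfLinearIndependentOfCardEqFinrank hv (by simp), fun i => by simp⟩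

theorem exists_basis_of_triple {p q₁ q₂ : Fin 4 → K} (h : LinearIndependent K ![p, q₁, q₂]) :
    ∃ b : Module.Basis (Fin 4) K (Fin 4 → K), b 1 = p ∧ b 2 = q₁ ∧ b 3 = q₂ := by
  obtain ⟨n, hn⟩ := exists_linearIndependent_cons (by norm_num) h
  obtain ⟨b, hb⟩ := exists_basis_of_linearIndependent hn
  exact ⟨b, hb 1, hb 2, hb 3⟩

theorem exists_triple_of_pair {p u : Fin 4 → K} (h : LinearIndependent K ![p, u]) :
    ∃ n, LinearIndependent K ![n, p, u] :=
  exists_linearIndependent_cons (by norm_num) h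

theorem spanPair_eq_image (b : Module.Basis (Fin 4) K (Fin 4 → K)) (i j : Fin 4) :
    spanPair (b i) (b j) = (Submodule.span K (b '' {i, j}) : Set (Fin 4 → K)) := by
  rw [spanPair, Set.image_pair]

theorem pointCone_eq_image (b : Module.Basis (Fin 4) K (Fin 4 → K)) (i : Fin 4) :
    pointCone (b i) = (Submodule.span K (b '' {i}) : Set (Fin 4 → K)) := by
  rw [pointCone, Set.image_singleton]

/-- The ideal of the cone over a point, in terms of a basis. -/
theorem vanishing_pointCone_le [Infinite K] (b : Module.Basis (Fin 4) K (Fin 4 → K)) {i : Fin 4}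
    {I : Ideal (MvPolynomial (Fin 4) K)} (h : ∀ j, j ≠ i → coordPoly b j ∈ I) :
    vanishingIdeal K (pointCone (b i)) ≤ I := by
  rw [pointCone_eq_image]
  refine (vanishing_span_le b _).trans (Ideal.span_le.2 ?_)
  rintro _ ⟨j, hj, rfl⟩
  exact h j hj

theorem vanishing_spanPair_le [Infinite K] (b : Module.Basis (Fin 4) K (Fin 4 → K)) {i i' : Fin 4}
    {I : Ideal (MvPolynomial (Fin 4) K)} (h : ∀ j, j ≠ i → j ≠ i' → coordPoly b j ∈ I) :
    vanishingIdeal K (spanPair (b i) (b i')) ≤ I := by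
  rw [spanPair_eq_image]
  refine (vanishing_span_le b _).trans (Ideal.span_le.2 ?_)
  rintro _ ⟨j, hj, rfl⟩
  simp only [Set.mem_compl_iff, Set.mem_insert_iff, Set.mem_singleton_iff, not_or] at hj
  exact h j hj.1 hj.2

theorem coordPoly_mem_pointCone (b : Module.Basis (Fin 4) K (Fin 4 → K)) {i j : Fin 4}
    (h : j ≠ i) : coordPoly b j ∈ vanishingIdeal K (pointCone (b i)) := by
  rw [pointCone_eq_image]
  exact coordPoly_mem_vanishing b h

theorem coordPoly_mem_spanPair (b : Module.Basis (Fin 4) K (Fin 4 → K)) {i i' j : Fin 4}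
    (h : j ≠ i) (h' : j ≠ i') : coordPoly b j ∈ vanishingIdeal K (spanPair (b i) (b i')) := by
  rw [spanPair_eq_image]
  exact coordPoly_mem_vanishing b (by simp [h, h'])

/-- The ideal of a plane times the ideal of a point `p` of it is contained in the product of the ideals
of two lines of the plane meeting in `p`. -/
theorem vanishing_plane_mul_point_le [Infinite K] {p q₁ q₂ : Fin 4 → K}
    (h : LinearIndependent K ![p, q₁, q₂]) {A F : MvPolynomial (Fin 4) K}
    (hA₁ : A ∈ vanishingIdeal K (spanPair p q₁)) (hA₂ : A ∈ vanishingIdeal K (spanPair p q₂))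
    (hF : F ∈ vanishingIdeal K (pointCone p)) :
    A * F ∈ vanishingIdeal K (spanPair p q₁) * vanishingIdeal K (spanPair p q₂) := by
  obtain ⟨b, rfl, rfl, rfl⟩ := exists_basis_of_triple h
  -- The ideal of the point is the sum of the ideals of the two lines. Each summand of F is
  -- multiplied by A, which is read as an element of the ideal of the other line.
  have key : vanishingIdeal K (pointCone (b 1)) ≤
      vanishingIdeal K (spanPair (b 1) (b 2)) ⊔ vanishingIdeal K (spanPair (b 1) (b 3)) := by
    refine vanishing_pointCone_le b fun j hj => ?_
    by_cases h2 : j = 2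
    · exact Ideal.mem_sup_right (coordPoly_mem_spanPair b hj (by simp [h2]))
    · exact Ideal.mem_sup_left (coordPoly_mem_spanPair b hj h2)
  obtain ⟨F₁, h₁, F₂, h₂, rfl⟩ := Submodule.mem_sup.1 (key hF)
  rw [mul_add]
  refine Ideal.add_mem _ ?_ (Ideal.mul_mem_mul hA₁ h₂)
  rw [mul_comm A]
  exact Ideal.mul_mem_mul h₁ hA₂

/-- The ideal of a cross is generated by the plane which contains it and by the products of forms
vanishing on its two lines. -/
theorem vanishing_inf_le [Infinite K] {p q₁ q₂ : Fin 4 → K}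
    (h : LinearIndependent K ![p, q₁, q₂]) {J : Ideal (MvPolynomial (Fin 4) K)}
    (hJ : ∀ φ : (Fin 4 → K) →ₗ[K] K, φ p = 0 → φ q₁ = 0 → φ q₂ = 0 → linearPoly φ ∈ J) :
    vanishingIdeal K (spanPair p q₁) ⊓ vanishingIdeal K (spanPair p q₂) ≤
      J ⊔ vanishingIdeal K (spanPair p q₁) * vanishingIdeal K (spanPair p q₂) := by
  obtain ⟨b, rfl, rfl, rfl⟩ := exists_basis_of_triple h
  rintro F ⟨h₁, h₂⟩
  have h0 : coordPoly b 0 ∈ J := hJ _ (by simp) (by simp) (by simp)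
  -- Write F = A y₀ + B y₃ with y₀ the equation of the plane. On the second line F and y₀ vanish,
  -- whereas y₃ vanishes only on the cone over p; so B vanishes on the second line, first off p and
  -- then by density.
  have key : vanishingIdeal K (spanPair (b 1) (b 2)) ≤ Ideal.span {coordPoly b 0, coordPoly b 3} := by
    refine vanishing_spanPair_le b fun j hj hj' => Ideal.subset_span ?_
    obtain rfl | rfl : j = 0 ∨ j = 3 := by revert j; decide
    all_goals simp only [Set.mem_insert_iff, Set.mem_singleton_iff, true_or, or_true]
  obtain ⟨A, B, rfl⟩ := Ideal.mem_span_pair.1 (key h₁)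
  refine Ideal.add_mem _ (Ideal.mem_sup_left (J.mul_mem_left _ h0)) (Ideal.mem_sup_right ?_)
  rw [mul_comm B]
  refine Ideal.mul_mem_mul (coordPoly_mem_spanPair b (by simp) (by simp)) ?_
  have hs : ∀ s t : K, s • b 1 + t • b 3 ∈ spanPair (b 1) (b 3) := fun s t =>
    Submodule.add_mem _ (Submodule.smul_mem _ _ (Submodule.subset_span (by simp)))
      (Submodule.smul_mem _ _ (Submodule.subset_span (by simp)))
  have hne : ∀ s t : K, t ≠ 0 → eval (s • b 1 + t • b 3) B = 0 := by
    intro s t ht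
    have := mem_vanishing.1 h₂ _ (hs s t)
    simpa [eval_coordPoly, ht] using this
  rw [mem_vanishing]
  intro w hw
  obtain ⟨s, t, rfl⟩ := Submodule.mem_span_pair.1 hw
  by_cases ht : t = 0
  · refine eval_eq_zero_of_line (n := b 3) fun r hr => ?_
    have := hne s r hr
    simpa [ht] using this
  · exact hne s t ht

/-- All products of two of a, b, c lie in I₁I₂ except b² and c². Multiplying the relation for x by b
or by c expresses these two through x and the other products, as u and v are units. -/
theorem span_triple_sq_le {R : Type*} [CommRing R] {I₁ I₂ : Ideal R} {x a b c w u v u' v' : R}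
    (hx : x = w * a + u * b + v * c) (hu : u' * u = 1) (hv : v' * v = 1)
    (ha₁ : a ∈ I₁) (ha₂ : a ∈ I₂) (hb : b ∈ I₂) (hc : c ∈ I₁) :
    Ideal.span {a, b, c} ^ 2 ≤ Ideal.span {x} ⊔ I₁ * I₂ := by
  set J := Ideal.span {x} ⊔ I₁ * I₂
  have hxJ : x ∈ J := Ideal.mem_sup_left (Ideal.subset_span rfl)
  have haa : a * a ∈ J := Ideal.mem_sup_right (Ideal.mul_mem_mul ha₁ ha₂)
  have hab : a * b ∈ J := Ideal.mem_sup_right (Ideal.mul_mem_mul ha₁ hb)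
  have hca : c * a ∈ J := Ideal.mem_sup_right (Ideal.mul_mem_mul hc ha₂)
  have hcb : c * b ∈ J := Ideal.mem_sup_right (Ideal.mul_mem_mul hc hb)
  have hbb : b * b ∈ J := by
    have : b * b = u' * (b * x - w * (a * b) - v * (c * b)) := by
      rw [hx]
      linear_combination (-b * b) * hu
    rw [this]
    exact J.mul_mem_left _ (J.sub_mem (J.sub_mem (J.mul_mem_left _ hxJ) (J.mul_mem_left _ hab))
      (J.mul_mem_left _ hcb))
  have hcc : c * c ∈ J := by
    have : c * c = v' * (c * x - w * (c * a) - u * (c * b)) := by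
      rw [hx]
      linear_combination (-c * c) * hv
    rw [this]
    exact J.mul_mem_left _ (J.sub_mem (J.sub_mem (J.mul_mem_left _ hxJ) (J.mul_mem_left _ hca))
      (J.mul_mem_left _ hcb))
  have hba : b * a ∈ J := mul_comm a b ▸ hab
  have hac : a * c ∈ J := mul_comm c a ▸ hca
  have hbc : b * c ∈ J := mul_comm c b ▸ hcb
  rw [pow_two, Ideal.span_mul_span', Ideal.span_le]
  rintro _ ⟨A, hA, B, hB, rfl⟩
  simp only [Set.mem_insert_iff, Set.mem_singleton_iff] at hA hB
  rcases hA with rfl | rfl | rfl <;> rcases hB with rfl | rfl | rfl <;> assumption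

/-- Two lines transversal to `H` and meeting in the point `p ∈ H`: modulo `x₃`, the square of the ideal
of `p` is contained in the product of the ideals of the lines. -/
theorem vanishing_point_sq_le [Infinite K] {p q₁ q₂ : Fin 4 → K}
    (h : LinearIndependent K ![p, q₁, q₂]) (hp : p 3 = 0) (h₁ : q₁ 3 ≠ 0) (h₂ : q₂ 3 ≠ 0) :
    vanishingIdeal K (pointCone p) ^ 2 ≤ Ideal.span {X 3} ⊔
      vanishingIdeal K (spanPair p q₁) * vanishingIdeal K (spanPair p q₂) := by
  obtain ⟨b, rfl, rfl, rfl⟩ := exists_basis_of_triple h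
  have key : vanishingIdeal K (pointCone (b 1)) ≤
      Ideal.span {coordPoly b 0, coordPoly b 2, coordPoly b 3} := by
    refine vanishing_pointCone_le b fun j hj => Ideal.subset_span ?_
    obtain rfl | rfl | rfl : j = 0 ∨ j = 2 ∨ j = 3 := by revert j; decide
    all_goals simp only [Set.mem_insert_iff, Set.mem_singleton_iff, true_or, or_true]
  have hX := X_eq_sum_coordPoly b 3
  rw [Fin.sum_univ_four, hp, C_0, zero_mul, add_zero] at hX
  have inv {c : K} (hc : c ≠ 0) : (C c⁻¹ * C c : MvPolynomial (Fin 4) K) = 1 := by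
    rw [← C_mul, inv_mul_cancel₀ hc, C_1]
  exact (Ideal.pow_right_mono key 2).trans (span_triple_sq_le hX (inv h₁) (inv h₂)
    (coordPoly_mem_spanPair b (by simp) (by simp)) (coordPoly_mem_spanPair b (by simp) (by simp))
    (coordPoly_mem_spanPair b (by simp) (by simp)) (coordPoly_mem_spanPair b (by simp) (by simp)))

/-- The trace on `H` of a line transversal to `H`. -/
theorem vanishing_point_le [Infinite K] {p u : Fin 4 → K} (h : LinearIndependent K ![p, u])
    (hp : p 3 = 0) (hu : u 3 ≠ 0) :
    vanishingIdeal K (pointCone p) ≤ Ideal.span {X 3} ⊔ vanishingIdeal K (spanPair p u) := by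
  obtain ⟨n, hn⟩ := exists_triple_of_pair h
  obtain ⟨b, rfl, rfl, rfl⟩ := exists_basis_of_triple hn
  have hX := X_eq_sum_coordPoly b 3
  rw [Fin.sum_univ_four, hp, C_0, zero_mul, add_zero] at hX
  set J := Ideal.span {X 3} ⊔ vanishingIdeal K (spanPair (b 2) (b 3))
  have x3 : (X 3 : MvPolynomial (Fin 4) K) ∈ J :=
    Ideal.mem_sup_left (Ideal.subset_span rfl)
  have h0 : coordPoly b 0 ∈ J :=
    Ideal.mem_sup_right (coordPoly_mem_spanPair b (by simp) (by simp))
  have h1 : coordPoly b 1 ∈ J :=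
    Ideal.mem_sup_right (coordPoly_mem_spanPair b (by simp) (by simp))
  have h3 : coordPoly b 3 ∈ J := by
    have : coordPoly b 3 = C (b 3 3)⁻¹ * (X 3 - C (b 0 3) * coordPoly b 0
        - C (b 1 3) * coordPoly b 1) := by
      have h1 : (C (b 3 3)⁻¹ * C (b 3 3) : MvPolynomial (Fin 4) K) = 1 := by
        rw [← C_mul, inv_mul_cancel₀ hu, C_1]
      rw [hX]
      linear_combination (-coordPoly b 3) * h1
    rw [this]
    exact J.mul_mem_left _ (J.sub_mem (J.sub_mem x3 (J.mul_mem_left _ h0)) (J.mul_mem_left _ h1))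
  refine vanishing_pointCone_le b fun j hj => ?_
  obtain rfl | rfl | rfl : j = 0 ∨ j = 1 ∨ j = 3 := by clear * - hj; revert j; decide
  exacts [h0, h1, h3]

/-- The trace on `H` of a plane meeting `H` in the line spanned by `p` and `d`. -/
theorem vanishing_spanPair_le_plane [Infinite K] {p q₁ q₂ : Fin 4 → K}
    (h : LinearIndependent K ![p, q₁, q₂]) (hp : p 3 = 0) (h₁ : q₁ 3 ≠ 0)
    {J : Ideal (MvPolynomial (Fin 4) K)} (hX : X 3 ∈ J)
    (hJ : ∀ φ : (Fin 4 → K) →ₗ[K] K, φ p = 0 → φ q₁ = 0 → φ q₂ = 0 → linearPoly φ ∈ J) :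
    vanishingIdeal K (spanPair p (q₁ 3 • q₂ - q₂ 3 • q₁)) ≤ J := by
  -- The third vector is the combination of q₁ and q₂ that lies in H. In the new frame, H and the
  -- plane together cut out the span of the first and third vectors.
  have h' : LinearIndependent K ![p, q₁, q₁ 3 • q₂ - q₂ 3 • q₁] := by
    rw [Fintype.linearIndependent_iff] at h ⊢
    intro g hg
    have hg' := h ![g 0, g 1 - g 2 * q₂ 3, g 2 * q₁ 3] (by
      rw [Fin.sum_univ_three] at hg ⊢
      rw [← hg]
      simp only [Matrix.cons_val_zero, Matrix.cons_val_one, Matrix.cons_val, smul_sub, sub_smul,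
        mul_smul]
      abel)
    have g0 : g 0 = 0 := hg' 0
    have g1 : g 1 - g 2 * q₂ 3 = 0 := hg' 1
    have g2 : g 2 = 0 := (mul_eq_zero.1 (hg' 2)).resolve_right h₁
    rw [g2, zero_mul, sub_zero] at g1
    intro i
    fin_cases i <;> assumption
  obtain ⟨b, hb1, hb2, hb3⟩ := exists_basis_of_triple h'
  have hX' := X_eq_sum_coordPoly b 3
  have e3 : b 3 3 = 0 := by rw [hb3]; simp [mul_comm]
  have e1 : b 1 3 = 0 := by rw [hb1, hp]
  have e2 : b 2 3 ≠ 0 := by rwa [hb2]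
  have h0 : coordPoly b 0 ∈ J := by
    have a1 : b.coord 0 p = 0 := by rw [← hb1]; simp
    have a2 : b.coord 0 q₁ = 0 := by rw [← hb2]; simp
    have a3 : b.coord 0 (q₁ 3 • q₂ - q₂ 3 • q₁) = 0 := by rw [← hb3]; simp
    refine hJ _ a1 a2 ?_
    rw [map_sub, map_smul, map_smul, a2, smul_zero, sub_zero, smul_eq_mul] at a3
    exact (mul_eq_zero.1 a3).resolve_left h₁
  rw [Fin.sum_univ_four, e1, e3, C_0, zero_mul, add_zero, zero_mul, add_zero] at hX'
  have h2 : coordPoly b 2 ∈ J := by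
    have : coordPoly b 2 = C (b 2 3)⁻¹ * (X 3 - C (b 0 3) * coordPoly b 0) := by
      have h1 : (C (b 2 3)⁻¹ * C (b 2 3) : MvPolynomial (Fin 4) K) = 1 := by
        rw [← C_mul, inv_mul_cancel₀ e2, C_1]
      rw [hX']
      linear_combination (-coordPoly b 2) * h1
    rw [this]
    exact J.mul_mem_left _ (J.sub_mem hX (J.mul_mem_left _ h0))
  rw [← hb1, ← hb3]
  refine vanishing_spanPair_le b fun j hj hj' => ?_
  obtain rfl | rfl : j = 0 ∨ j = 2 := by clear * - hj hj'; revert j; decide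
  exacts [h0, h2]

/-- A polynomial which vanishes on the cone over a point, together with its derivatives in some
coordinate directions, lies in the square of the ideal of the point modulo the other coordinates. -/
theorem mem_sq_sup_of_dirDeriv [Infinite K] (b : Module.Basis (Fin 4) K (Fin 4 → K)) (i : Fin 4)
    (s : Set (Fin 4)) {J : Ideal (MvPolynomial (Fin 4) K)}
    (hJ : ∀ j, j ∉ s → j ≠ i → coordPoly b j ∈ J) {F : MvPolynomial (Fin 4) K}
    (hF : ∀ t : K, eval (t • b i) F = 0)
    (hd : ∀ j ∈ s, ∀ t : K, dirDeriv (t • b i) (b j) F = 0) :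
    F ∈ J ⊔ vanishingIdeal K (pointCone (b i)) ^ 2 := by
  have hF' : F ∈ vanishingIdeal K (pointCone (b i)) := by
    rw [mem_vanishing]
    intro w hw
    obtain ⟨t, rfl⟩ := Submodule.mem_span_singleton.1 hw
    exact hF t
  have key : vanishingIdeal K (pointCone (b i)) ≤ Ideal.span (coordPoly b '' {i}ᶜ) :=
    vanishing_pointCone_le b fun j hj => Ideal.subset_span ⟨j, hj, rfl⟩
  -- Write F as a combination of the coordinates with index different from i. On the cone over `b i`
  -- the derivative in the direction `b j` is the value of the coefficient `A j`, so the terms with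
  -- j in s lie in the square, and the others lie in J.
  obtain ⟨A, hA⟩ : ∃ A : Fin 4 → MvPolynomial (Fin 4) K,
      F = ∑ j, if j = i then 0 else A j * coordPoly b j := by
    have := key hF'
    refine Submodule.span_induction (p := fun F _ => ∃ A : Fin 4 → MvPolynomial (Fin 4) K,
      F = ∑ j, if j = i then 0 else A j * coordPoly b j) ?_ ?_ ?_ ?_ this
    · rintro _ ⟨j, hj, rfl⟩
      refine ⟨fun k => if k = j then 1 else 0, ?_⟩
      rw [Finset.sum_eq_single j]
      · rw [if_neg (by simpa using hj)]; simp
      · intro k _ hk; simp [hk]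
      · simp
    · exact ⟨0, by simp⟩
    · rintro _ _ _ _ ⟨A, rfl⟩ ⟨B, rfl⟩
      refine ⟨A + B, ?_⟩
      rw [← Finset.sum_add_distrib]
      refine Finset.sum_congr rfl fun j _ => ?_
      split_ifs <;> simp [add_mul]
    · rintro a _ _ ⟨A, rfl⟩
      refine ⟨fun j => a * A j, ?_⟩
      rw [smul_eq_mul, Finset.mul_sum]
      refine Finset.sum_congr rfl fun j _ => ?_
      split_ifs <;> simp [mul_assoc]
  rw [hA]
  refine Ideal.sum_mem _ fun j _ => ?_
  split_ifs with hji
  · exact Ideal.zero_mem _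
  by_cases hj : j ∈ s
  · refine Ideal.mem_sup_right ?_
    rw [pow_two]
    refine Ideal.mul_mem_mul ?_ (coordPoly_mem_pointCone b hji)
    rw [mem_vanishing]
    intro w hw
    obtain ⟨t, rfl⟩ := Submodule.mem_span_singleton.1 hw
    have := hd j hj t
    rw [hA, dirDeriv_sum, Finset.sum_eq_single j] at this
    · rw [if_neg hji, dirDeriv_mul] at this
      simpa [coordPoly, dirDeriv_linearPoly, Finsupp.single_apply, Ne.symm hji] using this
    · intro k _ hk
      split_ifs with hki
      · simp [dirDeriv]
      · rw [dirDeriv_mul]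
        simp [coordPoly, dirDeriv_linearPoly, Ne.symm hki, hk.symm]
    · simp
  · exact Ideal.mem_sup_left (J.mul_mem_left _ (hJ j hj hji))

end Frames

/-! ### Polynomial functions and conditions on a general parameter -/

section General

variable {K : Type*} [Field K] {ι κ : Type}

/-- A function on affine space given by a polynomial. -/
def IsPolyFun (g : (ι → K) → K) : Prop := ∃ p : MvPolynomial ι K, ∀ x, eval x p = g x

namespace IsPolyFun

theorem coord (i : ι) : IsPolyFun fun x : ι → K => x i := ⟨X i, fun _ => eval_X i⟩

theorem const (c : K) : IsPolyFun fun _ : ι → K => c := ⟨C c, fun _ => eval_C c⟩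

theorem add {g h : (ι → K) → K} : IsPolyFun g → IsPolyFun h → IsPolyFun fun x => g x + h x := by
  rintro ⟨p, hp⟩ ⟨r, hr⟩
  exact ⟨p + r, fun x => by rw [map_add, hp, hr]⟩

theorem sub {g h : (ι → K) → K} : IsPolyFun g → IsPolyFun h → IsPolyFun fun x => g x - h x := by
  rintro ⟨p, hp⟩ ⟨r, hr⟩
  exact ⟨p - r, fun x => by rw [map_sub, hp, hr]⟩

theorem mul {g h : (ι → K) → K} : IsPolyFun g → IsPolyFun h → IsPolyFun fun x => g x * h x := by
  rintro ⟨p, hp⟩ ⟨r, hr⟩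
  exact ⟨p * r, fun x => by rw [map_mul, hp, hr]⟩

theorem sum {α : Type*} (s : Finset α) {g : α → (ι → K) → K} (h : ∀ a, IsPolyFun (g a)) :
    IsPolyFun fun x => ∑ a ∈ s, g a x := by
  choose p hp using h
  exact ⟨∑ a ∈ s, p a, fun x => by simp [hp]⟩

theorem prod {α : Type*} (s : Finset α) {g : α → (ι → K) → K} (h : ∀ a, IsPolyFun (g a)) :
    IsPolyFun fun x => ∏ a ∈ s, g a x := by
  choose p hp using h
  exact ⟨∏ a ∈ s, p a, fun x => by simp [hp]⟩

theorem det {n : Type*} [Fintype n] [DecidableEq n] {M : (ι → K) → Matrix n n K}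
    (h : ∀ i j, IsPolyFun fun x => M x i j) : IsPolyFun fun x => (M x).det := by
  simp only [Matrix.det_apply']
  exact sum _ fun σ => mul (const _) (prod _ fun i => h _ _)

end IsPolyFun

namespace ForGeneral

theorem mono {P Q : (ι → K) → Prop} (h : ForGeneral P) (hPQ : ∀ x, P x → Q x) : ForGeneral Q :=
  h.imp fun _ hf => ⟨hf.1, fun x hx => hPQ x (hf.2 x hx)⟩

theorem and {P Q : (ι → K) → Prop} (hP : ForGeneral P) (hQ : ForGeneral Q) :
    ForGeneral fun x => P x ∧ Q x := by
  obtain ⟨f, hf, hfP⟩ := hP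
  obtain ⟨g, hg, hgQ⟩ := hQ
  refine ⟨f * g, mul_ne_zero hf hg, fun x hx => ?_⟩
  rw [map_mul] at hx
  exact ⟨hfP x (left_ne_zero_of_mul hx), hgQ x (right_ne_zero_of_mul hx)⟩

theorem of_forall {P : (ι → K) → Prop} (h : ∀ x, P x) : ForGeneral P :=
  ⟨1, one_ne_zero, fun x _ => h x⟩

theorem all {α : Type*} [Finite α] {P : α → (ι → K) → Prop} (h : ∀ a, ForGeneral (P a)) :
    ForGeneral fun x => ∀ a, P a x := by
  cases nonempty_fintype α
  choose f hf hfP using h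
  refine ⟨∏ a, f a, Finset.prod_ne_zero_iff.2 fun a _ => hf a, fun x hx a => hfP a x ?_⟩
  rw [map_prod] at hx
  exact Finset.prod_ne_zero_iff.1 hx a (Finset.mem_univ a)

theorem imp {p : Prop} {P : (ι → K) → Prop} (h : p → ForGeneral P) :
    ForGeneral fun x => p → P x := by
  by_cases hp : p
  · exact (h hp).mono fun _ hx _ => hx
  · exact of_forall fun _ h' => absurd h' hp

/-- Reduces each open condition used below to exhibiting a single example. -/
theorem of_poly {g : (ι → K) → K} (hg : IsPolyFun g) (h : ∃ x, g x ≠ 0) :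
    ForGeneral fun x => g x ≠ 0 := by
  obtain ⟨p, hp⟩ := hg
  obtain ⟨x, hx⟩ := h
  refine ⟨p, ?_, fun y hy => by
    change g y ≠ 0
    rwa [← hp]⟩
  rintro rfl
  exact hx (by rw [← hp, map_zero])

theorem eval_ne_zero {f : MvPolynomial ι K} (hf : f ≠ 0) : ForGeneral fun x => eval x f ≠ 0 :=
  ⟨f, hf, fun _ h => h⟩

theorem exists_point [Infinite K] {P : (ι → K) → Prop} (h : ForGeneral P) : ∃ x, P x := by
  obtain ⟨f, hf, hfP⟩ := h
  by_contra! hc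
  refine hf (MvPolynomial.funext fun x => ?_)
  rw [map_zero]
  by_contra hx
  exact hc x (hfP x hx)

/-- Genericity can be pulled back along a dominant polynomial map. -/
theorem comap [Infinite K] {φ : (ι → K) → (κ → K)} (hφ : ∀ k, IsPolyFun fun x => φ x k)
    (hdom : ForGeneral fun y => ∃ x, φ x = y) {Q : (κ → K) → Prop} (hQ : ForGeneral Q) :
    ForGeneral fun x => Q (φ x) := by
  obtain ⟨f, hf, hfQ⟩ := hQ
  choose p hp using hφ
  have he : ∀ x, eval x (bind₁ p f) = eval (φ x) f := fun x => by
    have h : (aeval x : _ →ₐ[K] K).comp (bind₁ p) = aeval (φ x) := by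
      refine MvPolynomial.algHom_ext fun k => ?_
      simpa [aeval_eq_eval] using hp k x
    simpa [aeval_eq_eval] using DFunLike.congr_fun h f
  -- Dominance supplies a point of the image at which f does not vanish, so the pulled back
  -- polynomial is not zero.
  obtain ⟨y, hy, x, rfl⟩ := ((eval_ne_zero hf).and hdom).exists_point
  refine ⟨bind₁ p f, ?_, fun x hx => hfQ _ (by rwa [he] at hx)⟩
  intro h0
  exact hy (by rw [← he, h0, map_zero])

end ForGeneral

end General

/-! ### Vector operations and the coordinates of a parameter point -/

section Vectors

variable {K : Type*} [Field K]

/-- The standard bilinear form on `K³`. -/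
def dot (a b : Fin 3 → K) : K := a 0 * b 0 + a 1 * b 1 + a 2 * b 2

/-- The cross product on `K³`. -/
def cr (a b : Fin 3 → K) : Fin 3 → K :=
  ![a 1 * b 2 - a 2 * b 1, a 2 * b 0 - a 0 * b 2, a 0 * b 1 - a 1 * b 0]

/-- The first three coordinates of a vector. -/
def proj (u : Fin 4 → K) : Fin 3 → K := ![u 0, u 1, u 2]

/-- The intersection of the line spanned by `u` and `v` with `H`. -/
def meet (u v : Fin 4 → K) : Fin 3 → K :=
  ![u 3 * v 0 - v 3 * u 0, u 3 * v 1 - v 3 * u 1, u 3 * v 2 - v 3 * u 2]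

/-- The determinant of four vectors. -/
def det4 (a b c d : Fin 4 → K) : K := Matrix.det (Matrix.of ![a, b, c, d])

end Vectors

section Parameters

variable {K : Type*} {σ : SchemeType}

def linePt (x : Coord σ → K) (i : Fin σ.lines) (e : Fin 2) : Fin 4 → K := fun j => x (.line i e j)

def vtx (x : Coord σ → K) (i : Fin σ.crosses) : Fin 3 → K := fun j => x (.vertex i j)

def armPt (x : Coord σ → K) (i : Fin σ.crosses) (e : Fin 2) : Fin 4 → K := fun j => x (.arm i e j)

def starEq (x : Coord σ → K) (i : Fin σ.starLines) : Fin 3 → K := fun j => x (.star i j)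

def axisPt (x : Coord σ → K) (e : Fin 2) : Fin 4 → K := fun j => x (.axis e j)

def collPt [Field K] (x : Coord σ → K) (i : Fin σ.collinear) : Fin 4 → K :=
  fun j => x (.pt i 0) * x (.axis 0 j) + x (.pt i 1) * x (.axis 1 j)

/-- The parameters with given lines, crosses, star and collinear points. -/
def mkCoord (l : Fin σ.lines → Fin 2 → Fin 4 → K) (v : Fin σ.crosses → Fin 3 → K)
    (q : Fin σ.crosses → Fin 2 → Fin 4 → K) (s : Fin σ.starLines → Fin 3 → K)
    (a : Fin 2 → Fin 4 → K) (c : Fin σ.collinear → Fin 2 → K) : Coord σ → K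
  | .line i e j => l i e j
  | .vertex i j => v i j
  | .arm i e j => q i e j
  | .star i j => s i j
  | .axis e j => a e j
  | .pt i e => c i e

variable {l : Fin σ.lines → Fin 2 → Fin 4 → K} {v : Fin σ.crosses → Fin 3 → K}
    {q : Fin σ.crosses → Fin 2 → Fin 4 → K} {s : Fin σ.starLines → Fin 3 → K}
    {a : Fin 2 → Fin 4 → K} {c : Fin σ.collinear → Fin 2 → K}

@[simp] theorem linePt_mkCoord : linePt (mkCoord l v q s a c) = l := rfl
@[simp] theorem vtx_mkCoord : vtx (mkCoord l v q s a c) = v := rfl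
@[simp] theorem armPt_mkCoord : armPt (mkCoord l v q s a c) = q := rfl
@[simp] theorem starEq_mkCoord : starEq (mkCoord l v q s a c) = s := rfl
@[simp] theorem axisPt_mkCoord : axisPt (mkCoord l v q s a c) = a := rfl
@[simp] theorem collPt_mkCoord [Field K] (i : Fin σ.collinear) :
    collPt (mkCoord l v q s a c) i = fun j => c i 0 * a 0 j + c i 1 * a 1 j := rfl

end Parameters

/-! ### The pieces of a scheme and the explicit conditions of generality -/

section Pieces

variable {K : Type*} [Field K] {σ : SchemeType}

/-- The indices of the pieces of a scheme of type `σ`: lines, crosses, the sub-star, and the collinear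
points. -/
abbrev Piece (σ : SchemeType) : Type := Fin σ.lines ⊕ Fin σ.crosses ⊕ Unit ⊕ Fin σ.collinear

/-- The cones over the pieces. -/
def piece (x : Coord σ → K) : Piece σ → Set (Fin 4 → K)
  | .inl i => spanPair (linePt x i 0) (linePt x i 1)
  | .inr (.inl i) => ⋃ e, spanPair (inPlane (vtx x i)) (armPt x i e)
  | .inr (.inr (.inl _)) => subStarCone (starEq x) σ.omitted
  | .inr (.inr (.inr i)) => pointCone (collPt x i)

theorem mem_schemeIdeal {x : Coord σ → K} {F : MvPolynomial (Fin 4) K} :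
    F ∈ schemeIdeal x ↔ ∀ α, F ∈ vanishingIdeal K (piece x α) := by
  simp only [mem_vanishing, schemeIdeal]
  constructor
  · rintro h (i | i | i | i) w hw
    · exact h w (.inl (.inl (.inl (Set.mem_iUnion.2 ⟨i, hw⟩))))
    · obtain ⟨e, he⟩ := Set.mem_iUnion.1 hw
      exact h w (.inl (.inl (.inr (Set.mem_iUnion₂.2 ⟨i, e, he⟩))))
    · exact h w (.inl (.inr hw))
    · exact h w (.inr (Set.mem_iUnion.2 ⟨i, hw⟩))
  · rintro h w (((hw | hw) | hw) | hw)
    · obtain ⟨i, hi⟩ := Set.mem_iUnion.1 hw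
      exact h (.inl i) w hi
    · obtain ⟨i, e, hi⟩ := Set.mem_iUnion₂.1 hw
      exact h (.inr (.inl i)) w (Set.mem_iUnion.2 ⟨e, hi⟩)
    · exact h (.inr (.inr (.inl ()))) w hw
    · obtain ⟨i, hi⟩ := Set.mem_iUnion.1 hw
      exact h (.inr (.inr (.inr i))) w hi

/-- Explicit conditions satisfied by a general scheme of type `σ`. -/
structure Good (x : Coord σ → K) : Prop where
  -- Projections occur because the degeneration flattens lines into H, where they have to remain
  -- lines. Asking for one fixed coordinate of a cross product, instead of the vector, to be nonzero
  -- makes the condition the nonvanishing of one polynomial.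
  line_plane : ∀ i, cr (proj (linePt x i 0)) (proj (linePt x i 1)) 2 ≠ 0
  line_third : ∀ i e, linePt x i e 3 ≠ 0
  arm_third : ∀ i e, armPt x i e 3 ≠ 0
  pt_third : ∀ i, collPt x i 3 ≠ 0
  cross_frame : ∀ i, dot (vtx x i) (cr (proj (armPt x i 0)) (proj (armPt x i 1))) ≠ 0
  line_line : ∀ i j, i ≠ j →
    det4 (linePt x i 0) (linePt x i 1) (linePt x j 0) (linePt x j 1) ≠ 0
  line_arm : ∀ i j e, det4 (linePt x i 0) (linePt x i 1) (inPlane (vtx x j)) (armPt x j e) ≠ 0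
  arm_arm : ∀ i j, i ≠ j → ∀ e e',
    det4 (inPlane (vtx x i)) (armPt x i e) (inPlane (vtx x j)) (armPt x j e') ≠ 0
  star_line : ∀ k i, dot (starEq x k) (meet (linePt x i 0) (linePt x i 1)) ≠ 0
  star_vtx : ∀ k i, dot (starEq x k) (vtx x i) ≠ 0
  line_pt : ∀ i k, dot (cr (proj (linePt x i 0)) (proj (linePt x i 1))) (proj (collPt x k)) ≠ 0
  arm_pt : ∀ i e k, dot (cr (vtx x i) (proj (armPt x i e))) (proj (collPt x k)) ≠ 0
  pt_pt : ∀ i j, i ≠ j → cr (proj (collPt x i)) (proj (collPt x j)) 2 ≠ 0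
  star_star : ∀ i j, i ≠ j → cr (starEq x i) (starEq x j) 2 ≠ 0

theorem IsPolyFun.dot {ι : Type} {f g : (ι → K) → Fin 3 → K} (hf : ∀ j, IsPolyFun fun x => f x j)
    (hg : ∀ j, IsPolyFun fun x => g x j) : IsPolyFun fun x => dot (f x) (g x) :=
  (((hf 0).mul (hg 0)).add ((hf 1).mul (hg 1))).add ((hf 2).mul (hg 2))

theorem IsPolyFun.cr {ι : Type} {f g : (ι → K) → Fin 3 → K} (hf : ∀ j, IsPolyFun fun x => f x j)
    (hg : ∀ j, IsPolyFun fun x => g x j) (j : Fin 3) : IsPolyFun fun x => cr (f x) (g x) j := by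
  fin_cases j
  · exact ((hf 1).mul (hg 2)).sub ((hf 2).mul (hg 1))
  · exact ((hf 2).mul (hg 0)).sub ((hf 0).mul (hg 2))
  · exact ((hf 0).mul (hg 1)).sub ((hf 1).mul (hg 0))

theorem IsPolyFun.proj {ι : Type} {f : (ι → K) → Fin 4 → K} (hf : ∀ j, IsPolyFun fun x => f x j)
    (j : Fin 3) : IsPolyFun fun x => proj (f x) j := by
  fin_cases j
  exacts [hf 0, hf 1, hf 2]

theorem IsPolyFun.inPlane {ι : Type} {f : (ι → K) → Fin 3 → K} (hf : ∀ j, IsPolyFun fun x => f x j)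
    (j : Fin 4) : IsPolyFun fun x => inPlane (f x) j := by
  fin_cases j
  exacts [hf 0, hf 1, hf 2, .const 0]

theorem IsPolyFun.meet {ι : Type} {f g : (ι → K) → Fin 4 → K} (hf : ∀ j, IsPolyFun fun x => f x j)
    (hg : ∀ j, IsPolyFun fun x => g x j) (j : Fin 3) : IsPolyFun fun x => meet (f x) (g x) j := by
  fin_cases j
  exacts [((hf 3).mul (hg 0)).sub ((hg 3).mul (hf 0)), ((hf 3).mul (hg 1)).sub ((hg 3).mul (hf 1)),
    ((hf 3).mul (hg 2)).sub ((hg 3).mul (hf 2))]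

theorem IsPolyFun.det4 {ι : Type} {a b c d : (ι → K) → Fin 4 → K}
    (ha : ∀ j, IsPolyFun fun x => a x j) (hb : ∀ j, IsPolyFun fun x => b x j)
    (hc : ∀ j, IsPolyFun fun x => c x j) (hd : ∀ j, IsPolyFun fun x => d x j) :
    IsPolyFun fun x => det4 (a x) (b x) (c x) (d x) := by
  refine IsPolyFun.det fun i j => ?_
  fin_cases i
  exacts [ha j, hb j, hc j, hd j]

theorem IsPolyFun.linePt (i : Fin σ.lines) (e : Fin 2) (j : Fin 4) :
    IsPolyFun fun x : Coord σ → K => linePt x i e j := .coord _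

theorem IsPolyFun.vtx (i : Fin σ.crosses) (j : Fin 3) :
    IsPolyFun fun x : Coord σ → K => vtx x i j := .coord _

theorem IsPolyFun.armPt (i : Fin σ.crosses) (e : Fin 2) (j : Fin 4) :
    IsPolyFun fun x : Coord σ → K => armPt x i e j := .coord _

theorem IsPolyFun.starEq (i : Fin σ.starLines) (j : Fin 3) :
    IsPolyFun fun x : Coord σ → K => starEq x i j := .coord _

theorem IsPolyFun.collPt (i : Fin σ.collinear) (j : Fin 4) :
    IsPolyFun fun x : Coord σ → K => collPt x i j :=
  ((coord _).mul (coord _)).add ((coord _).mul (coord _))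

theorem det4_pi_single : det4 (K := K) ![1, 0, 0, 0] ![0, 1, 0, 0] ![0, 0, 1, 0] ![0, 0, 0, 1] = 1 := by
  have : Matrix.of ![![1, 0, 0, 0], ![0, 1, 0, 0], ![0, 0, 1, 0], ![0, 0, 0, (1 : K)]] = 1 := by
    ext i j
    fin_cases i <;> fin_cases j <;> rfl
  rw [det4, this, Matrix.det_one]

/-- The conditions are finitely many and each is the nonvanishing of a polynomial, so separate
examples, built from coordinate vectors, suffice. -/
theorem forGeneral_good [Infinite K] (σ : SchemeType) : ForGeneral fun x : Coord σ → K => Good x := by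
  have h1 : ForGeneral fun x : Coord σ → K =>
      ∀ i, cr (proj (linePt x i 0)) (proj (linePt x i 1)) 2 ≠ 0 :=
    .all fun i => .of_poly (.cr (.proj (.linePt _ _)) (.proj (.linePt _ _)) _)
      ⟨mkCoord (fun _ e => if e = 0 then ![1, 0, 0, 0] else ![0, 1, 0, 0]) 0 0 0 0 0,
        by simp [cr, proj]⟩
  have h2 : ForGeneral fun x : Coord σ → K => ∀ i e, linePt x i e 3 ≠ 0 :=
    .all fun i => .all fun e => .of_poly (.linePt _ _ _) ⟨fun _ => 1, one_ne_zero⟩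
  have h3 : ForGeneral fun x : Coord σ → K => ∀ i e, armPt x i e 3 ≠ 0 :=
    .all fun i => .all fun e => .of_poly (.armPt _ _ _) ⟨fun _ => 1, one_ne_zero⟩
  have h4 : ForGeneral fun x : Coord σ → K => ∀ i, collPt x i 3 ≠ 0 :=
    .all fun i => .of_poly (.collPt _ _)
      ⟨mkCoord 0 0 0 0 (fun _ => ![0, 0, 0, 1]) (fun _ => ![1, 0]), by simp⟩
  have h5 : ForGeneral fun x : Coord σ → K =>
      ∀ i, dot (vtx x i) (cr (proj (armPt x i 0)) (proj (armPt x i 1))) ≠ 0 :=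
    .all fun i => .of_poly (.dot (.vtx _) (.cr (.proj (.armPt _ _)) (.proj (.armPt _ _))))
      ⟨mkCoord 0 (fun _ => ![0, 0, 1])
        (fun _ e => if e = 0 then ![1, 0, 0, 0] else ![0, 1, 0, 0]) 0 0 0,
        by simp [cr, proj, dot]⟩
  have h6 : ForGeneral fun x : Coord σ → K => ∀ i j, i ≠ j →
      det4 (linePt x i 0) (linePt x i 1) (linePt x j 0) (linePt x j 1) ≠ 0 :=
    .all fun i => .all fun j => .imp fun hij => .of_poly
      (.det4 (.linePt _ _) (.linePt _ _) (.linePt _ _) (.linePt _ _))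
      ⟨mkCoord (fun k e => if k = i then (if e = 0 then ![1, 0, 0, 0] else ![0, 1, 0, 0])
        else (if e = 0 then ![0, 0, 1, 0] else ![0, 0, 0, 1])) 0 0 0 0 0,
        by simp [hij.symm, det4_pi_single]⟩
  have h7 : ForGeneral fun x : Coord σ → K => ∀ i j e,
      det4 (linePt x i 0) (linePt x i 1) (inPlane (vtx x j)) (armPt x j e) ≠ 0 :=
    .all fun i => .all fun j => .all fun e => .of_poly
      (.det4 (.linePt _ _) (.linePt _ _) (.inPlane (.vtx _)) (.armPt _ _))
      ⟨mkCoord (fun k e => if e = 0 then ![1, 0, 0, 0] else ![0, 1, 0, 0])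
        (fun _ => ![0, 0, 1]) (fun _ _ => ![0, 0, 0, 1]) 0 0 0,
        by simp [inPlane, det4_pi_single]⟩
  have h8 : ForGeneral fun x : Coord σ → K => ∀ i j, i ≠ j → ∀ e e',
      det4 (inPlane (vtx x i)) (armPt x i e) (inPlane (vtx x j)) (armPt x j e') ≠ 0 :=
    .all fun i => .all fun j => .imp fun hij => .all fun e => .all fun e' => .of_poly
      (.det4 (.inPlane (.vtx _)) (.armPt _ _) (.inPlane (.vtx _)) (.armPt _ _))
      ⟨mkCoord 0 (fun k => if k = i then ![1, 0, 0] else ![0, 0, 1])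
        (fun k _ => if k = i then ![0, 1, 0, 0] else ![0, 0, 0, 1]) 0 0 0,
        by simp [inPlane, hij.symm, det4_pi_single]⟩
  have h9 : ForGeneral fun x : Coord σ → K =>
      ∀ k i, dot (starEq x k) (meet (linePt x i 0) (linePt x i 1)) ≠ 0 :=
    .all fun k => .all fun i => .of_poly (.dot (.starEq _) (.meet (.linePt _ _) (.linePt _ _)))
      ⟨mkCoord (fun _ e => if e = 0 then ![0, 0, 0, 1] else ![1, 0, 0, 0]) 0 0
        (fun _ => ![1, 0, 0]) 0 0, by simp [meet, dot]⟩
  have h10 : ForGeneral fun x : Coord σ → K => ∀ k i, dot (starEq x k) (vtx x i) ≠ 0 :=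
    .all fun k => .all fun i => .of_poly (.dot (.starEq _) (.vtx _))
      ⟨mkCoord 0 (fun _ => ![1, 0, 0]) 0 (fun _ => ![1, 0, 0]) 0 0, by simp [dot]⟩
  have h11 : ForGeneral fun x : Coord σ → K => ∀ i k,
      dot (cr (proj (linePt x i 0)) (proj (linePt x i 1))) (proj (collPt x k)) ≠ 0 :=
    .all fun i => .all fun k => .of_poly
      (.dot (.cr (.proj (.linePt _ _)) (.proj (.linePt _ _))) (.proj (.collPt _)))
      ⟨mkCoord (fun _ e => if e = 0 then ![1, 0, 0, 0] else ![0, 1, 0, 0]) 0 0 0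
        (fun _ => ![0, 0, 1, 0]) (fun _ => ![1, 0]), by simp [cr, proj, dot]⟩
  have h12 : ForGeneral fun x : Coord σ → K => ∀ i e k,
      dot (cr (vtx x i) (proj (armPt x i e))) (proj (collPt x k)) ≠ 0 :=
    .all fun i => .all fun e => .all fun k => .of_poly
      (.dot (.cr (.vtx _) (.proj (.armPt _ _))) (.proj (.collPt _)))
      ⟨mkCoord 0 (fun _ => ![1, 0, 0]) (fun _ _ => ![0, 1, 0, 0]) 0
        (fun _ => ![0, 0, 1, 0]) (fun _ => ![1, 0]), by simp [cr, proj, dot]⟩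
  have h13 : ForGeneral fun x : Coord σ → K => ∀ i j, i ≠ j →
      cr (proj (collPt x i)) (proj (collPt x j)) 2 ≠ 0 :=
    .all fun i => .all fun j => .imp fun hij => .of_poly
      (.cr (.proj (.collPt _)) (.proj (.collPt _)) _)
      ⟨mkCoord 0 0 0 0 (fun e => if e = 0 then ![1, 0, 0, 0] else ![0, 1, 0, 0])
        (fun k => if k = i then ![1, 0] else ![0, 1]), by simp [cr, proj, hij.symm]⟩
  have h14 : ForGeneral fun x : Coord σ → K => ∀ i j, i ≠ j →
      cr (starEq x i) (starEq x j) 2 ≠ 0 :=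
    .all fun i => .all fun j => .imp fun hij => .of_poly (.cr (.starEq _) (.starEq _) _)
      ⟨mkCoord 0 0 0 (fun k => if k = i then ![1, 0, 0] else ![0, 1, 0]) 0 0,
        by simp [cr, hij.symm]⟩
  refine (h1.and (h2.and (h3.and (h4.and (h5.and (h6.and (h7.and (h8.and (h9.and (h10.and
    (h11.and (h12.and (h13.and h14))))))))))))).mono ?_
  rintro x ⟨a1, a2, a3, a4, a5, a6, a7, a8, a9, a10, a11, a12, a13, a14⟩
  exact ⟨a1, a2, a3, a4, a5, a6, a7, a8, a9, a10, a11, a12, a13, a14⟩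

end Pieces

/-! ### Elementary geometry of lines, points and nodes -/

section Vectors

variable {K : Type*} [Field K]

theorem mem_spanPair {u v w : Fin 4 → K} : w ∈ spanPair u v ↔ ∃ s t : K, s • u + t • v = w :=
  Submodule.mem_span_pair

theorem mem_pointCone {u w : Fin 4 → K} : w ∈ pointCone u ↔ ∃ t : K, t • u = w :=
  Submodule.mem_span_singleton

theorem mem_planeLine {a : Fin 3 → K} {w : Fin 4 → K} :
    w ∈ planeLine a ↔ w 3 = 0 ∧ dot a (proj w) = 0 := Iff.rfl

theorem left_mem_spanPair (u v : Fin 4 → K) : u ∈ spanPair u v :=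
  mem_spanPair.2 ⟨1, 0, by simp⟩

@[simp] theorem inPlane_three (p : Fin 3 → K) : inPlane p 3 = 0 := rfl

@[simp] theorem proj_inPlane (p : Fin 3 → K) : proj (inPlane p) = p := by
  ext j; fin_cases j <;> rfl

theorem inPlane_proj {w : Fin 4 → K} (h : w 3 = 0) : inPlane (proj w) = w := by
  ext j; fin_cases j
  exacts [rfl, rfl, rfl, h.symm]

theorem inPlane_smul (c : K) (p : Fin 3 → K) : inPlane (c • p) = c • inPlane p := by
  ext j; fin_cases j <;> simp [inPlane]

theorem inPlane_add (p p' : Fin 3 → K) : inPlane (p + p') = inPlane p + inPlane p' := by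
  ext j; fin_cases j <;> simp [inPlane]

theorem proj_add (u v : Fin 4 → K) : proj (u + v) = proj u + proj v := by
  ext j; fin_cases j <;> rfl

theorem proj_smul (c : K) (u : Fin 4 → K) : proj (c • u) = c • proj u := by
  ext j; fin_cases j <;> rfl

theorem inPlane_meet (u v : Fin 4 → K) : inPlane (meet u v) = u 3 • v - v 3 • u := by
  ext j; fin_cases j <;> simp [inPlane, meet, mul_comm]

theorem dot_add (a p p' : Fin 3 → K) : dot a (p + p') = dot a p + dot a p' := by
  simp only [dot, Pi.add_apply]; ring

theorem dot_smul (a : Fin 3 → K) (c : K) (p : Fin 3 → K) : dot a (c • p) = c * dot a p := by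
  simp only [dot, Pi.smul_apply, smul_eq_mul]; ring

theorem dot_cr_left (a b : Fin 3 → K) : dot (cr a b) a = 0 := by
  simp only [dot, cr, Matrix.cons_val_zero, Matrix.cons_val_one, Matrix.cons_val]; ring

theorem dot_cr_right (a b : Fin 3 → K) : dot (cr a b) b = 0 := by
  simp only [dot, cr, Matrix.cons_val_zero, Matrix.cons_val_one, Matrix.cons_val]; ring

theorem cr_smul_smul (a : Fin 3 → K) (c c' : K) : cr (c • a) (c' • a) = 0 := by
  ext j; fin_cases j <;> simp [cr] <;> ring

/-- Three covectors with non-zero determinant have no common zero. -/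
theorem eq_zero_of_dot {a b c w : Fin 3 → K} (h : dot a (cr b c) ≠ 0) (ha : dot a w = 0)
    (hb : dot b w = 0) (hc : dot c w = 0) : w = 0 := by
  -- Cramer's rule: the determinant times a coordinate of w is a combination of the three given
  -- values.
  have key : ∀ j, dot a (cr b c) * w j = 0 := by
    intro j
    fin_cases j
    · have : dot a (cr b c) * w 0 = cr b c 0 * dot a w + cr c a 0 * dot b w + cr a b 0 * dot c w := by
        simp only [dot, cr, Matrix.cons_val_zero, Matrix.cons_val_one, Matrix.cons_val]; ring
      simpa [ha, hb, hc] using this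
    · have : dot a (cr b c) * w 1 = cr b c 1 * dot a w + cr c a 1 * dot b w + cr a b 1 * dot c w := by
        simp only [dot, cr, Matrix.cons_val_zero, Matrix.cons_val_one, Matrix.cons_val]; ring
      simpa [ha, hb, hc] using this
    · have : dot a (cr b c) * w 2 = cr b c 2 * dot a w + cr c a 2 * dot b w + cr a b 2 * dot c w := by
        simp only [dot, cr, Matrix.cons_val_zero, Matrix.cons_val_one, Matrix.cons_val]; ring
      simpa [ha, hb, hc] using this
  ext j
  exact (mul_eq_zero.1 (key j)).resolve_left h

theorem eq_zero_of_proj {w : Fin 4 → K} (h : proj w = 0) (h3 : w 3 = 0) : w = 0 := by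
  rw [← inPlane_proj h3, h]
  ext j; fin_cases j <;> rfl

theorem inPlane_ne_zero {p : Fin 3 → K} (h : p ≠ 0) : inPlane p ≠ 0 := fun h0 => h (by
  rw [← proj_inPlane p, h0]; ext j; fin_cases j <;> rfl)

theorem ne_zero_of_apply {n : ℕ} {p : Fin n → K} {j : Fin n} (h : p j ≠ 0) : p ≠ 0 :=
  fun h0 => h (by rw [h0]; rfl)

theorem linearIndependent_of_det4 {a b c d : Fin 4 → K} (h : det4 a b c d ≠ 0) :
    LinearIndependent K ![a, b, c, d] :=
  Matrix.linearIndependent_rows_of_det_ne_zero h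

theorem eq_zero_of_mem_spanPair_of_linearIndependent {a b c d w : Fin 4 → K}
    (h : LinearIndependent K ![a, b, c, d]) (h₁ : w ∈ spanPair a b) (h₂ : w ∈ spanPair c d) :
    w = 0 := by
  obtain ⟨s, t, rfl⟩ := mem_spanPair.1 h₁
  obtain ⟨s', t', h'⟩ := mem_spanPair.1 h₂
  have hg : ∑ i, (![s, t, -s', -t'] : Fin 4 → K) i • (![a, b, c, d] : Fin 4 → Fin 4 → K) i = 0 := by
    rw [Fin.sum_univ_four]
    simp only [Matrix.cons_val_zero, Matrix.cons_val_one, Matrix.cons_val, neg_smul]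
    rw [add_assoc, add_assoc, ← add_assoc, ← h']
    abel
  have hl := Fintype.linearIndependent_iff.1 h _ hg
  have hs : s = 0 := hl 0
  have ht : t = 0 := hl 1
  rw [hs, ht, zero_smul, zero_smul, add_zero]

theorem eq_zero_of_mem_spanPair_of_det4 {a b c d w : Fin 4 → K} (h : det4 a b c d ≠ 0)
    (h₁ : w ∈ spanPair a b) (h₂ : w ∈ spanPair c d) : w = 0 :=
  eq_zero_of_mem_spanPair_of_linearIndependent (linearIndependent_of_det4 h) h₁ h₂

theorem linearIndependent_pair_of_cr {u v : Fin 4 → K} {j : Fin 3} (h : cr (proj u) (proj v) j ≠ 0) :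
    LinearIndependent K ![u, v] := by
  rw [LinearIndependent.pair_iff]
  intro s t hst
  have h' : s • proj u + t • proj v = 0 := by
    rw [← proj_smul, ← proj_smul, ← proj_add, hst]; ext j; fin_cases j <;> rfl
  have e0 := congrFun h' 0
  have e1 := congrFun h' 1
  have e2 := congrFun h' 2
  simp only [Pi.add_apply, Pi.smul_apply, smul_eq_mul, Pi.zero_apply] at e0 e1 e2
  generalize proj u = a at *
  generalize proj v = b at *
  constructor <;> refine (mul_eq_zero.1 (?_ : _ * cr a b j = 0)).resolve_right h <;>
    fin_cases j <;>
    simp only [cr, Fin.zero_eta, Fin.mk_one, Fin.reduceFinMk, Matrix.cons_val_zero,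
      Matrix.cons_val_one, Matrix.cons_val]
  · linear_combination b 2 * e1 - b 1 * e2
  · linear_combination b 0 * e2 - b 2 * e0
  · linear_combination b 1 * e0 - b 0 * e1
  · linear_combination a 1 * e2 - a 2 * e1
  · linear_combination a 2 * e0 - a 0 * e2
  · linear_combination a 0 * e1 - a 1 * e0

theorem linearIndependent_triple_of_dot {p : Fin 3 → K} {u v : Fin 4 → K}
    (h : dot p (cr (proj u) (proj v)) ≠ 0) : LinearIndependent K ![inPlane p, u, v] := by
  rw [Fintype.linearIndependent_iff]
  intro g hg
  rw [Fin.sum_univ_three] at hg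
  simp only [Matrix.cons_val_zero, Matrix.cons_val_one, Matrix.cons_val] at hg
  have h' : g 0 • p + g 1 • proj u + g 2 • proj v = 0 := by
    rw [← proj_inPlane p, ← proj_smul, ← proj_smul, ← proj_smul, ← proj_add, ← proj_add, hg]
    ext j; fin_cases j <;> rfl
  have e0 := congrFun h' 0
  have e1 := congrFun h' 1
  have e2 := congrFun h' 2
  simp only [Pi.add_apply, Pi.smul_apply, smul_eq_mul, Pi.zero_apply] at e0 e1 e2
  generalize proj u = a at *
  generalize proj v = b at *
  intro i
  refine (mul_eq_zero.1 (?_ : _ * dot p (cr a b) = 0)).resolve_right h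
  fin_cases i <;>
    simp only [dot, cr, Fin.zero_eta, Fin.mk_one, Fin.reduceFinMk, Matrix.cons_val_zero,
      Matrix.cons_val_one, Matrix.cons_val]
  · linear_combination (a 1 * b 2 - a 2 * b 1) * e0 + (a 2 * b 0 - a 0 * b 2) * e1 +
      (a 0 * b 1 - a 1 * b 0) * e2
  · linear_combination (b 1 * p 2 - b 2 * p 1) * e0 + (b 2 * p 0 - b 0 * p 2) * e1 +
      (b 0 * p 1 - b 1 * p 0) * e2
  · linear_combination (p 1 * a 2 - p 2 * a 1) * e0 + (p 2 * a 0 - p 0 * a 2) * e1 +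
      (p 0 * a 1 - p 1 * a 0) * e2

theorem exists_smul_meet {u v w : Fin 4 → K} (hw : w ∈ spanPair u v) (h3 : w 3 = 0) (hu : u 3 ≠ 0) :
    ∃ c : K, c • inPlane (meet u v) = w := by
  obtain ⟨s, t, rfl⟩ := mem_spanPair.1 hw
  refine ⟨t / u 3, ?_⟩
  simp only [Pi.add_apply, Pi.smul_apply, smul_eq_mul] at h3
  have hs : s = - (t / u 3 * v 3) := by field_simp; linear_combination h3
  rw [inPlane_meet, smul_sub, smul_smul, smul_smul, div_mul_cancel₀ _ hu, hs]
  module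

theorem exists_smul_vertex {p : Fin 3 → K} {q w : Fin 4 → K} (hw : w ∈ spanPair (inPlane p) q)
    (h3 : w 3 = 0) (hq : q 3 ≠ 0) : ∃ c : K, c • inPlane p = w := by
  obtain ⟨s, t, rfl⟩ := mem_spanPair.1 hw
  have ht : t = 0 := by simpa [hq] using h3
  exact ⟨s, by simp [ht]⟩

theorem dot_cr_of_mem_spanPair {u v w : Fin 4 → K} (hw : w ∈ spanPair u v) :
    dot (cr (proj u) (proj v)) (proj w) = 0 := by
  obtain ⟨s, t, rfl⟩ := mem_spanPair.1 hw
  rw [proj_add, proj_smul, proj_smul, dot_add, dot_smul, dot_smul, dot_cr_left, dot_cr_right]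
  simp

theorem mem_subStarCone {A : ℕ} {a : Fin A → Fin 3 → K} {b : ℕ} {w : Fin 4 → K} :
    w ∈ subStarCone a b ↔ ∃ i j : Fin A, IsKept b i j ∧ w ∈ planeLine (a i) ∧ w ∈ planeLine (a j) := by
  simp only [subStarCone, Set.mem_iUnion, Set.mem_inter_iff, exists_prop]

theorem dot_proj_smul {a : Fin 3 → K} {c : K} {w : Fin 4 → K} (h : dot a (proj (c • w)) = 0)
    (h' : dot a (proj w) ≠ 0) : c = 0 := by
  rw [proj_smul, dot_smul] at h
  exact (mul_eq_zero.1 h).resolve_right h'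

end Vectors

/-! ### Disjointness of the pieces of a general scheme -/

namespace Good

variable {K : Type*} [Field K] {σ : SchemeType} {x : Coord σ → K}

theorem linearIndependent_line (h : Good x) (i : Fin σ.lines) :
    LinearIndependent K ![linePt x i 0, linePt x i 1] := linearIndependent_pair_of_cr (h.line_plane i)

theorem linearIndependent_cross (h : Good x) (i : Fin σ.crosses) :
    LinearIndependent K ![inPlane (vtx x i), armPt x i 0, armPt x i 1] :=
  linearIndependent_triple_of_dot (h.cross_frame i)

theorem eq_zero_line_cross (h : Good x) {i : Fin σ.lines} {j : Fin σ.crosses} {w : Fin 4 → K}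
    (hi : w ∈ piece x (.inl i)) (hj : w ∈ piece x (.inr (.inl j))) : w = 0 := by
  obtain ⟨e, he⟩ := Set.mem_iUnion.1 hj
  exact eq_zero_of_mem_spanPair_of_det4 (h.line_arm i j e) hi he

theorem eq_zero_line_star (h : Good x) {i : Fin σ.lines} {w : Fin 4 → K}
    (hi : w ∈ piece x (.inl i)) (hj : w ∈ piece x (.inr (.inr (.inl ())))) : w = 0 := by
  obtain ⟨k, k', -, hk, -⟩ := mem_subStarCone.1 hj
  obtain ⟨c, rfl⟩ := exists_smul_meet hi hk.1 (h.line_third i 0)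
  rw [dot_proj_smul hk.2 (by rw [proj_inPlane]; exact h.star_line k i), zero_smul]

theorem eq_zero_cross_star (h : Good x) {i : Fin σ.crosses} {w : Fin 4 → K}
    (hi : w ∈ piece x (.inr (.inl i))) (hj : w ∈ piece x (.inr (.inr (.inl ())))) : w = 0 := by
  obtain ⟨k, k', -, hk, -⟩ := mem_subStarCone.1 hj
  obtain ⟨e, he⟩ := Set.mem_iUnion.1 hi
  obtain ⟨c, rfl⟩ := exists_smul_vertex he hk.1 (h.arm_third i e)
  rw [dot_proj_smul hk.2 (by rw [proj_inPlane]; exact h.star_vtx k i), zero_smul]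

theorem eq_zero_line_pt (h : Good x) {i : Fin σ.lines} {j : Fin σ.collinear} {w : Fin 4 → K}
    (hi : w ∈ piece x (.inl i)) (hj : w ∈ piece x (.inr (.inr (.inr j)))) : w = 0 := by
  obtain ⟨c, rfl⟩ := mem_pointCone.1 hj
  rw [dot_proj_smul (dot_cr_of_mem_spanPair hi) (h.line_pt i j), zero_smul]

theorem eq_zero_cross_pt (h : Good x) {i : Fin σ.crosses} {j : Fin σ.collinear} {w : Fin 4 → K}
    (hi : w ∈ piece x (.inr (.inl i))) (hj : w ∈ piece x (.inr (.inr (.inr j)))) : w = 0 := by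
  obtain ⟨c, rfl⟩ := mem_pointCone.1 hj
  obtain ⟨e, he⟩ := Set.mem_iUnion.1 hi
  have := dot_cr_of_mem_spanPair he
  rw [proj_inPlane] at this
  rw [dot_proj_smul this (h.arm_pt i e j), zero_smul]

theorem eq_zero_star_pt (h : Good x) {j : Fin σ.collinear} {w : Fin 4 → K}
    (hi : w ∈ piece x (.inr (.inr (.inl ())))) (hj : w ∈ piece x (.inr (.inr (.inr j)))) : w = 0 := by
  obtain ⟨c, rfl⟩ := mem_pointCone.1 hj
  obtain ⟨k, k', -, hk, -⟩ := mem_subStarCone.1 hi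
  rw [(mul_eq_zero.1 hk.1).resolve_right (h.pt_third j), zero_smul]

/-- The pieces of a general scheme are pairwise disjoint. -/
theorem eq_zero_of_mem (h : Good x) {α β : Piece σ} (hαβ : α ≠ β) {w : Fin 4 → K}
    (hα : w ∈ piece x α) (hβ : w ∈ piece x β) : w = 0 := by
  rcases α with i | i | i | i <;> rcases β with j | j | j | j
  · exact eq_zero_of_mem_spanPair_of_det4 (h.line_line i j fun hij => hαβ (by rw [hij])) hα hβ
  · exact h.eq_zero_line_cross hα hβ
  · exact h.eq_zero_line_star hα hβ
  · exact h.eq_zero_line_pt hα hβ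
  · exact h.eq_zero_line_cross hβ hα
  · obtain ⟨e, he⟩ := Set.mem_iUnion.1 hα
    obtain ⟨e', he'⟩ := Set.mem_iUnion.1 hβ
    exact eq_zero_of_mem_spanPair_of_det4 (h.arm_arm i j (fun hij => hαβ (by rw [hij])) e e') he he'
  · exact h.eq_zero_cross_star hα hβ
  · exact h.eq_zero_cross_pt hα hβ
  · exact h.eq_zero_line_star hβ hα
  · exact h.eq_zero_cross_star hβ hα
  · exact absurd rfl hαβ
  · exact h.eq_zero_star_pt hα hβ
  · exact h.eq_zero_line_pt hβ hα
  · exact h.eq_zero_cross_pt hβ hα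
  · exact h.eq_zero_star_pt hβ hα
  · obtain ⟨c, rfl⟩ := mem_pointCone.1 hα
    obtain ⟨c', hc'⟩ := mem_pointCone.1 hβ
    by_contra hw
    have hc : c ≠ 0 := fun h0 => hw (by rw [h0, zero_smul])
    have h1 : proj (collPt x i) = (c⁻¹ * c') • proj (collPt x j) := by
      rw [← proj_smul, mul_smul, hc', smul_smul, inv_mul_cancel₀ hc, one_smul]
    refine h.pt_pt i j (fun hij => hαβ (by rw [hij])) ?_
    rw [h1, ← one_smul K (proj (collPt x j)), smul_smul, cr_smul_smul]
    rfl

end Good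

/-! ### One-parameter families, flatness, and lifting along moving frames -/

section Families

variable {K : Type*} [Field K] {σ : SchemeType}

/-- The affine line through `x` in the parameter space with direction `D`; its point at `t = 1` is `x`. -/
def path (x D : Coord σ → K) (t : K) : Coord σ → K := fun c => x c + (t - 1) * D c

theorem path_one (x D : Coord σ → K) : path x D 1 = x := by
  funext c; simp [path]

/-- The coordinates of `path` as polynomials. -/
noncomputable def pathPoly (x D : Coord σ → K) (c : Coord σ) : Polynomial K :=
  Polynomial.C (x c) + (Polynomial.X - 1) * Polynomial.C (D c)

@[simp] theorem eval_pathPoly (x D : Coord σ → K) (c : Coord σ) (t : K) :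
    (pathPoly x D c).eval t = path x D t c := by
  simp [pathPoly, path]

/-- The member at `t = a` of a family, before saturation, as a ring homomorphism. -/
noncomputable abbrev specialize (a : K) :
    MvPolynomial (Fin 4) (Polynomial K) →+* MvPolynomial (Fin 4) K :=
  MvPolynomial.map (Polynomial.evalRingHom a)

theorem specialize_surjective (a : K) : Function.Surjective (specialize a) :=
  MvPolynomial.map_surjective _ fun c => ⟨Polynomial.C c, by simp⟩

/-- The ideal of the total space of the family of the schemes with parameters `path x D t`. -/
noncomputable def familyIdeal (x D : Coord σ → K) : Ideal (MvPolynomial (Fin 4) (Polynomial K)) where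
  carrier := {G | ∀ᶠ a in Filter.cofinite, specialize a G ∈ schemeIdeal (path x D a)}
  zero_mem' := by simp
  add_mem' := by
    intro G G' h h'
    rw [Set.mem_ofPred] at h h' ⊢
    refine (h.and h').mono fun a ha => ?_
    rw [map_add]
    exact Ideal.add_mem _ ha.1 ha.2
  smul_mem' := by
    intro A G h
    rw [Set.mem_ofPred] at h ⊢
    refine h.mono fun a ha => ?_
    rw [smul_eq_mul, map_mul]
    exact Ideal.mul_mem_left _ _ ha

theorem mem_familyIdeal {x D : Coord σ → K} {G : MvPolynomial (Fin 4) (Polynomial K)} :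
    G ∈ familyIdeal x D ↔ ∀ᶠ a in Filter.cofinite, specialize a G ∈ schemeIdeal (path x D a) :=
  Iff.rfl

/-- On the ray t ↦ t w the grading becomes the grading by powers of t. This is why the vanishing
ideal of a cone is homogeneous. -/
theorem coeff_restrictLine_zero (w : Fin 4 → K) (F : MvPolynomial (Fin 4) K) (n : ℕ) :
    (restrictLine 0 w F).coeff n = eval w (homogeneousComponent n F) := by
  induction F using MvPolynomial.induction_on' with
  | monomial d a =>
    have h1 : restrictLine 0 w (monomial d a) =
        Polynomial.C (eval w (monomial d a)) * Polynomial.X ^ d.degree := by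
      have hd : d.degree = ∑ i ∈ d.support, d i := rfl
      simp only [restrictLine, aeval_monomial, Pi.zero_apply, map_zero, zero_add, mul_pow,
        eval_monomial, map_mul, Finsupp.prod, map_prod, map_pow, Finset.prod_mul_distrib,
        Finset.prod_pow_eq_pow_sum, Polynomial.algebraMap_eq, hd]
      ring
    rw [h1, Polynomial.coeff_C_mul, Polynomial.coeff_X_pow]
    by_cases h : d.degree = n
    · rw [homogeneousComponent_of_mem (isHomogeneous_monomial a h)]
      simp [h]
    · rw [homogeneousComponent_of_mem (isHomogeneous_monomial a rfl), if_neg (Ne.symm h),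
        if_neg (Ne.symm h)]
      simp
  | add p r hp hr => rw [map_add, Polynomial.coeff_add, hp, hr, map_add, map_add]

theorem homogeneousComponent_mem_vanishing [Infinite K] {Z : Set (Fin 4 → K)}
    (hZ : ∀ w ∈ Z, ∀ t : K, t • w ∈ Z) {F : MvPolynomial (Fin 4) K} (hF : F ∈ vanishingIdeal K Z)
    (n : ℕ) : homogeneousComponent n F ∈ vanishingIdeal K Z := by
  rw [mem_vanishing] at hF ⊢
  intro w hw
  rw [← coeff_restrictLine_zero, restrictLine_eq_zero, Polynomial.coeff_zero]
  intro t _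
  rw [zero_add]
  exact hF _ (hZ w hw t)

theorem smul_mem_spanPair {u v w : Fin 4 → K} (hw : w ∈ spanPair u v) (t : K) :
    t • w ∈ spanPair u v := Submodule.smul_mem _ t hw

theorem smul_mem_planeLine {a : Fin 3 → K} {w : Fin 4 → K} (hw : w ∈ planeLine a) (t : K) :
    t • w ∈ planeLine a :=
  ⟨by simp [hw.1], by
    have := hw.2
    simp only [Pi.smul_apply, smul_eq_mul]
    linear_combination t * this⟩

theorem smul_mem_piece {x : Coord σ → K} {α : Piece σ} {w : Fin 4 → K} (hw : w ∈ piece x α) (t : K) :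
    t • w ∈ piece x α := by
  rcases α with i | i | i | i
  · exact smul_mem_spanPair hw t
  · obtain ⟨e, he⟩ := Set.mem_iUnion.1 hw
    exact Set.mem_iUnion.2 ⟨e, smul_mem_spanPair he t⟩
  · obtain ⟨i, j, hk, hi, hj⟩ := mem_subStarCone.1 hw
    exact mem_subStarCone.2 ⟨i, j, hk, smul_mem_planeLine hi t, smul_mem_planeLine hj t⟩
  · exact Submodule.smul_mem _ t hw

theorem homogeneousComponent_map {R S : Type*} [CommSemiring R] [CommSemiring S] (f : R →+* S)
    (n : ℕ) (G : MvPolynomial (Fin 4) R) :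
    homogeneousComponent n (MvPolynomial.map f G) = MvPolynomial.map f (homogeneousComponent n G) := by
  ext d
  rw [coeff_homogeneousComponent, coeff_map, coeff_map, coeff_homogeneousComponent]
  split_ifs <;> simp

/-- Flatness over K[t] follows from torsion-freeness. The ideal disregards finitely many members, so
a nonzero r in K[t] may be cancelled by disregarding its roots as well. Homogeneity holds because
all pieces are cones. -/
theorem isFlatFamily_familyIdeal [Infinite K] (x D : Coord σ → K) : IsFlatFamily (familyIdeal x D) where
  homogeneous := by
    intro G hG n
    rw [mem_familyIdeal] at hG ⊢
    filter_upwards [hG] with a ha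
    rw [specialize, ← homogeneousComponent_map]
    rw [mem_schemeIdeal] at ha ⊢
    exact fun α => homogeneousComponent_mem_vanishing (fun w hw t => smul_mem_piece hw t) (ha α) n
  flat := by
    have : Module.IsTorsionFree (Polynomial K)
        (MvPolynomial (Fin 4) (Polynomial K) ⧸ familyIdeal x D) := by
      refine ⟨fun r hr => ?_⟩
      rw [isSMulRegular_iff_right_eq_zero_of_smul]
      intro m hm
      obtain ⟨G, rfl⟩ := Ideal.Quotient.mk_surjective m
      have hm' : Ideal.Quotient.mk (familyIdeal x D) (r • G) = 0 := hm
      rw [Ideal.Quotient.eq_zero_iff_mem, mem_familyIdeal] at hm' ⊢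
      have hr0 : r ≠ 0 := hr.ne_zero
      have hroot : ∀ᶠ a in Filter.cofinite, r.eval a ≠ 0 := by
        have := Polynomial.finite_setOfPred_isRoot hr0
        filter_upwards [this.compl_mem_cofinite] with a ha
        exact ha
      filter_upwards [hm', hroot] with a ha hra
      have : specialize a G = C (r.eval a)⁻¹ * specialize a (r • G) := by
        rw [smul_eq_C_mul, map_mul, map_C, ← mul_assoc, ← C_mul, Polynomial.coe_evalRingHom,
          inv_mul_cancel₀ hra, C_1, one_mul]
      rw [this]
      exact Ideal.mul_mem_left _ _ ha
    infer_instance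

/-- Evaluation of a family along a curve. -/
theorem eval_eval_curve (W : Fin 4 → Polynomial K) (G : MvPolynomial (Fin 4) (Polynomial K)) (t : K) :
    (eval W G).eval t = eval (fun j => (W j).eval t) (specialize t G) := by
  induction G using MvPolynomial.induction_on with
  | C a => simp
  | add p r hp hr => simp [hp, hr]
  | mul_X p i hp => rw [map_mul, Polynomial.eval_mul, hp, map_mul, map_mul]; simp

/-- An element of the ideal of the family vanishes along every curve in the total space. -/
theorem eval_curve_eq_zero [Infinite K] {x D : Coord σ → K}
    {G : MvPolynomial (Fin 4) (Polynomial K)} (hG : G ∈ familyIdeal x D) (W : Fin 4 → Polynomial K)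
    {α : Piece σ} (hW : ∀ t, (fun j => (W j).eval t) ∈ piece (path x D t) α) : eval W G = 0 := by
  refine Polynomial.eq_zero_of_infinite_isRoot _ ?_
  rw [mem_familyIdeal, Filter.eventually_cofinite] at hG
  refine hG.infinite_compl.mono fun t ht => ?_
  rw [Set.mem_ofPred, Polynomial.IsRoot, eval_eval_curve]
  have ht' : specialize t G ∈ schemeIdeal (path x D t) := by simpa using ht
  exact mem_vanishing.1 (mem_schemeIdeal.1 ht' α) _ (hW t)

/-- If two curves in the total space pass through the same point `q` at `t = 0` then the derivative of
the members of the ideal at `t = 0` in the direction of the difference of their velocities is zero. -/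
theorem dirDeriv_sub_eq_zero [Infinite K] {x D : Coord σ → K}
    {G : MvPolynomial (Fin 4) (Polynomial K)} (hG : G ∈ familyIdeal x D) {q n n' : Fin 4 → K}
    {α β : Piece σ} (hα : ∀ t : K, q + t • n ∈ piece (path x D t) α)
    (hβ : ∀ t : K, q + t • n' ∈ piece (path x D t) β) :
    dirDeriv q (n - n') (specialize 0 G) = 0 := by
  set F := specialize 0 G with hF
  -- Write G = F + t G₁ with F constant in t. The coefficient of t along a curve q + t m is the
  -- derivative of F at q in the direction m plus the value of G₁ at t = 0 and q. It is zero for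
  -- both curves, and the second term does not depend on the curve.
  obtain ⟨G₁, hG₁⟩ : C Polynomial.X ∣ G - MvPolynomial.map Polynomial.C F := by
    rw [C_dvd_iff_dvd_coeff]
    intro d
    rw [coeff_sub, coeff_map, hF, coeff_map, Polynomial.X_dvd_iff, Polynomial.coeff_sub,
      Polynomial.coeff_C_zero, Polynomial.coe_evalRingHom, Polynomial.coeff_zero_eq_eval_zero, sub_self]
  have hcurve (m : Fin 4 → K) : eval (fun i => Polynomial.C (q i) + Polynomial.X * Polynomial.C (m i))
      (MvPolynomial.map Polynomial.C F) = restrictLine q m F := by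
    rw [eval_map, restrictLine, aeval_def]
    rfl
  have key (m : Fin 4 → K) {γ : Piece σ} (hγ : ∀ t : K, q + t • m ∈ piece (path x D t) γ) :
      dirDeriv q m F = - eval q (specialize 0 G₁) := by
    have h0 := eval_curve_eq_zero hG (fun i => Polynomial.C (q i) + Polynomial.X * Polynomial.C (m i))
      (α := γ) (fun t => by
        convert hγ t using 1
        funext i
        simp only [Polynomial.eval_add, Polynomial.eval_mul, Polynomial.eval_C, Polynomial.eval_X,
          Pi.add_apply, Pi.smul_apply, smul_eq_mul])
    rw [sub_eq_iff_eq_add'.1 hG₁, map_add, hcurve, map_mul, eval_C] at h0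
    have h1 := congrArg (fun p => Polynomial.coeff p 1) h0
    simp only [Polynomial.coeff_add, coeff_one_restrictLine, Polynomial.coeff_X_mul,
      Polynomial.coeff_zero] at h1
    rw [Polynomial.coeff_zero_eq_eval_zero, eval_eval_curve] at h1
    simp only [Polynomial.eval_add, Polynomial.eval_mul, Polynomial.eval_C, Polynomial.eval_X, zero_mul,
      add_zero] at h1
    exact eq_neg_of_add_eq_zero_left h1
  rw [← dirDerivₗ_apply, map_sub, dirDerivₗ_apply, dirDerivₗ_apply, key n hα, key n' hβ, sub_self]

/-- If a moving linear subspace has a moving basis then every polynomial extends to a family, constant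
along the moving subspace up to scaling. -/
theorem exists_lift {r : ℕ} (b : Fin r → Fin 4 → Polynomial K) (a : K)
    (hb : LinearIndependent K fun i j => (b i j).eval a) (F : MvPolynomial (Fin 4) K) :
    ∃ G, specialize a G = F ∧ ∀ (t : K) (c : Fin r → K),
      (∀ s : K, eval (s • ∑ i, c i • fun j => (b i j).eval a) F = 0) →
        eval (∑ i, c i • fun j => (b i j).eval t) (specialize t G) = 0 := by
  classical
  let f : (Fin r → K) →ₗ[K] (Fin 4 → K) := Fintype.linearCombination K fun i j => (b i j).eval a
  obtain ⟨g, hg⟩ := LinearMap.exists_leftInverse_of_injective f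
    (LinearMap.ker_eq_bot.2 hb.fintypeLinearCombination_injective)
  -- M = 1 + (b(t) - b(a)) g, with g a left inverse of the frame at a. So M is the identity at t =
  -- a, and it carries the frame at a to the frame at t.
  let M : Matrix (Fin 4) (Fin 4) (Polynomial K) := 1 + Matrix.of fun j k =>
    ∑ i, (b i j - Polynomial.C ((b i j).eval a)) * Polynomial.C (g (Pi.single k 1) i)
  let Mt (t : K) : Matrix (Fin 4) (Fin 4) K := (Polynomial.evalRingHom t).mapMatrix M
  have hMa : Mt a = 1 := by
    simp only [Mt, M, map_add, map_one]
    ext j k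
    simp [Polynomial.eval_finsetSum]
  have hMt (t : K) (c : Fin r → K) : (Mt t).mulVec (∑ i, c i • fun j => (b i j).eval a) =
      ∑ i, c i • fun j => (b i j).eval t := by
    have hgc : g (∑ i, c i • fun j => (b i j).eval a) = c := LinearMap.congr_fun hg c
    set v : Fin 4 → K := ∑ i, c i • fun j => (b i j).eval a with hv
    have hgv : ∀ i, ∑ k, g (Pi.single k 1) i * v k = c i := by
      intro i
      conv_rhs => rw [← hgc, LinearMap.pi_apply_eq_sum_univ g v]
      rw [Finset.sum_apply]
      refine Finset.sum_congr rfl fun k _ => ?_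
      rw [Pi.smul_apply, smul_eq_mul, mul_comm]
      have hk : (Pi.single k 1 : Fin 4 → K) = fun j => if k = j then 1 else 0 := by
        funext j
        simp [Pi.single_apply, eq_comm]
      rw [hk]
    funext j
    simp only [Mt, M, map_add, map_one, Matrix.add_mulVec, Matrix.one_mulVec, Pi.add_apply]
    have : ((Polynomial.evalRingHom t).mapMatrix (Matrix.of fun j k =>
        ∑ i, (b i j - Polynomial.C ((b i j).eval a)) * Polynomial.C (g (Pi.single k 1) i))).mulVec v j =
        ∑ i, ((b i j).eval t - (b i j).eval a) * c i := by
      simp only [Matrix.mulVec, dotProduct, RingHom.mapMatrix_apply, Matrix.map_apply, Matrix.of_apply,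
        Polynomial.coe_evalRingHom, Polynomial.eval_finsetSum, Polynomial.eval_mul,
        Polynomial.eval_sub, Polynomial.eval_C, Finset.sum_mul]
      rw [Finset.sum_comm]
      refine Finset.sum_congr rfl fun i _ => ?_
      rw [← hgv, Finset.mul_sum]
      exact Finset.sum_congr rfl fun k _ => by ring
    rw [this, hv]
    simp only [Finset.sum_apply, Pi.smul_apply, smul_eq_mul, ← Finset.sum_add_distrib]
    exact Finset.sum_congr rfl fun i _ => by ring
  -- F is composed with the adjugate of M, not the inverse, which keeps everything polynomial in t.
  -- The price is the factor det M on the moved vectors, which the scalar s in the hypothesis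
  -- absorbs.
  let y : Fin 4 → MvPolynomial (Fin 4) (Polynomial K) := fun j => ∑ k, C (M.adjugate j k) * X k
  refine ⟨eval₂ (C.comp Polynomial.C) y F, ?_, ?_⟩
  · have hy : ∀ j, specialize a (y j) = X j := by
      intro j
      have h1 : ∀ k, (M.adjugate j k).eval a = (1 : Matrix (Fin 4) (Fin 4) K) j k := by
        intro k
        have h2 := RingHom.map_adjugate (Polynomial.evalRingHom a) M
        rw [show (Polynomial.evalRingHom a).mapMatrix M = 1 from hMa, Matrix.adjugate_one] at h2
        exact congrFun (congrFun h2 j) k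
      simp [y, h1, Matrix.one_apply]
    induction F using MvPolynomial.induction_on with
    | C c => simp
    | add p q hp hq => rw [eval₂_add, map_add, hp, hq]
    | mul_X p i hp => rw [eval₂_mul, map_mul, hp, eval₂_X, hy]
  · intro t c hc
    have hy : ∀ v : Fin 4 → K, eval v (specialize t (eval₂ (C.comp Polynomial.C) y F)) =
        eval ((Mt t).adjugate.mulVec v) F := by
      intro v
      have hyj : ∀ j, eval v (specialize t (y j)) = (Mt t).adjugate.mulVec v j := by
        intro j
        rw [← RingHom.map_adjugate]
        simp [y, Matrix.mulVec, dotProduct]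
      clear hc
      induction F using MvPolynomial.induction_on with
      | C c => simp
      | add p q hp hq => rw [eval₂_add, map_add, map_add, hp, hq, map_add]
      | mul_X p i hp =>
        rw [eval₂_mul, map_mul, map_mul, hp, eval₂_X, hyj, map_mul, eval_X]
    rw [hy, ← hMt, Matrix.mulVec_mulVec, Matrix.adjugate_mul, Matrix.smul_mulVec, Matrix.one_mulVec]
    exact hc _

end Families

/-! ### Bounds for the members of a family -/

section Members

variable {K : Type*} [Field K] {σ : SchemeType}

/-- The pieces of the scheme are non-degenerate. -/
structure Framed (y : Coord σ → K) : Prop where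
  line : ∀ i, LinearIndependent K ![linePt y i 0, linePt y i 1]
  cross : ∀ i, LinearIndependent K ![inPlane (vtx y i), armPt y i 0, armPt y i 1]
  pt : ∀ i, collPt y i ≠ 0

theorem Good.framed {y : Coord σ → K} (h : Good y) : Framed y :=
  ⟨h.linearIndependent_line, h.linearIndependent_cross, fun i => ne_zero_of_apply (h.pt_third i)⟩

/-- The moving spanning vectors of a line; `crossFrame` and `ptFrame` play the same role for crosses
and collinear points. A point with constant coefficients in such a frame traces a curve in the total
space. -/
noncomputable def lineFrame (x D : Coord σ → K) (i : Fin σ.lines) (e : Fin 2) (j : Fin 4) :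
    Polynomial K := pathPoly x D (.line i e j)

noncomputable def crossFrame (x D : Coord σ → K) (i : Fin σ.crosses) : Fin 3 → Fin 4 → Polynomial K :=
  ![![pathPoly x D (.vertex i 0), pathPoly x D (.vertex i 1), pathPoly x D (.vertex i 2), 0],
    fun j => pathPoly x D (.arm i 0 j), fun j => pathPoly x D (.arm i 1 j)]

noncomputable def ptFrame (x D : Coord σ → K) (i : Fin σ.collinear) (_ : Fin 1) (j : Fin 4) :
    Polynomial K :=
  pathPoly x D (.pt i 0) * pathPoly x D (.axis 0 j) + pathPoly x D (.pt i 1) * pathPoly x D (.axis 1 j)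

theorem eval_lineFrame (x D : Coord σ → K) (i : Fin σ.lines) (t : K) :
    (fun e j => (lineFrame x D i e j).eval t) =
      ![linePt (path x D t) i 0, linePt (path x D t) i 1] := by
  funext e j
  fin_cases e <;> simp [lineFrame, linePt]

theorem eval_crossFrame (x D : Coord σ → K) (i : Fin σ.crosses) (t : K) :
    (fun e j => (crossFrame x D i e j).eval t) =
      ![inPlane (vtx (path x D t) i), armPt (path x D t) i 0, armPt (path x D t) i 1] := by
  funext e j
  fin_cases e
  · fin_cases j <;> simp [crossFrame, inPlane, vtx]
  · simp [crossFrame, armPt]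
  · simp [crossFrame, armPt]

theorem eval_ptFrame (x D : Coord σ → K) (i : Fin σ.collinear) (t : K) :
    (fun e j => (ptFrame x D i e j).eval t) = ![collPt (path x D t) i] := by
  funext e j
  fin_cases e
  simp [ptFrame, collPt]

theorem path_static {x D : Coord σ → K} {c : Coord σ} (h : D c = 0) (t : K) :
    path x D t c = x c := by simp [path, h]

theorem starEq_path {x D : Coord σ → K} (hs : ∀ i j, D (.star i j) = 0) (t : K) :
    starEq (path x D t) = starEq x := by
  funext i j; exact path_static (hs i j) t

/-- The coordinates, with respect to the frame of a piece, of the points of the piece. -/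
theorem exists_coeff_of_mem_piece (x D : Coord σ → K) (α : Piece σ) :
    α = .inr (.inr (.inl ())) ∨ ∃ (r : ℕ) (b : Fin r → Fin 4 → Polynomial K),
      (∀ a, Framed (path x D a) → LinearIndependent K fun i j => (b i j).eval a) ∧
      ∃ Z : Set (Fin r → K), ∀ t, piece (path x D t) α =
        (fun c => ∑ i, c i • fun j => (b i j).eval t) '' Z := by
  have hsum {r : ℕ} (b : Fin r → Fin 4 → Polynomial K) (v : Fin r → Fin 4 → K) (t : K)
      (h : (fun i j => (b i j).eval t) = v) (c : Fin r → K) :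
      (∑ i, c i • fun j => (b i j).eval t) = ∑ i, c i • v i := by rw [← h]
  rcases α with i | i | i | i
  · refine .inr ⟨2, lineFrame x D i, fun a ha => by rw [eval_lineFrame]; exact ha.line i, Set.univ, ?_⟩
    intro t
    simp only [hsum _ _ t (eval_lineFrame x D i t), Fin.sum_univ_two]
    ext w
    constructor
    · intro hw
      obtain ⟨s, s', rfl⟩ := mem_spanPair.1 hw
      exact ⟨![s, s'], Set.mem_univ _, rfl⟩
    · rintro ⟨c, -, rfl⟩
      exact mem_spanPair.2 ⟨c 0, c 1, rfl⟩
  · refine .inr ⟨3, crossFrame x D i, fun a ha => by rw [eval_crossFrame]; exact ha.cross i,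
      {c | c 1 = 0 ∨ c 2 = 0}, ?_⟩
    intro t
    simp only [hsum _ _ t (eval_crossFrame x D i t), Fin.sum_univ_three]
    ext w
    constructor
    · intro hw
      obtain ⟨e, he⟩ := Set.mem_iUnion.1 hw
      obtain ⟨s, s', rfl⟩ := mem_spanPair.1 he
      fin_cases e
      · exact ⟨![s, s', 0], .inr rfl, by simp⟩
      · exact ⟨![s, 0, s'], .inl rfl, by simp⟩
    · rintro ⟨c, hc | hc, rfl⟩
      · exact Set.mem_iUnion.2 ⟨1, mem_spanPair.2 ⟨c 0, c 2, by simp [hc]⟩⟩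
      · exact Set.mem_iUnion.2 ⟨0, mem_spanPair.2 ⟨c 0, c 1, by simp [hc]⟩⟩
  · exact .inl rfl
  · refine .inr ⟨1, ptFrame x D i, fun a ha => ?_, Set.univ, ?_⟩
    · rw [eval_ptFrame]
      exact LinearIndependent.of_subsingleton 0 (ha.pt i)
    intro t
    simp only [hsum _ _ t (eval_ptFrame x D i t), Fin.sum_univ_one]
    ext w
    constructor
    · intro hw
      obtain ⟨s, rfl⟩ := mem_pointCone.1 hw
      exact ⟨![s], Set.mem_univ _, rfl⟩
    · rintro ⟨c, -, rfl⟩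
      exact mem_pointCone.2 ⟨c 0, rfl⟩

/-- A single nondegenerate piece moves by linear changes of its frame, so its ideal extends by
`exists_lift`; the sub-star does not move and its ideal extends constantly. -/
theorem exists_lift_piece {x D : Coord σ → K} (hs : ∀ i j, D (.star i j) = 0) {a : K}
    (ha : Framed (path x D a)) (α : Piece σ) {F : MvPolynomial (Fin 4) K}
    (hF : F ∈ vanishingIdeal K (piece (path x D a) α)) :
    ∃ G, specialize a G = F ∧ ∀ t, specialize t G ∈ vanishingIdeal K (piece (path x D t) α) := by
  rcases exists_coeff_of_mem_piece x D α with rfl | ⟨r, b, hb, Z, hZ⟩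
  · refine ⟨MvPolynomial.map Polynomial.C F, ?_, fun t => ?_⟩ <;>
      rw [MvPolynomial.map_map, show (Polynomial.evalRingHom _).comp Polynomial.C = RingHom.id K by
        ext; simp, MvPolynomial.map_id]
    simpa only [piece, starEq_path hs] using hF
  · obtain ⟨G, hG, h⟩ := exists_lift b a (hb a ha) F
    refine ⟨G, hG, fun t => ?_⟩
    rw [mem_vanishing, hZ]
    rintro _ ⟨c, hc, rfl⟩
    refine h t c fun s => mem_vanishing.1 hF _ (smul_mem_piece ?_ s)
    rw [hZ]
    exact ⟨c, hc, rfl⟩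

theorem exists_curve {x D : Coord σ → K} (hs : ∀ i j, D (.star i j) = 0) {a : K} {α : Piece σ}
    {w : Fin 4 → K} (hw : w ∈ piece (path x D a) α) :
    ∃ W : Fin 4 → Polynomial K, (fun j => (W j).eval a) = w ∧
      ∀ t, (fun j => (W j).eval t) ∈ piece (path x D t) α := by
  rcases exists_coeff_of_mem_piece x D α with rfl | ⟨r, b, hb, Z, hZ⟩
  · refine ⟨fun j => Polynomial.C (w j), by simp, fun t => ?_⟩
    simpa only [piece, starEq_path hs, Polynomial.eval_C] using hw
  · rw [hZ] at hw
    obtain ⟨c, hc, rfl⟩ := hw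
    have key : ∀ t, (fun j => (∑ i, Polynomial.C (c i) * b i j).eval t) =
        ∑ i, c i • fun j => (b i j).eval t := by
      intro t
      funext j
      simp [Polynomial.eval_finsetSum]
    refine ⟨fun j => ∑ i, Polynomial.C (c i) * b i j, key a, fun t => ?_⟩
    rw [key, hZ]
    exact ⟨c, hc, rfl⟩

/-- The ideal of the member at `t = a`, before saturation. -/
noncomputable abbrev memberIdeal (x D : Coord σ → K) (a : K) : Ideal (MvPolynomial (Fin 4) K) :=
  (familyIdeal x D).map (specialize a)

theorem mem_memberIdeal {x D : Coord σ → K} {a : K} {F : MvPolynomial (Fin 4) K} :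
    F ∈ memberIdeal x D a ↔ ∃ G ∈ familyIdeal x D, specialize a G = F :=
  Ideal.mem_map_iff_of_surjective _ (specialize_surjective a)

/-- Products of forms vanishing on the pieces of the member at `t = a` extend to the family. -/
theorem prod_le_memberIdeal {x D : Coord σ → K} (hs : ∀ i j, D (.star i j) = 0) {a : K}
    (ha : Framed (path x D a)) :
    ∏ α, vanishingIdeal K (piece (path x D a) α) ≤ memberIdeal x D a := by
  -- Lifts are available for one piece at a time, and lifts of one F for different pieces need not
  -- agree. Therefore the product of the ideals extends, and not directly their intersection.
  let J (α : Piece σ) : Ideal (MvPolynomial (Fin 4) (Polynomial K)) :=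
    ⨅ t, (vanishingIdeal K (piece (path x D t) α)).comap (specialize t)
  have hJ : ∀ α, vanishingIdeal K (piece (path x D a) α) ≤ (J α).map (specialize a) := by
    intro α F hF
    obtain ⟨G, rfl, hG⟩ := exists_lift_piece hs ha α hF
    exact Ideal.mem_map_of_mem _ (Ideal.mem_iInf.2 fun t => hG t)
  have hprod : ∏ α, J α ≤ familyIdeal x D := by
    intro G hG
    rw [mem_familyIdeal]
    refine Filter.Eventually.of_forall fun t => mem_schemeIdeal.2 fun α => ?_
    exact Ideal.mem_iInf.1 (Ideal.le_of_dvd (Finset.dvd_prod_of_mem J (Finset.mem_univ α)) hG) t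
  calc ∏ α, vanishingIdeal K (piece (path x D a) α)
      ≤ ∏ α, (J α).map (specialize a) := Finset.prod_le_prod' fun α _ => hJ α
    _ = (∏ α, J α).map (specialize a) := (map_prod (Ideal.mapHom (specialize a)) J Finset.univ).symm
    _ ≤ memberIdeal x D a := Ideal.map_mono hprod

/-- Every point of a piece at t = a lies on a curve in the total space. An element of the ideal of
the family vanishes along the curve at almost all t, hence at a. -/
theorem memberIdeal_le [Infinite K] {x D : Coord σ → K} (hs : ∀ i j, D (.star i j) = 0) (a : K)
    (α : Piece σ) : memberIdeal x D a ≤ vanishingIdeal K (piece (path x D a) α) := by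
  intro F hF
  obtain ⟨G, hG, rfl⟩ := mem_memberIdeal.1 hF
  rw [mem_vanishing]
  intro w hw
  obtain ⟨W, rfl, hW⟩ := exists_curve hs hw
  rw [← eval_eval_curve, eval_curve_eq_zero hG W hW, Polynomial.eval_zero]

theorem exists_planeLine_ne_zero (a b : Fin 3 → K) :
    ∃ n : Fin 4 → K, n ≠ 0 ∧ n ∈ planeLine a ∧ n ∈ planeLine b := by
  obtain ⟨v, hv, h⟩ := Matrix.exists_mulVec_eq_zero_iff.2
    (show Matrix.det (Matrix.of ![a, b, 0]) = 0 by
      exact Matrix.det_eq_zero_of_row_eq_zero 2 fun j => rfl)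
  refine ⟨inPlane v, inPlane_ne_zero hv, mem_planeLine.2 ⟨rfl, ?_⟩, mem_planeLine.2 ⟨rfl, ?_⟩⟩
  · have := congrFun h 0
    rw [proj_inPlane]
    simpa [Matrix.mulVec, dotProduct, Fin.sum_univ_three, dot] using this
  · have := congrFun h 1
    rw [proj_inPlane]
    simpa [Matrix.mulVec, dotProduct, Fin.sum_univ_three, dot] using this

/-- Excludes pieces that consist of the origin alone, whose ideal would not be saturated. -/
theorem exists_ne_zero_mem_piece {y : Coord σ → K} (hy : Framed y) {α : Piece σ} {w : Fin 4 → K}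
    (hw : w ∈ piece y α) : ∃ n ∈ piece y α, n ≠ 0 := by
  rcases α with i | i | i | i
  · exact ⟨_, left_mem_spanPair _ _, (hy.line i).ne_zero 0⟩
  · exact ⟨_, Set.mem_iUnion.2 ⟨0, left_mem_spanPair _ _⟩, (hy.cross i).ne_zero 0⟩
  · obtain ⟨i, j, hk, -, -⟩ := mem_subStarCone.1 hw
    obtain ⟨n, hn, h1, h2⟩ := exists_planeLine_ne_zero (starEq y i) (starEq y j)
    exact ⟨n, mem_subStarCone.2 ⟨i, j, hk, h1, h2⟩, hn⟩
  · exact ⟨_, mem_pointCone.2 ⟨1, one_smul _ _⟩, hy.pt i⟩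

/-- The ideal of a cone which contains a non-zero point is saturated. -/
theorem saturation_le_vanishing [IsAlgClosed K] {I : Ideal (MvPolynomial (Fin 4) K)}
    {Z : Set (Fin 4 → K)} (h : I ≤ vanishingIdeal K Z) (hZ : ∀ w ∈ Z, ∀ t : K, t • w ∈ Z)
    (hne : ∀ w ∈ Z, ∃ n ∈ Z, n ≠ 0) : saturation I ≤ vanishingIdeal K Z := by
  intro F hF
  rw [mem_saturation_iff] at hF
  have key : ∀ w ∈ Z, w ≠ 0 → eval w F = 0 := by
    intro w hw h0
    obtain ⟨g, hg, hgF⟩ := hF w h0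
    have := mem_vanishing.1 (h hgF) w hw
    rw [map_mul] at this
    exact (mul_eq_zero.1 this).resolve_left hg
  rw [mem_vanishing]
  intro w hw
  by_cases h0 : w = 0
  · obtain ⟨n, hn, hn0⟩ := hne w hw
    refine eval_eq_zero_of_line (n := n) fun t ht => ?_
    rw [h0, zero_add]
    exact key _ (hZ n hn t) (smul_ne_zero ht hn0)
  · exact key w hw h0

theorem exists_separating_submodule (W : Submodule K (Fin 4 → K)) {q : Fin 4 → K} (hq : q ∉ W) :
    ∃ g ∈ vanishingIdeal K (W : Set (Fin 4 → K)), eval q g ≠ 0 := by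
  obtain ⟨φ, hφ, h⟩ := Submodule.exists_dual_map_eq_bot_of_notMem hq inferInstance
  refine ⟨linearPoly φ, mem_vanishing.2 fun w hw => ?_, by rwa [eval_linearPoly]⟩
  rw [eval_linearPoly]
  have : φ w ∈ W.map φ := Submodule.mem_map_of_mem hw
  rwa [h] at this

theorem exists_separating_iUnion {ι : Type*} [Finite ι] {Z : ι → Set (Fin 4 → K)} {q : Fin 4 → K}
    (h : ∀ i, ∃ g ∈ vanishingIdeal K (Z i), eval q g ≠ 0) :
    ∃ g ∈ vanishingIdeal K (⋃ i, Z i), eval q g ≠ 0 := by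
  cases nonempty_fintype ι
  choose g hg hq using h
  refine ⟨∏ i, g i, mem_vanishing.2 fun w hw => ?_, ?_⟩
  · obtain ⟨i, hi⟩ := Set.mem_iUnion.1 hw
    rw [map_prod]
    exact Finset.prod_eq_zero (Finset.mem_univ i) (mem_vanishing.1 (hg i) w hi)
  · rw [map_prod]
    exact Finset.prod_ne_zero_iff.2 fun i _ => hq i

theorem exists_separating_planeLine {a : Fin 3 → K} {q : Fin 4 → K} (hq : q ∉ planeLine a) :
    ∃ g ∈ vanishingIdeal K (planeLine a), eval q g ≠ 0 := by
  by_cases h3 : q 3 = 0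
  · refine ⟨C (a 0) * X 0 + C (a 1) * X 1 + C (a 2) * X 2, mem_vanishing.2 fun w hw => ?_, ?_⟩
    · simpa using hw.2
    · simpa using fun h => hq ⟨h3, h⟩
  · exact ⟨X 3, mem_vanishing.2 fun w hw => by simpa using hw.1, by simpa using h3⟩

theorem vanishing_anti {Z Z' : Set (Fin 4 → K)} (h : Z ⊆ Z') :
    vanishingIdeal K Z' ≤ vanishingIdeal K Z := vanishingIdeal_anti_mono h

/-- The pieces are closed. -/
theorem exists_separating_piece {y : Coord σ → K} {α : Piece σ} {q : Fin 4 → K}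
    (hq : q ∉ piece y α) : ∃ g ∈ vanishingIdeal K (piece y α), eval q g ≠ 0 := by
  rcases α with i | i | i | i
  · exact exists_separating_submodule _ hq
  · exact exists_separating_iUnion fun e => exists_separating_submodule _ fun he =>
      hq (Set.mem_iUnion.2 ⟨e, he⟩)
  · refine exists_separating_iUnion fun i => exists_separating_iUnion fun j =>
      ?_
    by_cases hk : IsKept σ.omitted i j
    swap
    · exact ⟨1, by simp [hk], by simp⟩
    simp only [hk, Set.iUnion_true]
    by_cases hi : q ∈ planeLine (starEq y i)
    · have hj : q ∉ planeLine (starEq y j) := fun hj => hq (mem_subStarCone.2 ⟨i, j, hk, hi, hj⟩)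
      obtain ⟨g, hg, h⟩ := exists_separating_planeLine hj
      exact ⟨g, vanishing_anti Set.inter_subset_right hg, h⟩
    · obtain ⟨g, hg, h⟩ := exists_separating_planeLine hi
      exact ⟨g, vanishing_anti Set.inter_subset_left hg, h⟩
  · exact exists_separating_submodule _ hq

/-- Members with disjoint pieces are as expected. -/
theorem member_familyIdeal [IsAlgClosed K] {x D : Coord σ → K} (hs : ∀ i j, D (.star i j) = 0) {a : K}
    (ha : Good (path x D a)) : member (familyIdeal x D) a = schemeIdeal (path x D a) := by
  have hinf : Infinite K := inferInstance
  refine le_antisymm ?_ ?_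
  · intro F hF
    rw [mem_schemeIdeal]
    exact fun α => saturation_le_vanishing (memberIdeal_le hs a α)
      (fun w hw t => smul_mem_piece hw t) (fun w hw => exists_ne_zero_mem_piece ha.framed hw) hF
  · intro F hF
    rw [mem_schemeIdeal] at hF
    refine mem_saturation_iff.2 fun q hq => localAt_mono (prod_le_memberIdeal hs ha.framed) ?_
    -- By disjointness q lies on at most one piece. If it lies on none, any α serves; otherwise α is
    -- that piece. Locally at q the product then contains the ideal of α.
    obtain ⟨α, hα⟩ : ∃ α : Piece σ, ∀ β, β ≠ α → q ∉ piece (path x D a) β := by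
      by_contra! hc
      obtain ⟨β, hβ, hqβ⟩ := hc (.inr (.inr (.inl ())))
      obtain ⟨γ, hγ, hqγ⟩ := hc β
      exact hq (ha.eq_zero_of_mem hγ hqγ hqβ)
    exact le_localAt_prod α (fun β hβ => exists_separating_piece (hα β hβ)) (hF α)

end Members

/-! ### Parameters of trace schemes and their conditions of generality -/

section Trace

variable {K : Type*} {τ : TraceType}

/-- The trace parameters with given data. -/
def mkTrace (l : Fin τ.lines → Fin 3 → K) (d : Fin τ.doubles → Fin 3 → K)
    (p q : Fin τ.lengthTwo → Fin 3 → K) (s : Fin τ.starLines → Fin 3 → K)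
    (o : Fin τ.points → Fin 3 → K) (a : Fin 2 → Fin 3 → K) (c : Fin τ.collinear → Fin 2 → K) :
    TraceCoord τ → K
  | .line i j => l i j
  | .double i j => d i j
  | .support i j => p i j
  | .direction i j => q i j
  | .star i j => s i j
  | .point i j => o i j
  | .axis e j => a e j
  | .pt i e => c i e

variable [Field K]

/-- The equations of the lines of the trace and of the lines of its star configuration. -/
def traceLn (z : TraceCoord τ → K) : Fin τ.lines ⊕ Fin τ.starLines → Fin 3 → K :=
  Sum.elim (fun i j => z (.line i j)) (fun i j => z (.star i j))

/-- The points of the support of the trace which are not on its lines, apart from the sub-star. -/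
def traceMk (z : TraceCoord τ → K) :
    Fin τ.doubles ⊕ Fin τ.lengthTwo ⊕ Fin τ.points ⊕ Fin τ.collinear → Fin 3 → K :=
  Sum.elim (fun i j => z (.double i j)) (Sum.elim (fun i j => z (.support i j))
    (Sum.elim (fun i j => z (.point i j))
      (fun i j => z (.pt i 0) * z (.axis 0 j) + z (.pt i 1) * z (.axis 1 j))))

/-- Source of the examples for `forGeneral_goodTrace`: the lines are arbitrary and every marked
point is one of two vectors. The collinear points fit in because their axis is spanned by these two
vectors. -/
theorem exists_traceParams (L : Fin τ.lines ⊕ Fin τ.starLines → Fin 3 → K) (a b : Fin 3 → K)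
    (χ : Fin τ.doubles ⊕ Fin τ.lengthTwo ⊕ Fin τ.points ⊕ Fin τ.collinear → Prop)
    [DecidablePred χ] :
    ∃ z : TraceCoord τ → K, traceLn z = L ∧ traceMk z = fun m => if χ m then a else b := by
  refine ⟨mkTrace (fun i => L (.inl i)) (fun i => if χ (.inl i) then a else b)
    (fun i => if χ (.inr (.inl i)) then a else b) 0 (fun i => L (.inr i))
    (fun i => if χ (.inr (.inr (.inl i))) then a else b) ![a, b]
    (fun i => if χ (.inr (.inr (.inr i))) then ![1, 0] else ![0, 1]), ?_, ?_⟩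
  · funext i
    rcases i with i | i <;> rfl
  · funext i
    rcases i with i | i | i | i
    · rfl
    · rfl
    · rfl
    · funext j
      simp only [traceMk, mkTrace, Sum.elim_inr]
      split_ifs <;> simp

/-- Explicit conditions satisfied by a general trace scheme. -/
structure GoodTrace (z : TraceCoord τ → K) : Prop where
  triple : ∀ i j k, i ≠ j → i ≠ k → j ≠ k →
    dot (traceLn z i) (cr (traceLn z j) (traceLn z k)) ≠ 0
  pair : ∀ i j, i ≠ j → cr (traceLn z i) (traceLn z j) 2 ≠ 0
  line : ∀ i, traceLn z i 2 ≠ 0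
  line_mark : ∀ i m, dot (traceLn z i) (traceMk z m) ≠ 0
  mark_mark : ∀ m m', m ≠ m' → cr (traceMk z m) (traceMk z m') 2 ≠ 0
  mark : ∀ m, traceMk z m 2 ≠ 0

theorem IsPolyFun.traceLn (i : Fin τ.lines ⊕ Fin τ.starLines) (j : Fin 3) :
    IsPolyFun fun z : TraceCoord τ → K => traceLn z i j := by
  rcases i with i | i
  exacts [.coord _, .coord _]

theorem IsPolyFun.traceMk (m : Fin τ.doubles ⊕ Fin τ.lengthTwo ⊕ Fin τ.points ⊕ Fin τ.collinear)
    (j : Fin 3) : IsPolyFun fun z : TraceCoord τ → K => traceMk z m j := by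
  rcases m with i | i | i | i
  exacts [.coord _, .coord _, .coord _, ((coord _).mul (coord _)).add ((coord _).mul (coord _))]

theorem forGeneral_goodTrace [Infinite K] (τ : TraceType) :
    ForGeneral fun z : TraceCoord τ → K => GoodTrace z := by
  classical
  have h1 : ForGeneral fun z : TraceCoord τ → K => ∀ i j k, i ≠ j → i ≠ k → j ≠ k →
      dot (traceLn z i) (cr (traceLn z j) (traceLn z k)) ≠ 0 := by
    refine .all fun i => .all fun j => .all fun k => .imp fun hij => .imp fun hik => .imp fun hjk =>
      .of_poly (.dot (.traceLn _) (.cr (.traceLn _) (.traceLn _))) ?_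
    obtain ⟨z, hz, -⟩ := exists_traceParams (τ := τ) (K := K)
      (fun m => if m = i then ![1, 0, 0] else if m = j then ![0, 1, 0] else ![0, 0, 1]) 0 0
      fun _ => True
    exact ⟨z, by rw [hz]; simp [dot, cr, hij.symm, hik.symm, hjk.symm]⟩
  have h2 : ForGeneral fun z : TraceCoord τ → K => ∀ i j, i ≠ j →
      cr (traceLn z i) (traceLn z j) 2 ≠ 0 := by
    refine .all fun i => .all fun j => .imp fun hij => .of_poly (.cr (.traceLn _) (.traceLn _) _) ?_
    obtain ⟨z, hz, -⟩ := exists_traceParams (τ := τ) (K := K)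
      (fun m => if m = i then ![1, 0, 0] else ![0, 1, 0]) 0 0 fun _ => True
    exact ⟨z, by rw [hz]; simp [cr, hij.symm]⟩
  have h3 : ForGeneral fun z : TraceCoord τ → K => ∀ i, traceLn z i 2 ≠ 0 := by
    refine .all fun i => .of_poly (.traceLn _ _) ?_
    obtain ⟨z, hz, -⟩ := exists_traceParams (τ := τ) (K := K) 1 0 0 fun _ => True
    exact ⟨z, by rw [hz]; simp⟩
  have h4 : ForGeneral fun z : TraceCoord τ → K => ∀ i m, dot (traceLn z i) (traceMk z m) ≠ 0 := by
    refine .all fun i => .all fun m => .of_poly (.dot (.traceLn _) (.traceMk _)) ?_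
    obtain ⟨z, hz, hz'⟩ := exists_traceParams (τ := τ) (K := K) (fun _ => ![1, 0, 0]) ![1, 0, 0] 0
      fun _ => True
    exact ⟨z, by rw [hz, hz']; simp [dot]⟩
  have h5 : ForGeneral fun z : TraceCoord τ → K => ∀ m m', m ≠ m' →
      cr (traceMk z m) (traceMk z m') 2 ≠ 0 := by
    refine .all fun m => .all fun m' => .imp fun hm => .of_poly (.cr (.traceMk _) (.traceMk _) _) ?_
    obtain ⟨z, -, hz⟩ := exists_traceParams (τ := τ) (K := K) 0 ![1, 0, 0] ![0, 1, 0] fun k => k = m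
    exact ⟨z, by rw [hz]; simp [cr, hm.symm]⟩
  have h6 : ForGeneral fun z : TraceCoord τ → K => ∀ m, traceMk z m 2 ≠ 0 := by
    refine .all fun m => .of_poly (.traceMk _ _) ?_
    obtain ⟨z, -, hz⟩ := exists_traceParams (τ := τ) (K := K) 0 1 0 fun _ => True
    exact ⟨z, by rw [hz]; simp⟩
  refine (h1.and (h2.and (h3.and (h4.and (h5.and h6))))).mono ?_
  rintro z ⟨a1, a2, a3, a4, a5, a6⟩
  exact ⟨a1, a2, a3, a4, a5, a6⟩

/-- Two general covectors are cross products with their common zero. -/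
theorem exists_cr_cr_eq {a : Fin 2 → Fin 3 → K} {j : Fin 3} (h : cr (a 0) (a 1) j ≠ 0) :
    ∃ q : Fin 2 → Fin 3 → K, ∀ e, cr (cr (a 0) (a 1)) (q e) = a e := by
  obtain ⟨d, hd⟩ : ∃ d, dot (cr (a 0) (a 1)) d = 1 := by
    refine ⟨Pi.single j (cr (a 0) (a 1) j)⁻¹, ?_⟩
    fin_cases j <;> simpa [dot] using mul_inv_cancel₀ h
  refine ⟨fun e => cr (a e) d, fun e => ?_⟩
  simp only [dot, cr, Matrix.cons_val_zero, Matrix.cons_val_one, Matrix.cons_val] at hd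
  fin_cases e <;> ext k <;> fin_cases k <;>
    simp only [cr, Fin.zero_eta, Fin.mk_one, Fin.reduceFinMk, Matrix.cons_val_zero,
      Matrix.cons_val_one, Matrix.cons_val]
  · linear_combination (a 0 0) * hd
  · linear_combination (a 0 1) * hd
  · linear_combination (a 0 2) * hd
  · linear_combination (a 1 0) * hd
  · linear_combination (a 1 1) * hd
  · linear_combination (a 1 2) * hd

/-- Makes every covector of H the equation of a flattened line; `exists_cr_cr_eq` does the same for
the two lines of a flattened cross. -/
theorem exists_cr_eq (a : Fin 3 → K) : ∃ u v : Fin 3 → K, cr u v = a := by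
  by_cases h : a 2 = 0
  · refine ⟨![-a 1, a 0, 0], ![0, 0, 1], ?_⟩
    ext k; fin_cases k <;> simp [cr, h]
  · refine ⟨![1, 0, -a 0 / a 2], ![0, a 2, -a 1], ?_⟩
    ext k; fin_cases k <;> simp [cr, h]

end Trace

/-! ### Roles of the pieces, and dominance of the maps to trace and residual parameters -/

/-- A numbering of the pieces according to their role in the specialization `S(l, s, 0, c)`. -/
structure Split (σ : SchemeType) (l s c : ℕ) where
  lines : Fin σ.lines ≃ Fin l ⊕ (Fin s × Fin 2) ⊕ Fin (traceType σ l s 0 c).points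
  crosses : Fin σ.crosses ≃ Fin c ⊕ Fin (traceType σ l s 0 c).lengthTwo
  star : Fin (traceType σ l s 0 c).lines ≃ (Fin c × Fin 2) ⊕ Fin l
  resLines : Fin (residualType σ l s 0 c).lines ≃ Fin (traceType σ l s 0 c).points
  resCrosses : Fin (residualType σ l s 0 c).crosses ≃
    Fin (traceType σ l s 0 c).lengthTwo ⊕ Fin s
  resStar : Fin (residualType σ l s 0 c).starLines ≃ (Fin c × Fin 2) ⊕ Fin l
  -- The two lines of the m-th moved cross get the numbers 2m and 2m + 1, so that its vertex is one
  -- of the nodes omitted by `IsKept`.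
  resStar_val : ∀ m e, (resStar.symm (.inl (m, e)) : ℕ) = 2 * m + e

theorem exists_split (σ : SchemeType) {l s c : ℕ} (hl : l + 2 * s ≤ σ.lines) (hc : c ≤ σ.crosses) :
    Nonempty (Split σ l s c) := by
  let e : (Fin c × Fin 2) ⊕ Fin l ≃ Fin (l + 2 * c + 0) :=
    (Equiv.sumCongr finProdFinEquiv (Equiv.refl _)).trans
      (finSumFinEquiv.trans (finCongr (by ring)))
  have h1 : (traceType σ l s 0 c).points = σ.lines - l - 2 * s := rfl
  have h2 : (traceType σ l s 0 c).lengthTwo = σ.crosses - c := rfl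
  have h3 : (residualType σ l s 0 c).lines = σ.lines - l - 2 * s := rfl
  have h4 : (residualType σ l s 0 c).crosses = σ.crosses - c + s := rfl
  refine ⟨⟨Fintype.equivOfCardEq ?_, Fintype.equivOfCardEq ?_, e.symm,
    Fintype.equivOfCardEq ?_, Fintype.equivOfCardEq ?_, e.symm, ?_⟩⟩
  · simp only [Fintype.card_sum, Fintype.card_prod, Fintype.card_fin]
    omega
  · simp only [Fintype.card_sum, Fintype.card_fin]
    omega
  · simp only [Fintype.card_fin]
    omega
  · simp only [Fintype.card_sum, Fintype.card_fin]
    omega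
  · intro m f
    change (e (.inl (m, f)) : ℕ) = _
    simp [e]
    ring

namespace Split

variable {K : Type*} [Field K] {σ : SchemeType} {l s c : ℕ} (S : Split σ l s c)

/-- The moved lines. -/
def moved (m : Fin l) : Fin σ.lines := S.lines.symm (.inl m)

/-- The pairs of lines which become crosses. -/
def pair (m : Fin s) (e : Fin 2) : Fin σ.lines := S.lines.symm (.inr (.inl (m, e)))

/-- The lines which are kept. -/
def kept (m : Fin (traceType σ l s 0 c).points) : Fin σ.lines := S.lines.symm (.inr (.inr m))

/-- The moved crosses. -/
def movedCross (m : Fin c) : Fin σ.crosses := S.crosses.symm (.inl m)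

/-- The crosses which are kept. -/
def keptCross (m : Fin (traceType σ l s 0 c).lengthTwo) : Fin σ.crosses := S.crosses.symm (.inr m)

/-- The equations of the lines of the special member in `H`. -/
def movedEq (x : Coord σ → K) : (Fin c × Fin 2) ⊕ Fin l → Fin 3 → K :=
  Sum.elim (fun m => cr (vtx x (S.movedCross m.1)) (proj (armPt x (S.movedCross m.1) m.2)))
    (fun m => cr (proj (linePt x (S.moved m) 0)) (proj (linePt x (S.moved m) 1)))

/-- The point in `H` of the first line of a pair. -/
def pairVertex (x : Coord σ → K) (m : Fin s) : Fin 3 → K :=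
  meet (linePt x (S.pair m 0) 0) (linePt x (S.pair m 0) 1)

/-- The parameters of the trace of the special member. -/
def traceParams (x : Coord σ → K) : TraceCoord (traceType σ l s 0 c) → K :=
  mkTrace (fun k => S.movedEq x (S.star k)) (S.pairVertex x) (fun m => vtx x (S.keptCross m))
    (fun m => meet (armPt x (S.keptCross m) 0) (armPt x (S.keptCross m) 1)) (starEq x)
    (fun m => meet (linePt x (S.kept m) 0) (linePt x (S.kept m) 1)) (fun e => proj (axisPt x e))
    (fun i e => x (.pt i e))

/-- The parameters of the residual scheme of the special member. -/
def residualParams (x : Coord σ → K) : Coord (residualType σ l s 0 c) → K :=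
  mkCoord (fun k => linePt x (S.kept (S.resLines k)))
    (fun k => Sum.elim (fun m => vtx x (S.keptCross m)) (S.pairVertex x) (S.resCrosses k))
    (fun k => Sum.elim (fun m => armPt x (S.keptCross m))
      (fun m => ![linePt x (S.pair m 0) 0, linePt x (S.pair m 1) 1]) (S.resCrosses k))
    (fun k => S.movedEq x (S.resStar k)) (axisPt x) (fun _ _ => 0)

theorem isPolyFun_movedEq (m : (Fin c × Fin 2) ⊕ Fin l) (j : Fin 3) :
    IsPolyFun fun x : Coord σ → K => S.movedEq x m j := by
  rcases m with m | m
  · exact .cr (.vtx _) (.proj (.armPt _ _)) _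
  · exact .cr (.proj (.linePt _ _)) (.proj (.linePt _ _)) _

theorem isPolyFun_pairVertex (m : Fin s) (j : Fin 3) :
    IsPolyFun fun x : Coord σ → K => S.pairVertex x m j := .meet (.linePt _ _) (.linePt _ _) _

theorem isPolyFun_traceParams (k : TraceCoord (traceType σ l s 0 c)) :
    IsPolyFun fun x : Coord σ → K => S.traceParams x k := by
  rcases k with ⟨i, j⟩ | ⟨i, j⟩ | ⟨i, j⟩ | ⟨i, j⟩ | ⟨i, j⟩ | ⟨i, j⟩ | ⟨e, j⟩ | ⟨i, e⟩
  · exact S.isPolyFun_movedEq _ _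
  · exact S.isPolyFun_pairVertex _ _
  · exact .vtx _ _
  · exact .meet (.armPt _ _) (.armPt _ _) _
  · exact .starEq _ _
  · exact .meet (.linePt _ _) (.linePt _ _) _
  · exact .proj (fun _ => .coord _) _
  · exact .coord _

theorem isPolyFun_residualParams (k : Coord (residualType σ l s 0 c)) :
    IsPolyFun fun x : Coord σ → K => S.residualParams x k := by
  rcases k with ⟨i, e, j⟩ | ⟨i, j⟩ | ⟨i, e, j⟩ | ⟨i, j⟩ | ⟨e, j⟩ | ⟨i, e⟩
  · exact .linePt _ _ _
  · change IsPolyFun fun x : Coord σ → K =>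
      Sum.elim (fun m => vtx x (S.keptCross m)) (S.pairVertex x) (S.resCrosses i) j
    rcases S.resCrosses i with m | m
    exacts [.vtx _ _, S.isPolyFun_pairVertex _ _]
  · change IsPolyFun fun x : Coord σ → K => Sum.elim (fun m => armPt x (S.keptCross m))
      (fun m => ![linePt x (S.pair m 0) 0, linePt x (S.pair m 1) 1]) (S.resCrosses i) e j
    rcases S.resCrosses i with m | m
    · exact .armPt _ _ _
    · fin_cases e
      exacts [.linePt _ _ _, .linePt _ _ _]
  · exact S.isPolyFun_movedEq _ _
  · exact .coord _
  · exact .const 0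

/-- The equations of the flattened pieces can be prescribed freely, as long as the two lines of each
cross differ. The vertex of the cross is then their intersection. The other parameters of x remain
free. -/
theorem exists_movedEq {a : (Fin c × Fin 2) ⊕ Fin l → Fin 3 → K}
    (ha : ∀ m, cr (a (.inl (m, 0))) (a (.inl (m, 1))) 2 ≠ 0) :
    ∃ (u : Fin l → Fin 2 → Fin 4 → K) (p : Fin c → Fin 3 → K) (q : Fin c → Fin 2 → Fin 4 → K),
      ∀ x : Coord σ → K, (∀ m, linePt x (S.moved m) = u m) → (∀ m, vtx x (S.movedCross m) = p m) →
        (∀ m, armPt x (S.movedCross m) = q m) → S.movedEq x = a := by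
  choose u v huv using fun m : Fin l => exists_cr_eq (a (.inr m))
  choose q hq using fun m : Fin c => exists_cr_cr_eq (a := fun e => a (.inl (m, e))) (ha m)
  refine ⟨fun m => ![inPlane (u m), inPlane (v m)], fun m => cr (a (.inl (m, 0))) (a (.inl (m, 1))),
    fun m e => inPlane (q m e), fun x h1 h2 h3 => ?_⟩
  funext m
  rcases m with ⟨m, e⟩ | m
  · simp only [movedEq, Sum.elim_inl, h2, h3, proj_inPlane]
    exact hq m e
  · simp only [movedEq, Sum.elim_inr, h1, Matrix.cons_val_zero, Matrix.cons_val_one, proj_inPlane]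
    exact huv m

theorem meet_vertical (p : Fin 3 → K) : meet ![0, 0, 0, 1] (inPlane p) = p := by
  ext j; fin_cases j <;> simp [meet, inPlane]

/-- A preimage is built for every good trace: points of H are cut out by lines through (0, 0, 0, 1),
and directions of length two schemes by crosses one of whose arms contains that point. -/
theorem forGeneral_traceParams [Infinite K] : ForGeneral fun z : TraceCoord (traceType σ l s 0 c) → K =>
    ∃ x : Coord σ → K, S.traceParams x = z := by
  refine (forGeneral_goodTrace _).mono fun z hz => ?_
  obtain ⟨u, p, q, h⟩ := S.exists_movedEq (a := fun m => traceLn z (.inl (S.star.symm m)))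
    (fun m => hz.pair _ _ (by simp))
  let x : Coord σ → K := mkCoord
    (fun i => Sum.elim u (Sum.elim
      (fun m => ![![0, 0, 0, 1], inPlane fun j => z (.double m.1 j)])
      (fun m => ![![0, 0, 0, 1], inPlane fun j => z (.point m j)])) (S.lines i))
    (fun i => Sum.elim p (fun m j => z (.support m j)) (S.crosses i))
    (fun i => Sum.elim q (fun m => ![![0, 0, 0, 1], inPlane fun j => z (.direction m j)]) (S.crosses i))
    (fun i j => z (.star i j)) (fun e => inPlane fun j => z (.axis e j)) (fun i e => z (.pt i e))
  have hx : S.movedEq x = fun m => traceLn z (.inl (S.star.symm m)) :=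
    h x (fun m => by simp [x, moved]) (fun m => by simp [x, movedCross])
      (fun m => by simp [x, movedCross])
  refine ⟨x, ?_⟩
  funext k
  rcases k with ⟨i, j⟩ | ⟨i, j⟩ | ⟨i, j⟩ | ⟨i, j⟩ | ⟨i, j⟩ | ⟨i, j⟩ | ⟨e, j⟩ | ⟨i, e⟩
  · simp only [traceParams, mkTrace, hx, Equiv.symm_apply_apply]
    rfl
  · simp [traceParams, mkTrace, pairVertex, pair, x, meet_vertical]
  · simp [traceParams, mkTrace, keptCross, x]
  · simp [traceParams, mkTrace, keptCross, x, meet_vertical]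
  · rfl
  · simp [traceParams, mkTrace, kept, x, meet_vertical]
  · simp [traceParams, mkTrace, x]
  · rfl

theorem meet_arm {p : Fin 3 → K} {u : Fin 4 → K} (hu : u 3 ≠ 0) :
    meet u (inPlane ((u 3)⁻¹ • p)) = p := by
  ext j; fin_cases j <;> simp [meet, inPlane, hu]

/-- A new cross comes from a pair whose first line is one arm, spanned by the arm point and a
rescaled vertex; by `meet_arm` the rescaling returns the exact coordinates of the vertex and not
merely a multiple. Of the second line only one point matters. -/
theorem forGeneral_residualParams [Infinite K] : ForGeneral fun y : Coord (residualType σ l s 0 c) → K =>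
    ∃ x : Coord σ → K, S.residualParams x = y := by
  refine (forGeneral_good _).mono fun y hy => ?_
  obtain ⟨u, p, q, h⟩ := S.exists_movedEq
    (a := fun m => starEq y (S.resStar.symm m))
    (fun m => hy.star_star _ _ (by simp))
  let x : Coord σ → K := mkCoord
    (fun i => Sum.elim u (Sum.elim
      (fun m => if m.2 = 0
        then ![armPt y (S.resCrosses.symm (.inr m.1)) 0,
          inPlane ((armPt y (S.resCrosses.symm (.inr m.1)) 0 3)⁻¹ •
            vtx y (S.resCrosses.symm (.inr m.1)))]
        else ![0, armPt y (S.resCrosses.symm (.inr m.1)) 1])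
      (fun m => linePt y (S.resLines.symm m))) (S.lines i))
    (fun i => Sum.elim p (fun m => vtx y (S.resCrosses.symm (.inl m))) (S.crosses i))
    (fun i => Sum.elim q (fun m => armPt y (S.resCrosses.symm (.inl m))) (S.crosses i))
    0 (axisPt y) 0
  have hx : S.movedEq x = fun m => starEq y (S.resStar.symm m) :=
    h x (fun m => by simp [x, moved]) (fun m => by simp [x, movedCross])
      (fun m => by simp [x, movedCross])
  refine ⟨x, ?_⟩
  funext k
  rcases k with ⟨i, e, j⟩ | ⟨i, j⟩ | ⟨i, e, j⟩ | ⟨i, j⟩ | ⟨e, j⟩ | ⟨i, e⟩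
  · simp [residualParams, mkCoord, x, kept]
    rfl
  · obtain ⟨m, rfl⟩ := S.resCrosses.symm.surjective i
    rcases m with m | m
    · simp [residualParams, mkCoord, x, keptCross]
      rfl
    · simp [residualParams, mkCoord, x, pairVertex, pair, meet_arm (hy.arm_third _ 0)]
      rfl
  · obtain ⟨m, rfl⟩ := S.resCrosses.symm.surjective i
    rcases m with m | m
    · simp [residualParams, mkCoord, x, keptCross]
      rfl
    · fin_cases e
      · simp [residualParams, mkCoord, x, pair]
        rfl
      · simp [residualParams, mkCoord, x, pair]
        rfl
  · simp only [residualParams, mkCoord, hx, Equiv.symm_apply_apply]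
    rfl
  · rfl
  · exact Fin.elim0 i

end Split

section

variable {K : Type*} [Field K]

theorem spanPair_inPlane {a b : Fin 3 → K} {j : Fin 3} (h : cr a b j ≠ 0) :
    spanPair (inPlane a) (inPlane b) = planeLine (cr a b) := by
  ext w
  constructor
  · intro hw
    have := dot_cr_of_mem_spanPair hw
    rw [proj_inPlane, proj_inPlane] at this
    obtain ⟨s, t, rfl⟩ := mem_spanPair.1 hw
    exact mem_planeLine.2 ⟨by simp, this⟩
  · rintro ⟨h3, hw⟩
    refine mem_spanPair.2 ⟨(cr a b j)⁻¹ * cr (proj w) b j, (cr a b j)⁻¹ * cr a (proj w) j, ?_⟩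
    change dot (cr a b) (proj w) = 0 at hw
    conv_rhs => rw [← inPlane_proj h3]
    rw [mul_smul, mul_smul, ← smul_add, inv_smul_eq_iff₀ h, ← inPlane_smul, ← inPlane_smul,
      ← inPlane_smul, ← inPlane_add]
    congr 1
    generalize proj w = v at *
    simp only [dot, cr, Matrix.cons_val_zero, Matrix.cons_val_one, Matrix.cons_val] at hw
    ext k
    fin_cases j <;> fin_cases k <;>
      simp only [cr, Fin.zero_eta, Fin.mk_one, Fin.reduceFinMk, Matrix.cons_val_zero,
        Matrix.cons_val_one, Matrix.cons_val, Pi.add_apply, Pi.smul_apply, smul_eq_mul]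
    all_goals first | ring1 | linear_combination -hw

theorem spanPair_meet {u v : Fin 4 → K} (hu : u 3 ≠ 0) :
    spanPair u v = spanPair (inPlane (meet u v)) u := by
  rw [inPlane_meet]
  ext w
  constructor
  · intro hw
    obtain ⟨s, t, rfl⟩ := mem_spanPair.1 hw
    refine mem_spanPair.2 ⟨t / u 3, s + t / u 3 * v 3, ?_⟩
    rw [smul_sub, smul_smul, div_mul_cancel₀ _ hu]
    module
  · intro hw
    obtain ⟨s, t, rfl⟩ := mem_spanPair.1 hw
    refine mem_spanPair.2 ⟨t - s * v 3, s * u 3, ?_⟩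
    module

end

/-! ### The degeneration and its special member -/

namespace Split

variable {K : Type*} [Field K] {σ : SchemeType} {l s c : ℕ} (S : Split σ l s c)

/-- The translation which moves the second line of a pair to the vertex on the first one. -/
def shift (x : Coord σ → K) (m : Fin s) : Fin 4 → K :=
  -- Adding a vector δ of H to the first spanning point u of the line through u and v changes its
  -- point in H, namely u₃ v - v₃ u, by -v₃ δ. The factor is chosen so that the new point is the
  -- prescribed vertex.
  inPlane ((linePt x (S.pair m 1) 1 3)⁻¹ •
    (meet (linePt x (S.pair m 1) 0) (linePt x (S.pair m 1) 1) - S.pairVertex x m))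

/-- The direction of the degeneration in the parameter space. -/
def direction (x : Coord σ → K) : Coord σ → K :=
  mkCoord
    (fun i => Sum.elim (fun _ e => Pi.single 3 (linePt x i e 3))
      (Sum.elim (fun m => if m.2 = 1 then ![-S.shift x m.1, 0] else 0) (fun _ => 0)) (S.lines i))
    0
    (fun i => Sum.elim (fun _ e => Pi.single 3 (armPt x i e 3)) (fun _ => 0) (S.crosses i))
    0 (fun e => Pi.single 3 (axisPt x e 3)) 0

/-- The degeneration. -/
abbrev degen (x : Coord σ → K) (t : K) : Coord σ → K := path x (S.direction x) t

theorem direction_star (x : Coord σ → K) (i : Fin σ.starLines) (j : Fin 3) :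
    S.direction x (.star i j) = 0 := rfl

/-- The vector obtained from `u` by scaling the last coordinate. -/
def tilt (u : Fin 4 → K) (t : K) : Fin 4 → K := inPlane (proj u) + t • Pi.single 3 (u 3)

theorem tilt_zero (u : Fin 4 → K) : tilt u 0 = inPlane (proj u) := by simp [tilt]

theorem tilt_eq (u : Fin 4 → K) (t : K) : u + (t - 1) • (Pi.single 3 (u 3) : Fin 4 → K) = tilt u t := by
  ext j
  fin_cases j <;> simp [tilt, inPlane, proj]
  ring

theorem linePt_degen (x : Coord σ → K) (t : K) (i : Fin σ.lines) (e : Fin 2) :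
    linePt (S.degen x t) i e = linePt x i e + (t - 1) • linePt (S.direction x) i e := rfl

theorem armPt_degen (x : Coord σ → K) (t : K) (i : Fin σ.crosses) (e : Fin 2) :
    armPt (S.degen x t) i e = armPt x i e + (t - 1) • armPt (S.direction x) i e := rfl

theorem linePt_moved (x : Coord σ → K) (t : K) (m : Fin l) (e : Fin 2) :
    linePt (S.degen x t) (S.moved m) e = tilt (linePt x (S.moved m) e) t := by
  rw [linePt_degen, ← tilt_eq]
  simp [direction, moved]

theorem linePt_pair_zero (x : Coord σ → K) (t : K) (m : Fin s) (e : Fin 2) :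
    linePt (S.degen x t) (S.pair m 0) e = linePt x (S.pair m 0) e := by
  rw [linePt_degen]
  simp [direction, pair]

theorem linePt_pair_one (x : Coord σ → K) (t : K) (m : Fin s) :
    linePt (S.degen x t) (S.pair m 1) 1 = linePt x (S.pair m 1) 1 := by
  rw [linePt_degen]
  simp [direction, pair]

theorem linePt_pair_shift (x : Coord σ → K) (t : K) (m : Fin s) :
    linePt (S.degen x t) (S.pair m 1) 0 = linePt x (S.pair m 1) 0 + (1 - t) • S.shift x m := by
  rw [linePt_degen]
  have : linePt (S.direction x) (S.pair m 1) 0 = - S.shift x m := by simp [direction, pair]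
  rw [this, smul_neg, ← neg_smul, neg_sub]

theorem linePt_kept (x : Coord σ → K) (t : K) (m : Fin (traceType σ l s 0 c).points) :
    linePt (S.degen x t) (S.kept m) = linePt x (S.kept m) := by
  funext e
  rw [linePt_degen]
  simp [direction, kept]

theorem vtx_degen (x : Coord σ → K) (t : K) : vtx (S.degen x t) = vtx x := by
  funext i j
  exact path_static rfl t

theorem armPt_movedCross (x : Coord σ → K) (t : K) (m : Fin c) (e : Fin 2) :
    armPt (S.degen x t) (S.movedCross m) e = tilt (armPt x (S.movedCross m) e) t := by
  rw [armPt_degen, ← tilt_eq]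
  simp [direction, movedCross]

theorem armPt_keptCross (x : Coord σ → K) (t : K) (m : Fin (traceType σ l s 0 c).lengthTwo) :
    armPt (S.degen x t) (S.keptCross m) = armPt x (S.keptCross m) := by
  funext e
  rw [armPt_degen]
  simp [direction, keptCross]

theorem starEq_degen (x : Coord σ → K) (t : K) : starEq (S.degen x t) = starEq x :=
  starEq_path (S.direction_star x) t

theorem collPt_degen (x : Coord σ → K) (i : Fin σ.collinear) :
    collPt (S.degen x 0) i = inPlane (proj (collPt x i)) := by
  have h1 : ∀ e, S.degen x 0 (.pt i e) = x (.pt i e) := fun e => path_static rfl 0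
  have h2 : ∀ e j, S.degen x 0 (.axis e j) = inPlane (proj (axisPt x e)) j := by
    intro e j
    have := congrFun (tilt_eq (axisPt x e) 0) j
    rw [tilt_zero] at this
    rw [← this]
    rfl
  funext j
  simp only [collPt, h1, h2]
  fin_cases j
  exacts [rfl, rfl, rfl, by simp [inPlane]]

/-- A general member and a general limit. -/
structure General (x : Coord σ → K) : Prop where
  good : Good x
  goodTrace : GoodTrace (S.traceParams x)
  goodResidual : Good (S.residualParams x)

/-- The piece which contains a line moved into `H`. -/
def movedPiece : (Fin c × Fin 2) ⊕ Fin l → Piece σ :=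
  Sum.elim (fun m => .inr (.inl (S.movedCross m.1))) (fun m => .inl (S.moved m))

/-- The second point spanning a line of a pair in the limit. -/
def pairArm (x : Coord σ → K) (m : Fin s) : Fin 2 → Fin 4 → K :=
  ![linePt x (S.pair m 0) 0, linePt x (S.pair m 1) 1]

theorem traceLn_moved (x : Coord σ → K) (k : (Fin c × Fin 2) ⊕ Fin l) :
    traceLn (S.traceParams x) (.inl (S.star.symm k)) = S.movedEq x k := by
  change S.movedEq x (S.star (S.star.symm k)) = _
  rw [Equiv.apply_symm_apply]

theorem traceMk_double (x : Coord σ → K) (m : Fin s) :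
    traceMk (S.traceParams x) (.inl m) = S.pairVertex x m := rfl

theorem traceMk_coll (x : Coord σ → K) (i : Fin σ.collinear) :
    traceMk (S.traceParams x) (.inr (.inr (.inr i))) = proj (collPt x i) := by
  funext j
  change x (.pt i 0) * proj (axisPt x 0) j + x (.pt i 1) * proj (axisPt x 1) j = _
  fin_cases j <;> rfl

theorem piece_residual_line (x : Coord σ → K) (m : Fin (traceType σ l s 0 c).points) :
    piece (S.residualParams x) (.inl (S.resLines.symm m)) =
      spanPair (linePt x (S.kept m) 0) (linePt x (S.kept m) 1) := by
  simp [piece, residualParams]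

theorem piece_residual_cross (x : Coord σ → K) (m : Fin (traceType σ l s 0 c).lengthTwo) :
    piece (S.residualParams x) (.inr (.inl (S.resCrosses.symm (.inl m)))) =
      ⋃ e, spanPair (inPlane (vtx x (S.keptCross m))) (armPt x (S.keptCross m) e) := by
  simp [piece, residualParams]

theorem piece_residual_pair (x : Coord σ → K) (m : Fin s) :
    piece (S.residualParams x) (.inr (.inl (S.resCrosses.symm (.inr m)))) =
      ⋃ e, spanPair (inPlane (S.pairVertex x m)) (S.pairArm x m e) := by
  simp [piece, residualParams, pairArm]

variable {S} {x : Coord σ → K}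

namespace General

variable (h : S.General x)
include h

theorem movedEq_ne_zero (k : (Fin c × Fin 2) ⊕ Fin l) : S.movedEq x k 2 ≠ 0 := by
  have := h.goodTrace.line (.inl (S.star.symm k))
  rwa [traceLn_moved] at this

end General

end Split

namespace Split

variable {K : Type*} [Field K] {σ : SchemeType} {l s c : ℕ} {S : Split σ l s c} {x : Coord σ → K}

theorem line_cases (S : Split σ l s c) (i : Fin σ.lines) :
    (∃ m, i = S.moved m) ∨ (∃ m e, i = S.pair m e) ∨ ∃ m, i = S.kept m := by
  obtain ⟨k, rfl⟩ := S.lines.symm.surjective i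
  rcases k with m | ⟨m, e⟩ | m
  exacts [.inl ⟨m, rfl⟩, .inr (.inl ⟨m, e, rfl⟩), .inr (.inr ⟨m, rfl⟩)]

theorem cross_cases (S : Split σ l s c) (i : Fin σ.crosses) :
    (∃ m, i = S.movedCross m) ∨ ∃ m, i = S.keptCross m := by
  obtain ⟨k, rfl⟩ := S.crosses.symm.surjective i
  rcases k with m | m
  exacts [.inl ⟨m, rfl⟩, .inr ⟨m, rfl⟩]

/-- The translated first generator of the second line of a pair, up to a factor. -/
theorem add_shift (S : Split σ l s c) {m : Fin s} (h : linePt x (S.pair m 1) 1 3 ≠ 0) :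
    linePt x (S.pair m 1) 1 3 • (linePt x (S.pair m 1) 0 + S.shift x m) =
      linePt x (S.pair m 1) 0 3 • linePt x (S.pair m 1) 1 - inPlane (S.pairVertex x m) := by
  have h' : inPlane (meet (linePt x (S.pair m 1) 0) (linePt x (S.pair m 1) 1) - S.pairVertex x m) =
      linePt x (S.pair m 1) 0 3 • linePt x (S.pair m 1) 1 -
        linePt x (S.pair m 1) 1 3 • linePt x (S.pair m 1) 0 - inPlane (S.pairVertex x m) := by
    rw [← inPlane_meet, sub_eq_add_neg, inPlane_add, ← neg_one_smul K (S.pairVertex x m),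
      inPlane_smul, neg_one_smul, ← sub_eq_add_neg]
  rw [shift, inPlane_smul, smul_add, smul_inv_smul₀ h, h']
  abel

theorem piece_kept (m : Fin (traceType σ l s 0 c).points) :
    piece (S.degen x 0) (.inl (S.kept m)) = spanPair (linePt x (S.kept m) 0) (linePt x (S.kept m) 1) := by
  rw [piece, linePt_kept]

theorem piece_keptCross (m : Fin (traceType σ l s 0 c).lengthTwo) :
    piece (S.degen x 0) (.inr (.inl (S.keptCross m))) =
      ⋃ e, spanPair (inPlane (vtx x (S.keptCross m))) (armPt x (S.keptCross m) e) := by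
  rw [piece, vtx_degen, armPt_keptCross]

theorem piece_star : piece (S.degen x 0) (.inr (.inr (.inl ()))) = subStarCone (starEq x) σ.omitted := by
  rw [piece, starEq_degen]

theorem piece_pt (i : Fin σ.collinear) :
    piece (S.degen x 0) (.inr (.inr (.inr i))) = pointCone (inPlane (proj (collPt x i))) := by
  rw [piece, collPt_degen]

namespace General

variable (h : S.General x)
include h

theorem pairVertex_ne_zero (m : Fin s) : S.pairVertex x m 2 ≠ 0 := by
  have := h.goodTrace.mark (.inl m)
  rwa [traceMk_double] at this

theorem pairArm_third (m : Fin s) (e : Fin 2) : S.pairArm x m e 3 ≠ 0 := by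
  fin_cases e
  exacts [h.good.line_third _ _, h.good.line_third _ _]

theorem piece_moved (m : Fin l) :
    piece (S.degen x 0) (.inl (S.moved m)) = planeLine (S.movedEq x (.inr m)) := by
  rw [piece, linePt_moved, linePt_moved, tilt_zero, tilt_zero]
  exact spanPair_inPlane (j := 2) (h.movedEq_ne_zero (.inr m))

theorem piece_movedCross (m : Fin c) :
    piece (S.degen x 0) (.inr (.inl (S.movedCross m))) =
      ⋃ e, planeLine (S.movedEq x (.inl (m, e))) := by
  rw [piece]
  refine Set.iUnion_congr fun e => ?_
  rw [vtx_degen, armPt_movedCross, tilt_zero]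
  exact spanPair_inPlane (j := 2) (h.movedEq_ne_zero (.inl (m, e)))

/-- In the limit the second line is spanned by v and w with v₃ w = u₃ v - p, by `add_shift`; hence
it is also spanned by p and v. -/
theorem piece_pair (m : Fin s) (e : Fin 2) :
    piece (S.degen x 0) (.inl (S.pair m e)) =
      spanPair (inPlane (S.pairVertex x m)) (S.pairArm x m e) := by
  fin_cases e
  · change piece _ (.inl (S.pair m 0)) = spanPair _ (linePt x (S.pair m 0) 0)
    rw [piece, linePt_pair_zero, linePt_pair_zero]
    exact spanPair_meet (h.good.line_third _ _)
  · change piece _ (.inl (S.pair m 1)) = spanPair _ (linePt x (S.pair m 1) 1)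
    rw [piece, linePt_pair_one, linePt_pair_shift, sub_zero, one_smul]
    have h3 := h.good.line_third (S.pair m 1) 1
    have hs := S.add_shift h3
    set v := linePt x (S.pair m 1) 1
    set u := linePt x (S.pair m 1) 0
    set p := inPlane (S.pairVertex x m)
    set w := u + S.shift x m
    ext n
    rw [mem_spanPair, mem_spanPair]
    constructor
    · rintro ⟨a, b, rfl⟩
      refine ⟨-(a / v 3), b + a / v 3 * u 3, ?_⟩
      have : a • w = (a / v 3) • (v 3 • w) := by rw [smul_smul, div_mul_cancel₀ _ h3]
      rw [this, hs]
      module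
    · rintro ⟨a, b, rfl⟩
      refine ⟨-(a * v 3), b + a * u 3, ?_⟩
      have : -(a * v 3) • w = -a • (v 3 • w) := by rw [smul_smul, neg_mul]
      rw [this, hs]
      module

theorem planeLine_subset (k : (Fin c × Fin 2) ⊕ Fin l) :
    planeLine (S.movedEq x k) ⊆ piece (S.degen x 0) (S.movedPiece k) := by
  rcases k with ⟨m, e⟩ | m
  · change _ ⊆ piece _ (.inr (.inl (S.movedCross m)))
    rw [h.piece_movedCross]
    exact Set.subset_iUnion (fun e => planeLine (S.movedEq x (.inl (m, e)))) e
  · exact (h.piece_moved m).symm.subset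

theorem exists_mem_planeLine {k : (Fin c × Fin 2) ⊕ Fin l} {q : Fin 4 → K}
    (hq : q ∈ piece (S.degen x 0) (S.movedPiece k)) :
    ∃ k', S.movedPiece k' = S.movedPiece k ∧ q ∈ planeLine (S.movedEq x k') := by
  rcases k with ⟨m, e⟩ | m
  · change q ∈ piece _ (.inr (.inl (S.movedCross m))) at hq
    rw [h.piece_movedCross] at hq
    obtain ⟨e', he⟩ := Set.mem_iUnion.1 hq
    exact ⟨.inl (m, e'), rfl, he⟩
  · exact ⟨.inr m, rfl, (h.piece_moved m).subset hq⟩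

theorem linearIndependent_pairVertex (m : Fin s) :
    LinearIndependent K ![inPlane (S.pairVertex x m), S.pairArm x m 0, S.pairArm x m 1] := by
  have := h.goodResidual.linearIndependent_cross (S.resCrosses.symm (.inr m))
  simpa [residualParams, pairArm] using this

/-- The limits of the pieces may meet, but each of them is still nondegenerate. Thus the product
bound for members applies at t = 0 as well. -/
theorem framed : Framed (S.degen x 0) where
  line i := by
    rcases S.line_cases i with ⟨m, rfl⟩ | ⟨m, e, rfl⟩ | ⟨m, rfl⟩
    · rw [linePt_moved, linePt_moved, tilt_zero, tilt_zero]
      refine linearIndependent_pair_of_cr (j := 2) ?_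
      rw [proj_inPlane, proj_inPlane]
      exact h.good.line_plane _
    · fin_cases e
      · change LinearIndependent K ![linePt _ (S.pair m 0) 0, linePt _ (S.pair m 0) 1]
        rw [linePt_pair_zero, linePt_pair_zero]
        exact h.good.linearIndependent_line _
      · change LinearIndependent K ![linePt _ (S.pair m 1) 0, linePt _ (S.pair m 1) 1]
        rw [linePt_pair_one, linePt_pair_shift, sub_zero, one_smul]
        have h3 := h.good.line_third (S.pair m 1) 1
        have hs := S.add_shift h3
        have hp := h.pairVertex_ne_zero m
        set v := linePt x (S.pair m 1) 1
        set u := linePt x (S.pair m 1) 0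
        set w := u + S.shift x m
        have hw : w 3 = u 3 := add_zero (u 3)
        rw [LinearIndependent.pair_iff]
        intro a b hab
        have e3 := congrFun hab 3
        simp only [Pi.add_apply, Pi.smul_apply, smul_eq_mul, hw, Pi.zero_apply] at e3
        have e2 := congrFun hab 2
        have s2 := congrFun hs 2
        simp only [Pi.add_apply, Pi.sub_apply, Pi.smul_apply, smul_eq_mul, Pi.zero_apply] at e2 s2
        have hi : inPlane (S.pairVertex x m) 2 = S.pairVertex x m 2 := rfl
        rw [hi] at s2
        have ha : a = 0 := by
          refine (mul_eq_zero.1 (?_ : a * S.pairVertex x m 2 = 0)).resolve_right hp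
          linear_combination a * s2 - v 3 * e2 + v 2 * e3
        refine ⟨ha, ?_⟩
        rw [ha, zero_mul, zero_add] at e3
        exact (mul_eq_zero.1 e3).resolve_right h3
    · rw [linePt_kept]
      exact h.good.linearIndependent_line _
  cross i := by
    rcases S.cross_cases i with ⟨m, rfl⟩ | ⟨m, rfl⟩
    · rw [vtx_degen, armPt_movedCross, armPt_movedCross, tilt_zero, tilt_zero]
      refine linearIndependent_triple_of_dot ?_
      rw [proj_inPlane, proj_inPlane]
      exact h.good.cross_frame _
    · rw [vtx_degen, armPt_keptCross]
      exact h.good.linearIndependent_cross _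
  pt i := by
    rw [collPt_degen]
    refine inPlane_ne_zero (ne_zero_of_apply (j := 2) ?_)
    rw [← S.traceMk_coll]
    exact h.goodTrace.mark _

end General

/-! ### Which pieces of the special member pass through a given point -/

/-- The pieces of the special member which pass through a point of the support of its trace. -/
def markPiece (S : Split σ l s c) (e : Fin 2) :
    Fin (traceType σ l s 0 c).doubles ⊕ Fin (traceType σ l s 0 c).lengthTwo ⊕
      Fin (traceType σ l s 0 c).points ⊕ Fin (traceType σ l s 0 c).collinear → Piece σ :=
  Sum.elim (fun m => .inl (S.pair m e)) (Sum.elim (fun m => .inr (.inl (S.keptCross m)))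
    (Sum.elim (fun m => .inl (S.kept m)) fun i => .inr (.inr (.inr i))))

/-- The pieces of the special member contained in a piece of the residual scheme. -/
def residualPiece (S : Split σ l s c) (e : Fin 2) : Piece (residualType σ l s 0 c) → Piece σ :=
  Sum.elim (fun k => .inl (S.kept (S.resLines k)))
    (Sum.elim (fun k => Sum.elim (fun m => .inr (.inl (S.keptCross m))) (fun m => .inl (S.pair m e))
      (S.resCrosses k)) fun _ => .inr (.inr (.inl ())))

namespace General

variable (h : S.General x)
include h

/-- Translates incidence in H into lines and marked points of the trace, so that `GoodTrace` decides
which pieces can meet there. -/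
theorem mem_piece_plane {q : Fin 4 → K} (h3 : q 3 = 0) {β : Piece σ}
    (hq : q ∈ piece (S.degen x 0) β) :
    (∃ k, β = S.movedPiece k ∧ dot (traceLn (S.traceParams x) (.inl (S.star.symm k))) (proj q) = 0) ∨
    (β = .inr (.inr (.inl ())) ∧ ∃ i j, i ≠ j ∧
      dot (traceLn (S.traceParams x) (.inr i)) (proj q) = 0 ∧
      dot (traceLn (S.traceParams x) (.inr j)) (proj q) = 0) ∨
    ∃ (μ : _) (e : Fin 2) (a : K), β = S.markPiece e μ ∧ q = a • inPlane (traceMk (S.traceParams x) μ) := by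
  rcases β with i | i | i | i
  · rcases S.line_cases i with ⟨m, rfl⟩ | ⟨m, e, rfl⟩ | ⟨m, rfl⟩
    · refine .inl ⟨.inr m, rfl, ?_⟩
      rw [h.piece_moved] at hq
      rw [traceLn_moved]
      exact (mem_planeLine.1 hq).2
    · rw [h.piece_pair] at hq
      obtain ⟨a, ha⟩ := exists_smul_vertex hq h3 (h.pairArm_third m e)
      exact .inr (.inr ⟨.inl m, e, a, rfl, ha.symm⟩)
    · rw [piece_kept] at hq
      obtain ⟨a, ha⟩ := exists_smul_meet hq h3 (h.good.line_third _ _)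
      exact .inr (.inr ⟨.inr (.inr (.inl m)), 0, a, rfl, ha.symm⟩)
  · rcases S.cross_cases i with ⟨m, rfl⟩ | ⟨m, rfl⟩
    · rw [h.piece_movedCross] at hq
      obtain ⟨e, he⟩ := Set.mem_iUnion.1 hq
      refine .inl ⟨.inl (m, e), rfl, ?_⟩
      rw [traceLn_moved]
      exact (mem_planeLine.1 he).2
    · rw [piece_keptCross] at hq
      obtain ⟨e, he⟩ := Set.mem_iUnion.1 hq
      obtain ⟨a, ha⟩ := exists_smul_vertex he h3 (h.good.arm_third _ _)
      exact .inr (.inr ⟨.inr (.inl m), 0, a, rfl, ha.symm⟩)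
  · rw [piece_star] at hq
    obtain ⟨i, j, hk, hi, hj⟩ := mem_subStarCone.1 hq
    refine .inr (.inl ⟨rfl, i, j, fun hij => ?_, (mem_planeLine.1 hi).2, (mem_planeLine.1 hj).2⟩)
    exact hk.1.ne (congrArg Fin.val hij)
  · rw [piece_pt] at hq
    obtain ⟨a, ha⟩ := mem_pointCone.1 hq
    refine .inr (.inr ⟨.inr (.inr (.inr i)), 0, a, rfl, ?_⟩)
    exact ha.symm.trans (by rw [← S.traceMk_coll])

/-- Outside H the pieces of the special member lie on pieces of the residual scheme, whose
disjointness is known. Only the two lines of a pair share a residual piece, which is what the index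
e records. -/
theorem mem_piece_space {q : Fin 4 → K} (h3 : q 3 ≠ 0) {β : Piece σ}
    (hq : q ∈ piece (S.degen x 0) β) :
    ∃ γ e, β = S.residualPiece e γ ∧ q ∈ piece (S.residualParams x) γ := by
  rcases β with i | i | i | i
  · rcases S.line_cases i with ⟨m, rfl⟩ | ⟨m, e, rfl⟩ | ⟨m, rfl⟩
    · rw [h.piece_moved] at hq
      exact absurd hq.1 h3
    · rw [h.piece_pair] at hq
      refine ⟨.inr (.inl (S.resCrosses.symm (.inr m))), e, by simp [residualPiece], ?_⟩
      rw [piece_residual_pair]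
      exact Set.mem_iUnion.2 ⟨e, hq⟩
    · rw [piece_kept] at hq
      refine ⟨.inl (S.resLines.symm m), 0, by simp [residualPiece], ?_⟩
      rwa [piece_residual_line]
  · rcases S.cross_cases i with ⟨m, rfl⟩ | ⟨m, rfl⟩
    · rw [h.piece_movedCross] at hq
      obtain ⟨e, he⟩ := Set.mem_iUnion.1 hq
      exact absurd he.1 h3
    · rw [piece_keptCross] at hq
      refine ⟨.inr (.inl (S.resCrosses.symm (.inl m))), 0, by simp [residualPiece], ?_⟩
      rwa [piece_residual_cross]
  · rw [piece_star] at hq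
    obtain ⟨i, j, hk, hi, hj⟩ := mem_subStarCone.1 hq
    exact absurd hi.1 h3
  · rw [piece_pt] at hq
    obtain ⟨a, ha⟩ := mem_pointCone.1 hq
    refine absurd ?_ h3
    rw [← ha]
    simp [inPlane]

theorem unique_piece_space {q : Fin 4 → K} (h3 : q 3 ≠ 0) {β β' : Piece σ}
    (hβ : q ∈ piece (S.degen x 0) β) (hβ' : q ∈ piece (S.degen x 0) β') : β = β' := by
  obtain ⟨γ, e, rfl, hγ⟩ := h.mem_piece_space h3 hβ
  obtain ⟨γ', e', rfl, hγ'⟩ := h.mem_piece_space h3 hβ'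
  obtain rfl : γ = γ' := by
    by_contra hne
    exact h3 (by rw [h.goodResidual.eq_zero_of_mem hne hγ hγ']; rfl)
  by_cases hee : e = e'
  · rw [hee]
  rcases γ with k | k | k
  · rfl
  · obtain ⟨k, rfl⟩ := S.resCrosses.symm.surjective k
    rcases k with m | m
    · simp [residualPiece]
    · exfalso
      simp only [residualPiece, Sum.elim_inr, Sum.elim_inl, Equiv.apply_symm_apply] at hβ hβ'
      rw [h.piece_pair] at hβ hβ'
      have key : q ∈ spanPair (inPlane (S.pairVertex x m)) (S.pairArm x m 0) ∧
          q ∈ spanPair (inPlane (S.pairVertex x m)) (S.pairArm x m 1) := by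
        rcases Fin.exists_fin_two.1 ⟨e, rfl⟩ with he | he <;>
          rcases Fin.exists_fin_two.1 ⟨e', rfl⟩ with he' | he' <;> subst he <;> subst he'
        exacts [absurd rfl hee, ⟨hβ, hβ'⟩, ⟨hβ', hβ⟩, absurd rfl hee]
      obtain ⟨a, b, hab⟩ := mem_spanPair.1 key.1
      obtain ⟨a', b', hab'⟩ := mem_spanPair.1 key.2
      have hli := Fintype.linearIndependent_iff.1 (h.linearIndependent_pairVertex m)
        ![a - a', b, -b'] (by
          rw [Fin.sum_univ_three]
          simp only [Matrix.cons_val_zero, Matrix.cons_val_one, Matrix.cons_val]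
          rw [sub_smul, neg_smul, sub_add_eq_add_sub, hab, ← hab']
          abel) 1
      simp only [Matrix.cons_val_one, Matrix.cons_val_zero] at hli
      refine h3 ?_
      rw [← hab, hli]
      simp [inPlane]
  · rfl

/-- The pieces of the special member through a given point. -/
theorem exists_local (q : Fin 4 → K) (hq : q ≠ 0) :
    (∃ m, q ∈ pointCone (inPlane (S.pairVertex x m)) ∧ ∀ β, q ∈ piece (S.degen x 0) β →
      β = .inl (S.pair m 0) ∨ β = .inl (S.pair m 1)) ∨
    (∃ k k', S.movedPiece k ≠ S.movedPiece k' ∧ q ∈ planeLine (S.movedEq x k) ∧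
      q ∈ planeLine (S.movedEq x k') ∧ (∀ k'', q ∈ planeLine (S.movedEq x k'') → k'' = k ∨ k'' = k') ∧
      ∀ β, q ∈ piece (S.degen x 0) β → β = S.movedPiece k ∨ β = S.movedPiece k') ∨
    ((∀ m, q ∉ pointCone (inPlane (S.pairVertex x m))) ∧
      ∃ α, ∀ β, q ∈ piece (S.degen x 0) β → β = α) := by
  by_cases h3 : q 3 = 0
  swap
  · refine .inr (.inr ⟨fun m hm => ?_, ?_⟩)
    · obtain ⟨a, rfl⟩ := mem_pointCone.1 hm
      exact h3 (by simp [inPlane])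
    · by_cases hex : ∃ α, q ∈ piece (S.degen x 0) α
      · obtain ⟨α, hα⟩ := hex
        exact ⟨α, fun β hβ => h.unique_piece_space h3 hβ hα⟩
      · push Not at hex
        exact ⟨.inr (.inr (.inl ())), fun β hβ => absurd hβ (hex β)⟩
  have hq' : proj q ≠ 0 := fun h0 => hq (eq_zero_of_proj h0 h3)
  have mark_line (μ) (a : K) (i) (hμ : q = a • inPlane (traceMk (S.traceParams x) μ))
      (hi : dot (traceLn (S.traceParams x) i) (proj q) = 0) : False := by
    rw [hμ, proj_smul, proj_inPlane, dot_smul] at hi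
    have ha := (mul_eq_zero.1 hi).resolve_right (h.goodTrace.line_mark i μ)
    exact hq (by rw [hμ, ha, zero_smul])
  have mark_mark (μ μ') (a a' : K) (hμ : q = a • inPlane (traceMk (S.traceParams x) μ))
      (hμ' : q = a' • inPlane (traceMk (S.traceParams x) μ')) : μ = μ' := by
    by_contra hne
    have e : proj q = a • traceMk (S.traceParams x) μ := by rw [hμ, proj_smul, proj_inPlane]
    have e' : proj q = a' • traceMk (S.traceParams x) μ' := by rw [hμ', proj_smul, proj_inPlane]
    have ha : a ≠ 0 := fun h0 => hq (by rw [hμ, h0, zero_smul])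
    have ha' : a' ≠ 0 := fun h0 => hq (by rw [hμ', h0, zero_smul])
    refine h.goodTrace.mark_mark μ μ' hne ?_
    have e1 : traceMk (S.traceParams x) μ = a⁻¹ • proj q := by rw [e, inv_smul_smul₀ ha]
    have e2 : traceMk (S.traceParams x) μ' = a'⁻¹ • proj q := by rw [e', inv_smul_smul₀ ha']
    rw [e1, e2, cr_smul_smul]
    rfl
  have triple (i j k) (hij : i ≠ j) (hik : i ≠ k) (hjk : j ≠ k)
      (hi : dot (traceLn (S.traceParams x) i) (proj q) = 0)
      (hj : dot (traceLn (S.traceParams x) j) (proj q) = 0)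
      (hk : dot (traceLn (S.traceParams x) k) (proj q) = 0) : False :=
    hq' (eq_zero_of_dot (h.goodTrace.triple i j k hij hik hjk) hi hj hk)
  have vertex (m) (hm : q ∈ pointCone (inPlane (S.pairVertex x m))) :
      ∃ a : K, q = a • inPlane (traceMk (S.traceParams x) (.inl m)) := by
    obtain ⟨a, ha⟩ := mem_pointCone.1 hm
    exact ⟨a, ha.symm⟩
  -- A marked point lies on none of the lines and coincides with no other marked point, so only its
  -- own pieces pass through it: two for the vertex of a new cross, one otherwise.
  by_cases hm : ∃ (μ : _) (a : K), q = a • inPlane (traceMk (S.traceParams x) μ)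
  · obtain ⟨μ, a, hμ⟩ := hm
    have all (β) (hβ : q ∈ piece (S.degen x 0) β) : ∃ e, β = S.markPiece e μ := by
      rcases h.mem_piece_plane h3 hβ with ⟨k, -, hk⟩ | ⟨-, i, -, -, hi, -⟩ | ⟨μ', e, a', rfl, hμ'⟩
      · exact (mark_line _ _ _ hμ hk).elim
      · exact (mark_line _ _ _ hμ hi).elim
      · exact ⟨e, by rw [mark_mark _ _ _ _ hμ hμ']⟩
    rcases μ with m | μ
    · refine .inl ⟨m, mem_pointCone.2 ⟨a, hμ.symm⟩, fun β hβ => ?_⟩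
      obtain ⟨e, rfl⟩ := all β hβ
      fin_cases e
      exacts [.inl rfl, .inr rfl]
    · refine .inr (.inr ⟨fun m hm => ?_, S.markPiece 0 (.inr μ), fun β hβ => ?_⟩)
      · obtain ⟨a', ha'⟩ := vertex m hm
        exact absurd (mark_mark _ _ _ _ hμ ha') (by simp)
      · obtain ⟨e, rfl⟩ := all β hβ
        rfl
  · have hv (m) : q ∉ pointCone (inPlane (S.pairVertex x m)) := fun hm' => by
      obtain ⟨a, ha⟩ := vertex m hm'
      exact hm ⟨_, a, ha⟩
    by_cases hs : q ∈ piece (S.degen x 0) (.inr (.inr (.inl ())))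
    · refine .inr (.inr ⟨hv, .inr (.inr (.inl ())), fun β hβ => ?_⟩)
      · obtain ⟨i, j, hk, hi, hj⟩ := mem_subStarCone.1 (piece_star.subset hs)
        have hij : i ≠ j := fun hij => hk.1.ne (congrArg Fin.val hij)
        rcases h.mem_piece_plane h3 hβ with ⟨k, -, hk⟩ | ⟨h', -⟩ | ⟨μ', e, a', -, hμ'⟩
        · exact (triple _ (.inr i) (.inr j) (by simp) (by simp) (fun h0 => hij (Sum.inr.inj h0)) hk
            (mem_planeLine.1 hi).2 (mem_planeLine.1 hj).2).elim
        · exact h'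
        · exact (hm ⟨_, _, hμ'⟩).elim
    · have all (β) (hβ : q ∈ piece (S.degen x 0) β) :
          ∃ k, β = S.movedPiece k ∧ q ∈ planeLine (S.movedEq x k) := by
        rcases h.mem_piece_plane h3 hβ with ⟨k, rfl, hk⟩ | ⟨rfl, -⟩ | ⟨μ', e, a', -, hμ'⟩
        · rw [traceLn_moved] at hk
          exact ⟨k, rfl, mem_planeLine.2 ⟨h3, hk⟩⟩
        · exact absurd hβ hs
        · exact (hm ⟨_, _, hμ'⟩).elim
      by_cases hex : ∃ α α', α ≠ α' ∧ q ∈ piece (S.degen x 0) α ∧ q ∈ piece (S.degen x 0) α'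
      · obtain ⟨α, α', hne, hα, hα'⟩ := hex
        obtain ⟨k, rfl, hk⟩ := all α hα
        obtain ⟨k', rfl, hk'⟩ := all α' hα'
        -- No three lines of the trace are concurrent.
        have two (k'') (hk'' : q ∈ planeLine (S.movedEq x k'')) : k'' = k ∨ k'' = k' := by
          by_contra! hne'
          have hkk : k ≠ k' := fun h' => hne (by rw [h'])
          refine triple (.inl (S.star.symm k'')) (.inl (S.star.symm k)) (.inl (S.star.symm k'))
            (by simpa using hne'.1) (by simpa using hne'.2) (by simpa using hkk) ?_ ?_ ?_ <;>
            rw [traceLn_moved]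
          exacts [(mem_planeLine.1 hk'').2, (mem_planeLine.1 hk).2, (mem_planeLine.1 hk').2]
        refine .inr (.inl ⟨k, k', hne, hk, hk', two, fun β hβ => ?_⟩)
        obtain ⟨k'', rfl, hk''⟩ := all β hβ
        rcases two k'' hk'' with rfl | rfl
        exacts [.inl rfl, .inr rfl]
      · push Not at hex
        refine .inr (.inr ⟨hv, ?_⟩)
        by_cases hne : ∃ α, q ∈ piece (S.degen x 0) α
        · obtain ⟨α, hα⟩ := hne
          refine ⟨α, fun β hβ => ?_⟩
          by_contra hab
          exact hex β α hab hβ hα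
        · push Not at hne
          exact ⟨.inr (.inr (.inl ())), fun β hβ => absurd hβ (hne β)⟩

end General

end Split

/-! ### Frames at the nodes of lines of H -/

section

variable {K : Type*} [Field K]

/-- The second spanning vector is the point of the line with x₂ = 0; it is not proportional to v
because `v 2` is nonzero. -/
theorem planeLine_eq_spanPair {a v : Fin 3 → K} (hv : v 2 ≠ 0) (hav : dot a v = 0)
    (ha : a 0 ≠ 0 ∨ a 1 ≠ 0) : planeLine a = spanPair (inPlane v) (inPlane ![a 1, -a 0, 0]) := by
  ext w
  constructor
  · rintro ⟨h3, hw⟩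
    simp only [dot] at hav
    have key : ∃ t : K, w 0 - w 2 / v 2 * v 0 = t * a 1 ∧ w 1 - w 2 / v 2 * v 1 = -(t * a 0) := by
      have h0 : a 0 * (w 0 - w 2 / v 2 * v 0) + a 1 * (w 1 - w 2 / v 2 * v 1) = 0 := by
        field_simp
        linear_combination v 2 * hw - w 2 * hav
      generalize w 0 - w 2 / v 2 * v 0 = A at h0 ⊢
      generalize w 1 - w 2 / v 2 * v 1 = B at h0 ⊢
      rcases ha with ha | ha
      · refine ⟨-B / a 0, ?_, by field_simp⟩
        rw [div_mul_eq_mul_div, eq_div_iff ha]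
        linear_combination h0
      · refine ⟨A / a 1, by field_simp, ?_⟩
        rw [div_mul_eq_mul_div, ← neg_div, eq_div_iff ha]
        linear_combination h0
    obtain ⟨t, h0, h1⟩ := key
    refine mem_spanPair.2 ⟨w 2 / v 2, t, ?_⟩
    rw [← inPlane_smul, ← inPlane_smul, ← inPlane_add]
    conv_rhs => rw [← inPlane_proj h3]
    congr 1
    ext j
    fin_cases j <;> simp [proj]
    · linear_combination -h0
    · linear_combination -h1
    · field_simp
  · intro hw
    obtain ⟨s, t, rfl⟩ := mem_spanPair.1 hw
    refine mem_planeLine.2 ⟨by simp [inPlane], ?_⟩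
    rw [proj_add, proj_smul, proj_smul, proj_inPlane, proj_inPlane, dot_add, dot_smul, dot_smul, hav]
    simp [dot]
    ring_nf
    simp

theorem exists_planeLine_frame {a a' : Fin 3 → K} (h : cr a a' 2 ≠ 0) {q : Fin 4 → K} (hq : q ≠ 0)
    (ha : q ∈ planeLine a) (ha' : q ∈ planeLine a') :
    ∃ n n' : Fin 4 → K, planeLine a = spanPair q n ∧ planeLine a' = spanPair q n' ∧
      n 3 = 0 ∧ n' 3 = 0 ∧ LinearIndependent K ![q, n, n'] := by
  obtain ⟨h3, hd⟩ := mem_planeLine.1 ha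
  obtain ⟨-, hd'⟩ := mem_planeLine.1 ha'
  have hv : proj q 2 ≠ 0 := by
    intro h2
    refine hq (eq_zero_of_proj ?_ h3)
    simp only [dot, h2, mul_zero, add_zero] at hd hd'
    simp only [cr, Matrix.cons_val] at h
    ext j
    fin_cases j
    · refine (mul_eq_zero.1 (?_ : _ * proj q 0 = 0)).resolve_left h
      linear_combination a' 1 * hd - a 1 * hd'
    · refine (mul_eq_zero.1 (?_ : _ * proj q 1 = 0)).resolve_left h
      linear_combination a 0 * hd' - a' 0 * hd
    · exact h2
  have hne : (a 0 ≠ 0 ∨ a 1 ≠ 0) ∧ (a' 0 ≠ 0 ∨ a' 1 ≠ 0) := by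
    constructor <;>
    · by_contra! h0
      exact h (by simp [cr, h0.1, h0.2])
  have e := planeLine_eq_spanPair hv hd hne.1
  have e' := planeLine_eq_spanPair hv hd' hne.2
  have hli : LinearIndependent K ![inPlane (proj q), inPlane ![a 1, -a 0, 0],
      inPlane ![a' 1, -a' 0, 0]] := by
    refine linearIndependent_triple_of_dot ?_
    rw [proj_inPlane, proj_inPlane]
    have : dot (proj q) (cr ![a 1, -a 0, 0] ![a' 1, -a' 0, 0]) = proj q 2 * cr a a' 2 := by
      simp [dot, cr]
      left
      ring
    rw [this]
    exact mul_ne_zero hv h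
  rw [inPlane_proj h3] at e e' hli
  exact ⟨_, _, e, e', rfl, rfl, hli⟩

theorem linearIndependent_vertical_cons {q n n' : Fin 4 → K} (h : LinearIndependent K ![q, n, n'])
    (hq : q 3 = 0) (hn : n 3 = 0) (hn' : n' 3 = 0) :
    LinearIndependent K ![Pi.single 3 1, q, n, n'] := by
  refine linearIndependent_finCons.2 ⟨h, fun hmem => ?_⟩
  have hle : Submodule.span K (Set.range ![q, n, n']) ≤ LinearMap.ker (LinearMap.proj 3) := by
    rw [Submodule.span_le]
    rintro _ ⟨j, rfl⟩
    fin_cases j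
    exacts [hq, hn, hn']
  have := hle hmem
  simp at this

theorem linearPoly_mem_span_X {q n n' : Fin 4 → K} (h : LinearIndependent K ![q, n, n'])
    (hq : q 3 = 0) (hn : n 3 = 0) (hn' : n' 3 = 0) {φ : (Fin 4 → K) →ₗ[K] K} (h₀ : φ q = 0)
    (h₁ : φ n = 0) (h₂ : φ n' = 0) :
    linearPoly φ ∈ Ideal.span {(X 3 : MvPolynomial (Fin 4) K)} := by
  obtain ⟨b, hb⟩ := exists_basis_of_linearIndependent (linearIndependent_vertical_cons h hq hn hn')
  have hφ : φ = φ (Pi.single 3 1) • LinearMap.proj 3 := by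
    refine b.ext fun i => ?_
    rw [hb]
    fin_cases i
    · simp
    · simp [h₀, hq]
    · simp [h₁, hn]
    · simp [h₂, hn']
  rw [linearPoly_eq_sum_coordPoly b, hφ]
  have hX := X_eq_sum_coordPoly b 3
  have : ∑ i, C ((φ (Pi.single 3 1) • LinearMap.proj 3 : (Fin 4 → K) →ₗ[K] K) (b i)) * coordPoly b i =
      C (φ (Pi.single 3 1)) * X 3 := by
    rw [hX, Finset.mul_sum]
    refine Finset.sum_congr rfl fun i _ => ?_
    simp [mul_assoc]
  rw [this]
  exact Ideal.mul_mem_left _ _ (Ideal.subset_span rfl)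

end

/-! ### The residual scheme of the limit lies in the expected one -/

namespace Split

variable {K : Type*} [Field K] {σ : SchemeType} {l s c : ℕ} {S : Split σ l s c} {x : Coord σ → K}

/-- Together with `movedPiece_ne` this identifies the kept nodes with the nodes of two different
moved pieces. The disjunction is due to the ordering built into `IsKept`. -/
theorem isKept_or (S : Split σ l s c) {k k' : (Fin c × Fin 2) ⊕ Fin l}
    (h : S.movedPiece k ≠ S.movedPiece k') :
    IsKept c (S.resStar.symm k) (S.resStar.symm k') ∨
      IsKept c (S.resStar.symm k') (S.resStar.symm k) := by
  have key (k k' : (Fin c × Fin 2) ⊕ Fin l) (h : S.movedPiece k ≠ S.movedPiece k')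
      (hlt : (S.resStar.symm k : ℕ) < S.resStar.symm k') :
      IsKept c (S.resStar.symm k) (S.resStar.symm k') := by
    refine ⟨hlt, ?_⟩
    rintro ⟨m, hm, h1, h2⟩
    have e1 : S.resStar.symm k = S.resStar.symm (.inl (⟨m, hm⟩, 0)) :=
      Fin.ext (by rw [S.resStar_val, h1]; simp)
    have e2 : S.resStar.symm k' = S.resStar.symm (.inl (⟨m, hm⟩, 1)) :=
      Fin.ext (by rw [S.resStar_val, h2]; simp)
    refine h ?_
    rw [S.resStar.symm.injective e1, S.resStar.symm.injective e2]
    rfl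
  rcases lt_trichotomy (S.resStar.symm k : ℕ) (S.resStar.symm k' : ℕ) with hlt | heq | hlt
  · exact .inl (key k k' h hlt)
  · exact absurd (congrArg S.movedPiece (S.resStar.symm.injective (Fin.ext heq))) h
  · exact .inr (key k' k h.symm hlt)

theorem movedPiece_ne (S : Split σ l s c) {i j : Fin (residualType σ l s 0 c).starLines}
    (h : IsKept c i j) : S.movedPiece (S.resStar i) ≠ S.movedPiece (S.resStar j) := by
  intro he
  have hij : S.resStar i ≠ S.resStar j := fun h0 => h.1.ne (congrArg Fin.val (S.resStar.injective h0))
  generalize hi : S.resStar i = k at he hij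
  generalize hj : S.resStar j = k' at he hij
  have ei : (i : ℕ) = S.resStar.symm k := by rw [← hi, Equiv.symm_apply_apply]
  have ej : (j : ℕ) = S.resStar.symm k' := by rw [← hj, Equiv.symm_apply_apply]
  rcases k with ⟨m, e⟩ | m <;> rcases k' with ⟨m', e'⟩ | m'
  · have hm : m = m' := by simpa [movedPiece, movedCross] using he
    subst hm
    rw [S.resStar_val] at ei ej
    have h1 := h.1
    refine h.2 ⟨m, m.2, ?_, ?_⟩ <;> omega
  · simp [movedPiece] at he
  · simp [movedPiece] at he
  · exact hij (by simpa [movedPiece, moved] using he)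

/-- The product of the ideals of the pieces of the special member. -/
noncomputable abbrev prodIdeal (S : Split σ l s c) (x : Coord σ → K) :
    Ideal (MvPolynomial (Fin 4) K) := ∏ α, vanishingIdeal K (piece (S.degen x 0) α)

theorem le_localAt_prodIdeal {q : Fin 4 → K} {α : Piece σ}
    (hα : ∀ β, q ∈ piece (S.degen x 0) β → β = α) :
    vanishingIdeal K (piece (S.degen x 0) α) ≤ localAt q (S.prodIdeal x) :=
  le_localAt_prod α fun β hβ => exists_separating_piece fun h => hβ (hα β h)

theorem mul_le_localAt_prodIdeal {q : Fin 4 → K} {α β : Piece σ} (hne : α ≠ β)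
    (hα : ∀ γ, q ∈ piece (S.degen x 0) γ → γ = α ∨ γ = β) :
    localAt q (vanishingIdeal K (piece (S.degen x 0) α)) *
      localAt q (vanishingIdeal K (piece (S.degen x 0) β)) ≤ localAt q (S.prodIdeal x) :=
  mul_le_localAt_prod (I := fun α => vanishingIdeal K (piece (S.degen x 0) α)) hne fun γ h h' =>
    exists_separating_piece fun hq => (hα γ hq).elim h h'

namespace General

variable (h : S.General x)
include h

/-- The other line of a moved cross, if there is one, misses q, and is disposed of by a multiplier
that vanishes on it but not at q. -/
theorem vanishing_planeLine_le {k : (Fin c × Fin 2) ⊕ Fin l} {q : Fin 4 → K}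
    (hk : ∀ k', S.movedPiece k' = S.movedPiece k → q ∈ planeLine (S.movedEq x k') → k' = k) :
    vanishingIdeal K (planeLine (S.movedEq x k)) ≤
      localAt q (vanishingIdeal K (piece (S.degen x 0) (S.movedPiece k))) := by
  intro F hF
  obtain ⟨g, hg, hgq⟩ := exists_separating_iUnion (q := q)
    (Z := fun k' : {k' // S.movedPiece k' = S.movedPiece k ∧ k' ≠ k} => planeLine (S.movedEq x k'))
    fun k' => exists_separating_planeLine fun hmem => k'.2.2 (hk _ k'.2.1 hmem)
  refine mem_localAt.2 ⟨g, hgq, mem_vanishing.2 fun w hw => ?_⟩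
  obtain ⟨k', hk', hwk⟩ := h.exists_mem_planeLine hw
  rw [map_mul]
  by_cases hkk : k' = k
  · subst hkk
    rw [mem_vanishing.1 hF w hwk, mul_zero]
  · rw [mem_vanishing.1 hg w (Set.mem_iUnion.2 ⟨⟨k', hk', hkk⟩, hwk⟩), zero_mul]

/-- Near a node on two pieces in `H` the limit contains the first-order neighbourhood of it. -/
theorem mul_planeLine_le {k k' : (Fin c × Fin 2) ⊕ Fin l} {q : Fin 4 → K}
    (hne : S.movedPiece k ≠ S.movedPiece k')
    (hk : ∀ k'', q ∈ planeLine (S.movedEq x k'') → k'' = k ∨ k'' = k')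
    (hβ : ∀ β, q ∈ piece (S.degen x 0) β → β = S.movedPiece k ∨ β = S.movedPiece k') :
    vanishingIdeal K (planeLine (S.movedEq x k)) * vanishingIdeal K (planeLine (S.movedEq x k')) ≤
      localAt q (S.prodIdeal x) := by
  refine le_trans (Ideal.mul_mono ?_ ?_) (mul_le_localAt_prodIdeal hne hβ)
  · refine h.vanishing_planeLine_le fun k'' he hq => (hk k'' hq).resolve_right fun h0 => hne ?_
    rw [← he, h0]
  · refine h.vanishing_planeLine_le fun k'' he hq => (hk k'' hq).resolve_left fun h0 => hne ?_
    rw [← he, h0]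

theorem mul_pair_le {m : Fin s} {q : Fin 4 → K} (hβ : ∀ β, q ∈ piece (S.degen x 0) β →
      β = .inl (S.pair m 0) ∨ β = .inl (S.pair m 1)) :
    vanishingIdeal K (spanPair (inPlane (S.pairVertex x m)) (S.pairArm x m 0)) *
      vanishingIdeal K (spanPair (inPlane (S.pairVertex x m)) (S.pairArm x m 1)) ≤
      localAt q (S.prodIdeal x) := by
  have := mul_le_localAt_prodIdeal (S := S) (x := x) (α := .inl (S.pair m 0))
    (β := .inl (S.pair m 1)) (by simp [pair]) hβ
  rw [h.piece_pair, h.piece_pair] at this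
  exact le_trans (Ideal.mul_mono (le_localAt _ _) (le_localAt _ _)) this

theorem cr_movedEq {k k' : (Fin c × Fin 2) ⊕ Fin l} (hne : k ≠ k') :
    cr (S.movedEq x k) (S.movedEq x k') 2 ≠ 0 := by
  have := h.goodTrace.pair (.inl (S.star.symm k)) (.inl (S.star.symm k'))
    (fun h0 => hne (S.star.symm.injective (Sum.inl.inj h0)))
  rwa [traceLn_moved, traceLn_moved] at this

/-- The residual scheme of the special member is contained in the scheme with parameters
`residualParams`. -/
theorem X_mul_mem [Infinite K] {F : MvPolynomial (Fin 4) K} (hF : F ∈ schemeIdeal (S.residualParams x))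
    {q : Fin 4 → K} (hq : q ≠ 0) : X 3 * F ∈ localAt q (S.prodIdeal x) := by
  rw [mem_schemeIdeal] at hF
  rcases h.exists_local q hq with ⟨m, hm, hβ⟩ | ⟨k, k', hne, hk, hk', hkk, hβ⟩ | ⟨-, α, hα⟩
  · have hF' := hF (.inr (.inl (S.resCrosses.symm (.inr m))))
    rw [piece_residual_pair] at hF'
    -- J contains the product, and also the equation of the plane of the cross, because x₃ vanishes
    -- at the vertex. By `vanishing_inf_le` it contains the ideal of the cross.
    let J : Ideal (MvPolynomial (Fin 4) K) := (localAt q (S.prodIdeal x)).colon {X 3}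
    have hJ {G : MvPolynomial (Fin 4) K} : G ∈ J ↔ G * X 3 ∈ localAt q (S.prodIdeal x) := by
      rw [Submodule.mem_colon_singleton, smul_eq_mul]
    have hle := h.mul_pair_le hβ
    have hli := h.linearIndependent_pairVertex m
    have := vanishing_inf_le hli (J := J) (fun φ h0 h1 h2 => ?_)
      ⟨vanishing_anti (Set.subset_iUnion (fun e => spanPair _ (S.pairArm x m e)) 0) hF',
        vanishing_anti (Set.subset_iUnion (fun e => spanPair _ (S.pairArm x m e)) 1) hF'⟩
    · rw [mul_comm, ← hJ]
      refine (sup_le le_rfl fun G hG => ?_ : J ⊔ _ ≤ J) this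
      rw [hJ]
      exact Ideal.mul_mem_right _ _ (hle hG)
    · rw [hJ]
      refine hle (vanishing_plane_mul_point_le hli ?_ ?_ ?_)
      · rw [mem_vanishing]
        intro w hw
        obtain ⟨a, b, rfl⟩ := mem_spanPair.1 hw
        rw [eval_linearPoly, map_add, map_smul, map_smul, h0, h1, smul_zero, smul_zero, add_zero]
      · rw [mem_vanishing]
        intro w hw
        obtain ⟨a, b, rfl⟩ := mem_spanPair.1 hw
        rw [eval_linearPoly, map_add, map_smul, map_smul, h0, h2, smul_zero, smul_zero, add_zero]
      · rw [mem_vanishing]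
        intro w hw
        obtain ⟨a, rfl⟩ := mem_pointCone.1 hw
        simp [inPlane]
  · have hne' : k ≠ k' := fun h0 => hne (by rw [h0])
    -- At the node x₃ vanishes on both lines, and F vanishes at their intersection since this is a
    -- kept node; a plane times a point of it lies in the product of the two lines.
    obtain ⟨n, n', e, e', hn, hn', hli⟩ := exists_planeLine_frame (h.cr_movedEq hne') hq hk hk'
    have hle := h.mul_planeLine_le hne hkk hβ
    rw [e, e'] at hle
    refine hle (vanishing_plane_mul_point_le hli ?_ ?_ ?_)
    · rw [← e, mem_vanishing]
      intro w hw
      rw [eval_X]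
      exact hw.1
    · rw [← e', mem_vanishing]
      intro w hw
      rw [eval_X]
      exact hw.1
    · refine vanishing_anti ?_ (hF (.inr (.inr (.inl ()))))
      have hs (k : (Fin c × Fin 2) ⊕ Fin l) :
          starEq (S.residualParams x) (S.resStar.symm k) = S.movedEq x k := by
        simp [residualParams]
      intro w hw
      obtain ⟨a, rfl⟩ := mem_pointCone.1 hw
      refine mem_subStarCone.2 ?_
      have m1 := smul_mem_planeLine hk a
      have m2 := smul_mem_planeLine hk' a
      rw [← hs] at m1 m2
      rcases S.isKept_or hne with hkept | hkept
      exacts [⟨_, _, hkept, m1, m2⟩, ⟨_, _, hkept, m2, m1⟩]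
  · refine le_localAt_prodIdeal hα ?_
    have hX {Z : Set (Fin 4 → K)} (hZ : ∀ w ∈ Z, w 3 = 0) : X 3 * F ∈ vanishingIdeal K Z :=
      Ideal.mul_mem_right _ _ (mem_vanishing.2 fun w hw => by rw [eval_X]; exact hZ w hw)
    rcases α with i | i | i | i
    · rcases S.line_cases i with ⟨m, rfl⟩ | ⟨m, e, rfl⟩ | ⟨m, rfl⟩
      · rw [h.piece_moved]
        exact hX fun w hw => hw.1
      · refine Ideal.mul_mem_left _ _ (vanishing_anti ?_ (hF (.inr (.inl (S.resCrosses.symm (.inr m))))))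
        rw [piece_residual_pair, h.piece_pair]
        exact Set.subset_iUnion (fun e => spanPair _ (S.pairArm x m e)) e
      · refine Ideal.mul_mem_left _ _ (vanishing_anti ?_ (hF (.inl (S.resLines.symm m))))
        rw [piece_residual_line, piece_kept]
    · rcases S.cross_cases i with ⟨m, rfl⟩ | ⟨m, rfl⟩
      · rw [h.piece_movedCross]
        exact hX fun w hw => by obtain ⟨e, he⟩ := Set.mem_iUnion.1 hw; exact he.1
      · refine Ideal.mul_mem_left _ _ (vanishing_anti ?_ (hF (.inr (.inl (S.resCrosses.symm (.inl m))))))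
        rw [piece_residual_cross, piece_keptCross]
    · rw [piece_star]
      exact hX fun w hw => by obtain ⟨i, j, -, hi, -⟩ := mem_subStarCone.1 hw; exact hi.1
    · rw [piece_pt]
      exact hX fun w hw => by obtain ⟨a, rfl⟩ := mem_pointCone.1 hw; simp [inPlane]

end General

end Split

/-! ### The trace of the limit lies in the expected one -/

section

variable {K : Type*} [Field K]

theorem linearIndependent_pair_of_third {p u : Fin 4 → K} (hp : p ≠ 0) (h3 : p 3 = 0) (hu : u 3 ≠ 0) :
    LinearIndependent K ![p, u] := by
  rw [LinearIndependent.pair_iff]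
  intro a b hab
  have e3 := congrFun hab 3
  simp only [Pi.add_apply, Pi.smul_apply, smul_eq_mul, h3, mul_zero, zero_add, Pi.zero_apply] at e3
  have hb := (mul_eq_zero.1 e3).resolve_right hu
  rw [hb, zero_smul, add_zero] at hab
  exact ⟨(smul_eq_zero.1 hab).resolve_right hp, hb⟩

end

namespace Split

variable {K : Type*} [Field K] {σ : SchemeType} {l s c : ℕ} {S : Split σ l s c} {x : Coord σ → K}

theorem mem_traceIdeal {F : MvPolynomial (Fin 4) K} : F ∈ traceIdeal (S.traceParams x) ↔
    (∀ k, F ∈ vanishingIdeal K (planeLine (S.movedEq x k))) ∧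
    F ∈ vanishingIdeal K (subStarCone (starEq x) σ.omitted) ∧
    (∀ m, F ∈ vanishingIdeal K
      (pointCone (inPlane (meet (linePt x (S.kept m) 0) (linePt x (S.kept m) 1))))) ∧
    (∀ i, F ∈ vanishingIdeal K (pointCone (inPlane (proj (collPt x i))))) ∧
    (∀ m, F ∈ doublePointIdeal (S.pairVertex x m)) ∧
    ∀ m, F ∈ lengthTwoIdeal (vtx x (S.keptCross m))
      (meet (armPt x (S.keptCross m) 0) (armPt x (S.keptCross m) 1)) := by
  have hcoll : (fun i => pointCone (inPlane (proj (collPt x i)))) = fun i : Fin σ.collinear =>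
      pointCone (inPlane fun j => S.traceParams x (.pt i 0) * S.traceParams x (.axis 0 j) +
        S.traceParams x (.pt i 1) * S.traceParams x (.axis 1 j)) := by
    funext i
    rw [← S.traceMk_coll]
    rfl
  have hset : F ∈ traceIdeal (S.traceParams x) ↔
      (F ∈ vanishingIdeal K ((⋃ i, planeLine (S.movedEq x (S.star i))) ∪
        subStarCone (starEq x) σ.omitted ∪
        (⋃ m, pointCone (inPlane (meet (linePt x (S.kept m) 0) (linePt x (S.kept m) 1)))) ∪
        ⋃ i, pointCone (inPlane (proj (collPt x i)))) ∧
      F ∈ ⨅ m, doublePointIdeal (S.pairVertex x m)) ∧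
      F ∈ ⨅ m, lengthTwoIdeal (vtx x (S.keptCross m))
        (meet (armPt x (S.keptCross m) 0) (armPt x (S.keptCross m) 1)) := by
    rw [hcoll]
    rfl
  rw [hset, Ideal.mem_iInf, Ideal.mem_iInf, and_assoc]
  simp only [mem_vanishing]
  constructor
  · rintro ⟨h, hd, hl⟩
    refine ⟨fun k w hw => h w ?_, fun w hw => h w ?_, fun m w hw => h w ?_, fun i w hw => h w ?_, hd, hl⟩
    · exact .inl (.inl (.inl (Set.mem_iUnion.2 ⟨S.star.symm k, by rwa [Equiv.apply_symm_apply]⟩)))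
    · exact .inl (.inl (.inr hw))
    · exact .inl (.inr (Set.mem_iUnion.2 ⟨m, hw⟩))
    · exact .inr (Set.mem_iUnion.2 ⟨i, hw⟩)
  · rintro ⟨h1, h2, h3, h4, hd, hl⟩
    refine ⟨?_, hd, hl⟩
    rintro w (((hw | hw) | hw) | hw)
    · obtain ⟨i, hi⟩ := Set.mem_iUnion.1 hw
      exact h1 _ w hi
    · exact h2 w hw
    · obtain ⟨i, hi⟩ := Set.mem_iUnion.1 hw
      exact h3 _ w hi
    · obtain ⟨i, hi⟩ := Set.mem_iUnion.1 hw
      exact h4 _ w hi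

namespace General

variable (h : S.General x)
include h

/-- The trace of the special member is contained in the scheme with parameters `traceParams`. -/
theorem mem_localAt_trace [Infinite K] {F : MvPolynomial (Fin 4) K}
    (hF : F ∈ traceIdeal (S.traceParams x)) {q : Fin 4 → K} (hq : q ≠ 0) :
    F ∈ localAt q (S.prodIdeal x ⊔ Ideal.span {X 3}) := by
  obtain ⟨hline, hstar, hpoint, hcoll, hdouble, hlength⟩ := mem_traceIdeal.1 hF
  set T := localAt q (S.prodIdeal x ⊔ Ideal.span {X 3}) with hT
  have hP : localAt q (S.prodIdeal x) ≤ T := localAt_mono le_sup_left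
  have hX : Ideal.span {(X 3 : MvPolynomial (Fin 4) K)} ≤ T := le_trans le_sup_right (le_localAt _ _)
  by_cases h3 : q 3 = 0
  swap
  · have : T = ⊤ := localAt_eq_top (g := X 3) (Ideal.mem_sup_right (Ideal.subset_span rfl))
      (by rwa [eval_X])
    rw [this]
    exact Submodule.mem_top
  rcases h.exists_local q hq with ⟨m, hm, hβ⟩ | ⟨k, k', hne, hk, hk', hkk, hβ⟩ | ⟨hv, α, hα⟩
  -- Modulo x₃ the product for the two arms contains the square of the ideal of the vertex, as both
  -- arms are transversal to H.
  · refine (sup_le hX ?_ : doublePointIdeal (S.pairVertex x m) ≤ T) (hdouble m)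
    refine le_trans (vanishing_point_sq_le (h.linearIndependent_pairVertex m) rfl
      (h.pairArm_third m 0) (h.pairArm_third m 1)) (sup_le hX ?_)
    exact (h.mul_pair_le hβ).trans hP
  · have hne' : k ≠ k' := fun h0 => hne (by rw [h0])
    -- Modulo x₃ the product of the ideals of two lines of H contains their intersection, so the
    -- embedded point at the node leaves no mark on the trace.
    obtain ⟨n, n', e, e', hn, hn', hli⟩ := exists_planeLine_frame (h.cr_movedEq hne') hq hk hk'
    have hle := h.mul_planeLine_le hne hkk hβ
    have h1 := hline k
    have h2 := hline k'
    rw [e] at hle h1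
    rw [e'] at hle h2
    exact (sup_le hX (hle.trans hP) : _ ≤ T) (vanishing_inf_le hli (J := Ideal.span {X 3})
      (fun φ => linearPoly_mem_span_X hli h3 hn hn') ⟨h1, h2⟩)
  · have hα' : vanishingIdeal K (piece (S.degen x 0) α) ≤ T := (le_localAt_prodIdeal hα).trans hP
    rcases α with i | i | i | i
    · rcases S.line_cases i with ⟨m, rfl⟩ | ⟨m, e, rfl⟩ | ⟨m, rfl⟩
      · rw [h.piece_moved] at hα'
        exact hα' (hline _)
      · obtain ⟨g, hg, hgq⟩ := exists_separating_piece (y := S.degen x 0) (α := .inl (S.pair m e))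
          (q := q) fun hmem => by
            rw [h.piece_pair] at hmem
            obtain ⟨a, ha⟩ := exists_smul_vertex hmem h3 (h.pairArm_third m e)
            exact hv m (mem_pointCone.2 ⟨a, ha⟩)
        -- A line of a pair meets H only in the vertex, which is excluded here. So its ideal
        -- contains an element that is nonzero at q, and there is no condition at q.
        refine localAt_localAt q _ ?_
        rw [localAt_eq_top (hα' hg) hgq]
        exact Submodule.mem_top
      · rw [piece_kept, spanPair_meet (h.good.line_third _ 0)] at hα'
        refine (sup_le hX hα' : _ ≤ T) (vanishing_point_le (linearIndependent_pair_of_third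
          (inPlane_ne_zero (ne_zero_of_apply (j := 2) ?_)) rfl (h.good.line_third _ _)) rfl
            (h.good.line_third _ _) (hpoint m))
        exact h.goodTrace.mark (.inr (.inr (.inl m)))
    · rcases S.cross_cases i with ⟨m, rfl⟩ | ⟨m, rfl⟩
      · rw [h.piece_movedCross] at hα'
        refine hα' (mem_vanishing.2 fun w hw => ?_)
        obtain ⟨e, he⟩ := Set.mem_iUnion.1 hw
        exact mem_vanishing.1 (hline _) w he
      · rw [piece_keptCross] at hα'
        have hli := h.good.linearIndependent_cross (S.keptCross m)
        refine (sup_le ?_ ?_ : lengthTwoIdeal _ _ ≤ T) (hlength m)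
        · rw [inPlane_meet]
          refine vanishing_spanPair_le_plane hli rfl (h.good.arm_third _ _)
            (hX (Ideal.subset_span rfl)) fun φ h0 h1 h2 => hα' (mem_vanishing.2 fun w hw => ?_)
          obtain ⟨e, he⟩ := Set.mem_iUnion.1 hw
          obtain ⟨a, b, rfl⟩ := mem_spanPair.1 he
          have : φ (armPt x (S.keptCross m) e) = 0 := by
            fin_cases e
            exacts [h1, h2]
          rw [eval_linearPoly, map_add, map_smul, map_smul, h0, this, smul_zero, smul_zero, add_zero]
        · refine le_trans (vanishing_point_sq_le hli rfl (h.good.arm_third _ _)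
            (h.good.arm_third _ _)) (sup_le hX fun G hG => hα' (mem_vanishing.2 fun w hw => ?_))
          have hG' := Ideal.mul_le_inf hG
          obtain ⟨e, he⟩ := Set.mem_iUnion.1 hw
          fin_cases e
          exacts [mem_vanishing.1 hG'.1 w he, mem_vanishing.1 hG'.2 w he]
    · rw [piece_star] at hα'
      exact hα' hstar
    · rw [piece_pt] at hα'
      exact hα' (hcoll _)

end General

end Split

/-! ### First order conditions and their passage to trace and saturation -/

section

variable {K : Type*} [Field K]

/-- A form vanishing on the points outside `H` of a line not in `H` vanishes on the line. -/
theorem mem_vanishing_of_X_mul [Infinite K] {u v : Fin 4 → K} (hv : v 3 ≠ 0)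
    {F : MvPolynomial (Fin 4) K} (hF : X 3 * F ∈ vanishingIdeal K (spanPair u v)) :
    F ∈ vanishingIdeal K (spanPair u v) := by
  rw [mem_vanishing] at hF ⊢
  have key : ∀ w ∈ spanPair u v, w 3 ≠ 0 → eval w F = 0 := by
    intro w hw h3
    have := hF w hw
    rw [map_mul, eval_X] at this
    exact (mul_eq_zero.1 this).resolve_left h3
  intro w hw
  by_cases h3 : w 3 = 0
  · refine eval_eq_zero_of_line (n := v) fun t ht => key _ ?_ ?_
    · obtain ⟨a, b, rfl⟩ := mem_spanPair.1 hw
      exact mem_spanPair.2 ⟨a, b + t, by module⟩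
    · simpa [h3] using ⟨ht, hv⟩
  · exact key w hw h3

/-- By the product rule, a multiplier that is nonzero at q can be cancelled, first from the value
and then from the derivative. -/
theorem eval_and_dirDeriv_of_localAt {q n : Fin 4 → K} {I : Ideal (MvPolynomial (Fin 4) K)}
    (hI : ∀ A ∈ I, eval q A = 0 ∧ dirDeriv q n A = 0) {F : MvPolynomial (Fin 4) K}
    (hF : F ∈ localAt q I) : eval q F = 0 ∧ dirDeriv q n F = 0 := by
  obtain ⟨g, hg, hgF⟩ := mem_localAt.1 hF
  obtain ⟨h1, h2⟩ := hI _ hgF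
  have h0 : eval q F = 0 := by
    rw [map_mul] at h1
    exact (mul_eq_zero.1 h1).resolve_left hg
  refine ⟨h0, ?_⟩
  rw [dirDeriv_mul, h0, zero_mul, add_zero] at h2
  exact (mul_eq_zero.1 h2).resolve_left hg

/-- First order conditions in `H` on an ideal pass to the saturation of its sum with `(x₃)`. -/
theorem eval_and_dirDeriv_of_trace [IsAlgClosed K] {q n : Fin 4 → K} (hq : q ≠ 0) (hq3 : q 3 = 0)
    (hn3 : n 3 = 0) {I : Ideal (MvPolynomial (Fin 4) K)}
    (hI : ∀ A ∈ I, eval q A = 0 ∧ dirDeriv q n A = 0) {F : MvPolynomial (Fin 4) K}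
    (hF : F ∈ trace (saturation I)) : eval q F = 0 ∧ dirDeriv q n F = 0 := by
  refine eval_and_dirDeriv_of_localAt (fun A hA => ?_) (mem_saturation_iff.1 hF q hq)
  obtain ⟨A, hA', B, hB, rfl⟩ := Submodule.mem_sup.1 hA
  obtain ⟨h1, h2⟩ := eval_and_dirDeriv_of_localAt hI (mem_saturation_iff.1 hA' q hq)
  obtain ⟨B, rfl⟩ := Ideal.mem_span_singleton'.1 hB
  rw [map_add, dirDeriv_add, dirDeriv_mul, dirDeriv_X, h1, h2, map_mul, eval_X, hq3, hn3]
  simp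

theorem eval_and_dirDeriv_smul [Infinite K] {p n : Fin 4 → K} {F : MvPolynomial (Fin 4) K}
    (h : ∀ t : K, t ≠ 0 → eval (t • p) F = 0 ∧ dirDeriv (t • p) n F = 0) (t : K) :
    eval (t • p) F = 0 ∧ dirDeriv (t • p) n F = 0 := by
  by_cases ht : t = 0
  swap
  · exact h t ht
  rw [ht, zero_smul]
  constructor
  · exact eval_eq_zero_of_line (n := p) fun a ha => by rw [zero_add]; exact (h a ha).1
  · have hd (q : Fin 4 → K) : dirDeriv q n F = eval q (∑ i, C (n i) * pderiv i F) := by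
      simp [dirDeriv]
    rw [hd]
    exact eval_eq_zero_of_line (n := p) fun a ha => by
      rw [zero_add, ← hd]
      exact (h a ha).2

/-- A basis of the whole space is taken with the vertical vector first; its coordinate is a multiple
of x₃, which the ideal contains, and the remaining directions lie in H. -/
theorem mem_doublePointIdeal_of_dirDeriv [Infinite K] {v : Fin 3 → K} (hv : v 2 ≠ 0)
    {F : MvPolynomial (Fin 4) K} (hF : ∀ (n : Fin 4 → K), n 3 = 0 → ∀ t : K,
      eval (t • inPlane v) F = 0 ∧ dirDeriv (t • inPlane v) n F = 0) : F ∈ doublePointIdeal v := by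
  have hli : LinearIndependent K ![inPlane v, inPlane ![1, 0, 0], inPlane ![0, 1, 0]] := by
    refine linearIndependent_triple_of_dot ?_
    rw [proj_inPlane, proj_inPlane]
    simpa [dot, cr] using hv
  obtain ⟨b, hb⟩ := exists_basis_of_linearIndependent
    (linearIndependent_vertical_cons hli rfl rfl rfl)
  have h1 : b 1 = inPlane v := hb 1
  have h2 : b 2 = inPlane ![1, 0, 0] := hb 2
  have h3 : b 3 = inPlane ![0, 1, 0] := hb 3
  rw [doublePointIdeal, ← h1]
  refine mem_sq_sup_of_dirDeriv b 1 {2, 3} (fun j hj hj1 => ?_) (fun t => ?_) fun j hj t => ?_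
  · obtain rfl : j = 0 := by
      revert j
      simp only [Set.mem_insert_iff, Set.mem_singleton_iff]
      decide
    refine linearPoly_mem_span_X hli rfl rfl rfl ?_ ?_ ?_
    · rw [← h1]; simp
    · rw [← h2]; simp
    · rw [← h3]; simp
  · rw [h1]
    exact (hF 0 rfl t).1
  · rw [h1]
    rcases hj with rfl | rfl
    · rw [h2]
      exact (hF _ rfl t).2
    · rw [h3]
      exact (hF _ rfl t).2

theorem mem_lengthTwoIdeal_of_dirDeriv [Infinite K] {v v' : Fin 3 → K}
    (hli : LinearIndependent K ![inPlane v, inPlane v']) {F : MvPolynomial (Fin 4) K}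
    (hF : ∀ t : K, eval (t • inPlane v) F = 0 ∧ dirDeriv (t • inPlane v) (inPlane v') F = 0) :
    F ∈ lengthTwoIdeal v v' := by
  obtain ⟨n, hn⟩ := exists_triple_of_pair hli
  obtain ⟨b, -, h2, h3⟩ := exists_basis_of_triple hn
  rw [lengthTwoIdeal, ← h2, ← h3]
  refine mem_sq_sup_of_dirDeriv b 2 {3} (fun j hj hj2 => ?_) (fun t => ?_) fun j hj t => ?_
  · exact coordPoly_mem_spanPair b hj2 hj
  · rw [h2]
    exact (hF t).1
  · rw [Set.mem_singleton_iff.1 hj, h2, h3]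
    exact (hF t).2

end

/-! ### The limit contains the expected residual scheme and trace -/

namespace Split

variable {K : Type*} [Field K] {σ : SchemeType} {l s c : ℕ} {S : Split σ l s c} {x : Coord σ → K}

/-- The special member before saturation. -/
noncomputable abbrev limitIdeal (S : Split σ l s c) (x : Coord σ → K) :
    Ideal (MvPolynomial (Fin 4) K) := memberIdeal x (S.direction x) 0

theorem limitIdeal_le [Infinite K] (α : Piece σ) :
    S.limitIdeal x ≤ vanishingIdeal K (piece (S.degen x 0) α) :=
  memberIdeal_le (S.direction_star x) 0 α

namespace General

variable (h : S.General x)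
include h

/-- Scaling the last coordinates of the spanning points moves a point with fixed coefficients along
a vertical line, at constant velocity. -/
theorem exists_vertical_curve (k : (Fin c × Fin 2) ⊕ Fin l) {w : Fin 4 → K}
    (hw : w ∈ planeLine (S.movedEq x k)) : ∃ a : K, ∀ t : K,
      w + t • (a • Pi.single 3 1 : Fin 4 → K) ∈ piece (S.degen x t) (S.movedPiece k) := by
  rcases k with ⟨m, e⟩ | m
  · rw [← show spanPair _ _ = planeLine (S.movedEq x (.inl (m, e))) from
      spanPair_inPlane (j := 2) (h.movedEq_ne_zero (.inl (m, e)))] at hw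
    obtain ⟨a, b, rfl⟩ := mem_spanPair.1 hw
    refine ⟨b * armPt x (S.movedCross m) e 3, fun t => ?_⟩
    change _ ∈ piece _ (.inr (.inl (S.movedCross m)))
    refine Set.mem_iUnion.2 ⟨e, ?_⟩
    rw [vtx_degen, armPt_movedCross, tilt]
    refine mem_spanPair.2 ⟨a, b, ?_⟩
    ext j
    simp [Pi.single_apply]
    split_ifs <;> ring
  · rw [← show spanPair _ _ = planeLine (S.movedEq x (.inr m)) from
      spanPair_inPlane (j := 2) (h.movedEq_ne_zero (.inr m))] at hw
    obtain ⟨a, b, rfl⟩ := mem_spanPair.1 hw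
    refine ⟨a * linePt x (S.moved m) 0 3 + b * linePt x (S.moved m) 1 3, fun t => ?_⟩
    change _ ∈ piece _ (.inl (S.moved m))
    rw [piece, linePt_moved, linePt_moved, tilt, tilt]
    refine mem_spanPair.2 ⟨a, b, ?_⟩
    ext j
    simp [Pi.single_apply]
    split_ifs <;> ring

theorem saturation_limitIdeal_le [IsAlgClosed K] (α : Piece σ) :
    saturation (S.limitIdeal x) ≤ vanishingIdeal K (piece (S.degen x 0) α) :=
  have : Infinite K := inferInstance
  saturation_le_vanishing (limitIdeal_le α) (fun _ hw t => smul_mem_piece hw t)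
    fun _ hw => exists_ne_zero_mem_piece h.framed hw

/-- The residual scheme of the special member contains the scheme with parameters `residualParams`. -/
theorem residual_le [IsAlgClosed K] :
    residual (saturation (S.limitIdeal x)) ≤ schemeIdeal (S.residualParams x) := by
  have : Infinite K := inferInstance
  intro F hF
  rw [residual, Submodule.mem_colon_singleton, smul_eq_mul, mul_comm] at hF
  have hα (α : Piece σ) := h.saturation_limitIdeal_le α hF
  have hunion {Z : Fin 2 → Set (Fin 4 → K)} (hZ : ∀ e, F ∈ vanishingIdeal K (Z e)) :
      F ∈ vanishingIdeal K (⋃ e, Z e) := mem_vanishing.2 fun w hw => by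
    obtain ⟨e, he⟩ := Set.mem_iUnion.1 hw
    exact mem_vanishing.1 (hZ e) w he
  rw [mem_schemeIdeal]
  rintro (k | k | k | k)
  · obtain ⟨m, rfl⟩ := S.resLines.symm.surjective k
    have := hα (.inl (S.kept m))
    rw [piece_kept] at this
    rw [piece_residual_line]
    exact mem_vanishing_of_X_mul (h.good.line_third _ _) this
  · obtain ⟨m | m, rfl⟩ := S.resCrosses.symm.surjective k
    · rw [piece_residual_cross]
      refine hunion fun e => ?_
      have := hα (.inr (.inl (S.keptCross m)))
      rw [piece_keptCross] at this
      exact mem_vanishing_of_X_mul (h.good.arm_third _ _)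
        (vanishing_anti (Set.subset_iUnion (fun e => spanPair _ (armPt x (S.keptCross m) e)) e) this)
    · rw [piece_residual_pair]
      refine hunion fun e => ?_
      have := hα (.inl (S.pair m e))
      rw [h.piece_pair] at this
      exact mem_vanishing_of_X_mul (h.pairArm_third m e) this
  · have key (w : Fin 4 → K) (hw : w ∈ piece (S.residualParams x) (.inr (.inr (.inl k)))) (h0 : w ≠ 0) :
        eval w F = 0 := by
      obtain ⟨i, j, hk, hi, hj⟩ := mem_subStarCone.1 hw
      have hne := S.movedPiece_ne hk
      obtain ⟨a, ha⟩ := h.exists_vertical_curve (S.resStar i) hi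
      obtain ⟨a', ha'⟩ := h.exists_vertical_curve (S.resStar j) hj
      obtain ⟨g, hg, hgF⟩ := mem_localAt.1 (mem_saturation_iff.1 hF w h0)
      obtain ⟨G, hG, hGF⟩ := mem_memberIdeal.1 hgF
      -- Two moved lines leave the node w with vertical velocities a and a'. Since x₃ vanishes at w,
      -- the derivative of g x₃ F in the direction of their difference is (a - a') g(w) F(w).
      have hd := dirDeriv_sub_eq_zero hG ha ha'
      have w3 : w 3 = 0 := hi.1
      rw [hGF, dirDeriv_mul, dirDeriv_mul, dirDeriv_X, map_mul, eval_X, w3] at hd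
      simp only [Pi.sub_apply, Pi.smul_apply, Pi.single_eq_same, smul_eq_mul, mul_one, zero_mul,
        zero_add, add_zero, mul_eq_zero] at hd
      rcases hd with hd | hd | hd
      · exact absurd hd hg
      · exact hd
      -- Equal velocities would keep the two curves together up to t = 1, where the pieces are
      -- disjoint.
      · exfalso
        have e := sub_eq_zero.1 hd
        have h1 := ha 1
        have h1' := ha' 1
        rw [degen, path_one] at h1 h1'
        rw [← e] at h1'
        have hz := h.good.eq_zero_of_mem hne h1 h1'
        refine h0 (eq_zero_of_proj ?_ w3)
        have := congrArg proj hz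
        rw [proj_add, proj_smul, proj_smul] at this
        have hs : proj (Pi.single 3 1 : Fin 4 → K) = 0 := by
          ext j
          fin_cases j <;> simp [proj]
        rw [hs, smul_zero, smul_zero, add_zero] at this
        rw [this]
        ext j
        fin_cases j <;> rfl
    rw [mem_vanishing]
    intro w hw
    by_cases h0 : w = 0
    · obtain ⟨n, hn, hn0⟩ := exists_ne_zero_mem_piece h.goodResidual.framed hw
      rw [h0]
      refine eval_eq_zero_of_line (n := n) fun t ht => ?_
      rw [zero_add]
      exact key _ (smul_mem_piece hn t) (smul_ne_zero ht hn0)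
    · exact key w hw h0
  · exact k.elim0

/-- The special member is singular at the vertices of the new crosses. -/
theorem dirDeriv_pairVertex [Infinite K] (m : Fin s) {t : K} (ht : t ≠ 0) {A : MvPolynomial (Fin 4) K}
    (hA : A ∈ S.limitIdeal x) (n : Fin 4 → K) :
    dirDeriv (t • inPlane (S.pairVertex x m)) n A = 0 := by
  set p := inPlane (S.pairVertex x m) with hp
  have hpiece (e : Fin 2) : dirDeriv (t • p) (S.pairArm x m e) A = 0 := by
    refine dirDeriv_eq_zero_of_line fun a => ?_
    refine mem_vanishing.1 (limitIdeal_le (.inl (S.pair m e)) hA) _ ?_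
    rw [h.piece_pair]
    exact mem_spanPair.2 ⟨t, a, rfl⟩
  have hvertex : dirDeriv (t • p) p A = 0 := by
    refine dirDeriv_eq_zero_of_line fun a => ?_
    refine mem_vanishing.1 (limitIdeal_le (.inl (S.pair m 0)) hA) _ ?_
    rw [h.piece_pair]
    exact mem_spanPair.2 ⟨t + a, 0, by module⟩
  have hp0 : p = linePt x (S.pair m 0) 0 3 • linePt x (S.pair m 0) 1 -
    linePt x (S.pair m 0) 1 3 • linePt x (S.pair m 0) 0 := inPlane_meet _ _
  have hv3 := h.good.line_third (S.pair m 1) 1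
  have hu3 := h.good.line_third (S.pair m 0) 0
  have hs := S.add_shift hv3
  have hdet := h.good.line_line (S.pair m 0) (S.pair m 1) (by simp [pair])
  -- The point of the second line in H runs straight from p at t = 0 to its original position at t =
  -- 1, while p rests on the first line. The direction is the difference of these two positions.
  have hcurve : dirDeriv (t • p) (linePt x (S.pair m 1) 0 3 • linePt x (S.pair m 1) 1 -
      linePt x (S.pair m 1) 1 3 • linePt x (S.pair m 1) 0 - p) A = 0 := by
    obtain ⟨G, hG, rfl⟩ := mem_memberIdeal.1 hA
    have h1 (a : K) : t • p + a • (t • (linePt x (S.pair m 1) 0 3 • linePt x (S.pair m 1) 1 -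
        linePt x (S.pair m 1) 1 3 • linePt x (S.pair m 1) 0 - p)) ∈
        piece (path x (S.direction x) a) (.inl (S.pair m 1)) := by
      change _ ∈ piece (S.degen x a) _
      rw [piece, linePt_pair_one, linePt_pair_shift]
      refine mem_spanPair.2 ⟨-(t * linePt x (S.pair m 1) 1 3), t * linePt x (S.pair m 1) 0 3, ?_⟩
      have hs' : linePt x (S.pair m 1) 1 3 • S.shift x m =
          linePt x (S.pair m 1) 0 3 • linePt x (S.pair m 1) 1 - p -
            linePt x (S.pair m 1) 1 3 • linePt x (S.pair m 1) 0 := by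
        rw [← hs, smul_add, add_sub_cancel_left]
      have : -(t * linePt x (S.pair m 1) 1 3) • (linePt x (S.pair m 1) 0 + (1 - a) • S.shift x m) =
          -(t * linePt x (S.pair m 1) 1 3) • linePt x (S.pair m 1) 0 -
            (t * (1 - a)) • (linePt x (S.pair m 1) 1 3 • S.shift x m) := by module
      rw [this, hs']
      module
    have h2 (a : K) : t • p + a • (0 : Fin 4 → K) ∈
        piece (path x (S.direction x) a) (.inl (S.pair m 0)) := by
      change _ ∈ piece (S.degen x a) _
      rw [piece, linePt_pair_zero, linePt_pair_zero, hp0]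
      exact mem_spanPair.2 ⟨-(t * linePt x (S.pair m 0) 1 3), t * linePt x (S.pair m 0) 0 3, by module⟩
    have := dirDeriv_sub_eq_zero hG h1 h2
    rw [sub_zero, ← dirDerivₗ_apply, map_smul, dirDerivₗ_apply, smul_eq_mul] at this
    exact (mul_eq_zero.1 this).resolve_left ht
  simp only [← dirDerivₗ_apply] at hpiece hvertex hcurve ⊢
  generalize dirDerivₗ (t • p) A = φ at *
  have e0 : φ (linePt x (S.pair m 0) 0) = 0 := hpiece 0
  have e3 : φ (linePt x (S.pair m 1) 1) = 0 := hpiece 1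
  have e1 : φ (linePt x (S.pair m 0) 1) = 0 := by
    rw [hp0, map_sub, map_smul, map_smul, e0, smul_zero, sub_zero, smul_eq_mul] at hvertex
    exact (mul_eq_zero.1 hvertex).resolve_left hu3
  have e2 : φ (linePt x (S.pair m 1) 0) = 0 := by
    rw [map_sub, map_sub, map_smul, map_smul, hvertex, e3, smul_zero, sub_zero, zero_sub,
      smul_eq_mul, neg_eq_zero] at hcurve
    exact (mul_eq_zero.1 hcurve).resolve_left hv3
  -- The derivative now vanishes on the four vectors spanning the two original lines. These lines
  -- are skew, so it vanishes in every direction.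
  obtain ⟨b, hb⟩ := exists_basis_of_linearIndependent (linearIndependent_of_det4 hdet)
  have : φ = 0 := b.ext fun i => by
    rw [hb]
    fin_cases i
    exacts [e0, e1, e2, e3]
  rw [this]
  rfl

theorem trace_le_vanishing [IsAlgClosed K] {Z : Set (Fin 4 → K)} (α : Piece σ)
    (hZ : Z ⊆ piece (S.degen x 0) α) (h3 : ∀ w ∈ Z, w 3 = 0) (hcone : ∀ w ∈ Z, ∀ t : K, t • w ∈ Z)
    (hne : ∀ w ∈ Z, ∃ n ∈ Z, n ≠ 0) : trace (saturation (S.limitIdeal x)) ≤ vanishingIdeal K Z := by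
  refine saturation_le_vanishing (sup_le ?_ ?_) hcone hne
  · exact (h.saturation_limitIdeal_le α).trans (vanishing_anti hZ)
  · rw [Ideal.span_singleton_le_iff_mem, mem_vanishing]
    intro w hw
    rw [eval_X]
    exact h3 w hw

theorem trace_le_vanishing_point [IsAlgClosed K] {v : Fin 3 → K} (hv : v 2 ≠ 0) (α : Piece σ)
    (hvα : inPlane v ∈ piece (S.degen x 0) α) :
    trace (saturation (S.limitIdeal x)) ≤ vanishingIdeal K (pointCone (inPlane v)) := by
  refine h.trace_le_vanishing α ?_ ?_ ?_ ?_
  · intro w hw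
    obtain ⟨a, rfl⟩ := mem_pointCone.1 hw
    exact smul_mem_piece hvα a
  · intro w hw
    obtain ⟨a, rfl⟩ := mem_pointCone.1 hw
    simp [inPlane]
  · intro w hw t
    obtain ⟨a, rfl⟩ := mem_pointCone.1 hw
    exact mem_pointCone.2 ⟨t * a, mul_smul _ _ _⟩
  · intro w hw
    exact ⟨inPlane v, mem_pointCone.2 ⟨1, one_smul _ _⟩, inPlane_ne_zero (ne_zero_of_apply hv)⟩

/-- The trace of the special member contains the scheme with parameters `traceParams`. -/
theorem trace_le [IsAlgClosed K] :
    trace (saturation (S.limitIdeal x)) ≤ traceIdeal (S.traceParams x) := by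
  have : Infinite K := inferInstance
  intro F hF
  rw [mem_traceIdeal]
  refine ⟨fun k => ?_, ?_, fun m => ?_, fun i => ?_, fun m => ?_, fun m => ?_⟩
  · refine h.trace_le_vanishing _ (h.planeLine_subset k) (fun w hw => hw.1)
      (fun w hw t => smul_mem_planeLine hw t) (fun w hw => ?_) hF
    obtain ⟨n, hn, h1, -⟩ := exists_planeLine_ne_zero (S.movedEq x k) (S.movedEq x k)
    exact ⟨n, h1, hn⟩
  · rw [← piece_star (S := S)]
    refine h.trace_le_vanishing _ subset_rfl (fun w hw => ?_)
      (fun w hw t => smul_mem_piece hw t) (fun w hw => exists_ne_zero_mem_piece h.framed hw) hF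
    rw [piece_star] at hw
    obtain ⟨i, j, -, hi, -⟩ := mem_subStarCone.1 hw
    exact hi.1
  · refine h.trace_le_vanishing_point (h.goodTrace.mark (.inr (.inr (.inl m)))) (.inl (S.kept m)) ?_ hF
    rw [piece_kept, spanPair_meet (h.good.line_third _ _)]
    exact left_mem_spanPair _ _
  · have hv : proj (collPt x i) 2 ≠ 0 := by
      have := h.goodTrace.mark (.inr (.inr (.inr i)))
      rwa [traceMk_coll] at this
    refine h.trace_le_vanishing_point hv (.inr (.inr (.inr i))) ?_ hF
    rw [piece_pt]
    exact mem_pointCone.2 ⟨1, one_smul _ _⟩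
  · refine mem_doublePointIdeal_of_dirDeriv (h.pairVertex_ne_zero m) fun n hn =>
      eval_and_dirDeriv_smul fun t ht => ?_
    refine eval_and_dirDeriv_of_trace (smul_ne_zero ht (inPlane_ne_zero
      (ne_zero_of_apply (h.pairVertex_ne_zero m)))) (by simp [inPlane]) hn
      (fun A hA => ⟨?_, h.dirDeriv_pairVertex m ht hA n⟩) hF
    refine mem_vanishing.1 (limitIdeal_le (.inl (S.pair m 0)) hA) _ ?_
    rw [h.piece_pair]
    exact smul_mem_spanPair (left_mem_spanPair _ _) t
  · have hli := Fintype.linearIndependent_iff.1 (h.good.linearIndependent_cross (S.keptCross m))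
    have h3 := h.good.arm_third (S.keptCross m)
    have hpiece {A : MvPolynomial (Fin 4) K} (hA : A ∈ S.limitIdeal x) (a b : K) (e : Fin 2) :
        eval (a • inPlane (vtx x (S.keptCross m)) + b • armPt x (S.keptCross m) e) A = 0 := by
      refine mem_vanishing.1 (limitIdeal_le (.inr (.inl (S.keptCross m))) hA) _ ?_
      rw [piece_keptCross]
      exact Set.mem_iUnion.2 ⟨e, mem_spanPair.2 ⟨a, b, rfl⟩⟩
    have hv : vtx x (S.keptCross m) 2 ≠ 0 := h.goodTrace.mark (.inr (.inl m))
    refine mem_lengthTwoIdeal_of_dirDeriv ?_ (eval_and_dirDeriv_smul fun t ht => ?_)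
    · rw [LinearIndependent.pair_iff]
      intro a b hab
      rw [inPlane_meet] at hab
      have key := hli ![a, -(b * armPt x (S.keptCross m) 1 3), b * armPt x (S.keptCross m) 0 3] (by
        rw [Fin.sum_univ_three]
        simp only [Matrix.cons_val_zero, Matrix.cons_val_one, Matrix.cons_val]
        rw [← hab]
        module)
      exact ⟨key 0, (mul_eq_zero.1 (key 2)).resolve_right (h3 0)⟩
    · refine eval_and_dirDeriv_of_trace (smul_ne_zero ht (inPlane_ne_zero
        (ne_zero_of_apply hv))) (by simp [inPlane]) rfl (fun A hA => ⟨?_, ?_⟩) hF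
      · simpa using hpiece hA t 0 0
      -- At the vertex the derivatives along both arms vanish, hence also the one along the line in
      -- which the plane of the cross meets H.
      · have hd (e : Fin 2) : dirDeriv (t • inPlane (vtx x (S.keptCross m)))
            (armPt x (S.keptCross m) e) A = 0 :=
          dirDeriv_eq_zero_of_line fun a => hpiece hA t a e
        rw [inPlane_meet]
        simp only [← dirDerivₗ_apply] at hd ⊢
        rw [map_sub, map_smul, map_smul, hd, hd, smul_zero, smul_zero, sub_zero]

theorem prodIdeal_le [IsAlgClosed K] : S.prodIdeal x ≤ saturation (S.limitIdeal x) :=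
  (prod_le_memberIdeal (S.direction_star x) h.framed).trans (le_saturation _)

theorem residual_eq [IsAlgClosed K] :
    residual (member (familyIdeal x (S.direction x)) 0) = schemeIdeal (S.residualParams x) := by
  have : Infinite K := inferInstance
  refine le_antisymm h.residual_le fun F hF => ?_
  rw [residual, Submodule.mem_colon_singleton, smul_eq_mul, mul_comm]
  exact mem_saturation_iff.2 fun q hq => localAt_mono
    (prod_le_memberIdeal (S.direction_star x) h.framed) (h.X_mul_mem hF hq)

theorem trace_eq [IsAlgClosed K] :
    trace (member (familyIdeal x (S.direction x)) 0) = traceIdeal (S.traceParams x) := by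
  have : Infinite K := inferInstance
  refine le_antisymm h.trace_le fun F hF => ?_
  exact mem_saturation_iff.2 fun q hq => localAt_mono (sup_le_sup_right h.prodIdeal_le _)
    (h.mem_localAt_trace hF hq)

end General

end Split

/-! ### Existence of the specialization steps -/

section

variable {K : Type*} [Field K] {σ : SchemeType}

/-- A condition on the parameters which is open and holds at `x` holds at all but finitely many points
of every affine line through `x`. -/
theorem eventually_path_ne_zero {f : MvPolynomial (Coord σ) K} {x : Coord σ → K} (hf : eval x f ≠ 0)
    (D : Coord σ → K) : ∀ᶠ a in Filter.cofinite, eval (path x D a) f ≠ 0 := by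
  let p : Polynomial K := aeval (pathPoly x D) f
  have hp (a : K) : p.eval a = eval (path x D a) f := by
    have h : (Polynomial.aeval a).comp (aeval (pathPoly x D) : _ →ₐ[K] Polynomial K) =
        aeval (path x D a) := by
      refine MvPolynomial.algHom_ext fun j => ?_
      simp
    have := congrArg (fun φ => φ f) h
    simpa [p, ← Polynomial.coe_aeval_eq_eval, aeval_eq_eval] using this
  have h0 : p ≠ 0 := fun h0 => hf (by rw [← path_one x D, ← hp, h0, Polynomial.eval_zero])
  classical
  refine (p.roots.toFinset.finite_toSet.subset fun a ha => ?_)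
  rw [Finset.mem_coe, Multiset.mem_toFinset, Polynomial.mem_roots h0, Polynomial.IsRoot, hp]
  exact not_not.1 ha

end

/-- The specialization `S(l, s, 0, c)` exists. -/
theorem generalSpecialization (K : Type*) [Field K] [IsAlgClosed K] (σ : SchemeType) {l s c : ℕ}
    (hl : l + 2 * s ≤ σ.lines) (hc : c ≤ σ.crosses) :
    GeneralSpecialization K σ (traceType σ l s 0 c) (residualType σ l s 0 c) := by
  have : Infinite K := inferInstance
  obtain ⟨S⟩ := exists_split σ hl hc
  intro f e f' hf he hf'
  -- Generality is recorded by a polynomial δ so that, being nonzero at x, it stays nonzero at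
  -- almost all members of the family.
  obtain ⟨δ, hδ, hgood⟩ := forGeneral_good (K := K) σ
  have h1 : ForGeneral fun x : Coord σ → K => eval x (f * δ) ≠ 0 := 
    ForGeneral.eval_ne_zero (mul_ne_zero hf hδ)
  have h2 : ForGeneral fun x : Coord σ → K =>
      eval (S.traceParams x) e ≠ 0 ∧ GoodTrace (S.traceParams x) :=
    ForGeneral.comap S.isPolyFun_traceParams S.forGeneral_traceParams
      (ForGeneral.and (ForGeneral.eval_ne_zero he) (forGeneral_goodTrace _))
  have h3 : ForGeneral fun x : Coord σ → K =>
      eval (S.residualParams x) f' ≠ 0 ∧ Good (S.residualParams x) :=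
    ForGeneral.comap S.isPolyFun_residualParams S.forGeneral_residualParams
      (ForGeneral.and (ForGeneral.eval_ne_zero hf') (forGeneral_good _))
  refine ((h1.and h2).and h3).mono fun x ⟨⟨hx, hz, hz'⟩, hy, hy'⟩ => ?_
  have hfδ {y : Coord σ → K} (hy : eval y (f * δ) ≠ 0) : eval y f ≠ 0 ∧ Good y := by
    rw [map_mul] at hy
    exact ⟨left_ne_zero_of_mul hy, hgood y (right_ne_zero_of_mul hy)⟩
  have h : S.General x := ⟨(hfδ hx).2, hz', hy'⟩
  refine ⟨S.traceParams x, S.residualParams x, _, hz, hy,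
    ⟨familyIdeal x (S.direction x), isFlatFamily_familyIdeal _ _, ?_, rfl, ?_⟩, h.trace_eq,
    h.residual_eq⟩
  · rw [member_familyIdeal (S.direction_star x) (by rw [path_one]; exact h.good), path_one]
  · filter_upwards [eventually_path_ne_zero hx (S.direction x)] with a ha
    exact ⟨_, (hfδ ha).1, member_familyIdeal (S.direction_star x) (hfδ ha).2⟩

/-- The source is written as a sum of what remains and what is used up, so that no truncated
subtraction survives and l, s, c are automatically permitted. -/
theorem step_typeB (K : Type*) [Field K] [IsAlgClosed K] (d L C A b p l s c : ℕ) :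
    Step K ⟨d + 1, L + l + 2 * s, C + c, A, b, p⟩ (typeB d L (C + s) (l + 2 * c) c) := by
  have h : residualType ⟨d + 1, L + l + 2 * s, C + c, A, b, p⟩ l s 0 c =
      typeB d L (C + s) (l + 2 * c) c := by
    simp only [residualType, typeB, SchemeType.mk.injEq, Nat.add_sub_cancel, and_true, add_zero,
      Nat.sub_zero, true_and]
    omega
  refine ⟨l, s, 0, c, ?_, ?_, ?_, h.symm, ?_⟩
  · simp
  · simp only
    omega
  · simp only
    omega
  · rw [← h]
    exact generalSpecialization K _ (by simp only; omega) (by simp only; omega)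

/-! ### Numerics -/

theorem six_mul_choose_three (d : ℕ) : 6 * (d + 3).choose 3 = (d + 1) * (d + 2) * (d + 3) := by
  induction d with
  | zero => rfl
  | succ d ih =>
    have h2 : 2 * (d + 3).choose 2 = (d + 3) * (d + 2) := by
      rw [Nat.choose_two_right, Nat.mul_div_cancel' (Nat.even_mul_pred_self _).two_dvd]
      rfl
    rw [show d + 1 + 3 = (d + 3) + 1 by ring, Nat.choose_succ_succ' (d + 3) 2]
    linarith

/-- The count is multiplied by 6, the omitted nodes are moved to the other side and the number of
star lines is A + 1. This leaves a polynomial identity over ℕ without division or subtraction; `hb`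
justifies the truncated difference in the definition. -/
theorem conditions_typeB {d L C A b : ℕ} (hb : 2 * b ≤ (A + 1) * A)
    (h : 6 * (L * (d + 1) + C * (2 * d + 1)) + 3 * ((A + 1) * A) =
      (d + 1) * (d + 2) * (d + 3) + 6 * b) :
    (typeB d L C (A + 1) b).conditions = ((typeB d L C (A + 1) b).deg + 3).choose 3 := by
  have h2 : 2 * (A + 1).choose 2 = (A + 1) * A := by
    rw [Nat.choose_two_right, Nat.mul_div_cancel' (Nat.even_mul_pred_self _).two_dvd]
    rfl
  have h3 := six_mul_choose_three d
  simp only [SchemeType.conditions, typeB]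
  omega

theorem conditions_typeY {d l p : ℕ} (h : 6 * (l * (d + 1) + p) = (d + 1) * (d + 2) * (d + 3)) :
    (typeY d l p).conditions = ((typeY d l p).deg + 3).choose 3 := by
  have h3 := six_mul_choose_three d
  simp only [SchemeType.conditions, typeY, zero_mul, Nat.choose_zero_succ, Nat.sub_zero]
  omega

/-- Here and in the next three lemmas the parity of k is fixed and the divisions are carried out, so
that the ends of the chains can be matched by `ring`. -/
theorem reductionScheme₀_even (j : ℕ) : reductionScheme₀ (2 * j) =
    typeB (6 * j) (2 * j * j + 5 * j + 1) (2 * j * j) (2 * j + 1) j := by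
  rw [reductionScheme₀, if_neg (by simp), typeB, typeB, SchemeType.mk.injEq]
  refine ⟨by ring, ?_, ?_, rfl, by omega, rfl⟩
  · exact Nat.div_eq_of_eq_mul_right two_pos (by ring)
  · exact Nat.div_eq_of_eq_mul_right two_pos (by ring)

theorem reductionScheme₀_odd (j : ℕ) : reductionScheme₀ (2 * j + 1) =
    typeB (6 * j + 3) (2 * j * j + 7 * j + 5) (2 * j * j + 2 * j) (2 * j + 2) (j + 1) := by
  rw [reductionScheme₀, if_pos (by simp), typeB, typeB, SchemeType.mk.injEq]
  refine ⟨by ring, ?_, ?_, rfl, by omega, rfl⟩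
  · exact Nat.div_eq_of_eq_mul_right two_pos (by ring)
  · refine Nat.div_eq_of_eq_mul_right two_pos (Nat.sub_eq_of_eq_add (by ring))

theorem reductionScheme₂_even (i : ℕ) : reductionScheme₂ (2 * i + 2) =
    typeB (6 * i + 4) (2 * i * i + 9 * i + 7) (2 * i * i + 2 * i) (2 * i + 2) (i + 1) := by
  rw [reductionScheme₂, if_neg (by simp [parity_simps]), typeB, typeB, SchemeType.mk.injEq]
  refine ⟨by omega, ?_, ?_, rfl, by omega, rfl⟩
  · exact Nat.div_eq_of_eq_mul_right two_pos (by ring)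
  · rw [Nat.add_sub_cancel]
    exact Nat.div_eq_of_eq_mul_right two_pos (by ring)

theorem reductionScheme₂_odd (j : ℕ) : reductionScheme₂ (2 * j + 1) =
    typeB (6 * j + 1) (2 * j * j + 7 * j + 2) (2 * j * j) (2 * j + 1) j := by
  rw [reductionScheme₂, if_pos (by simp), typeB, typeB, SchemeType.mk.injEq]
  refine ⟨by omega, ?_, ?_, rfl, by omega, rfl⟩
  · rw [show (2 * j + 1) * (2 * j + 1 + 5) = 2 * (2 * j * j + 7 * j + 3) by ring,
      Nat.mul_div_cancel_left _ two_pos]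
    rfl
  · rw [Nat.add_sub_cancel]
    exact Nat.div_eq_of_eq_mul_right two_pos (by ring)

/-- A specialization step to a scheme with the expected number of conditions. -/
def GoodStep (K : Type*) [Field K] (σ σ' : SchemeType) : Prop :=
  Step K σ σ' ∧ σ'.conditions = (σ'.deg + 3).choose 3

theorem goodStep (K : Type*) [Field K] [IsAlgClosed K] {σ : SchemeType} (l s C : ℕ)
    {c d L C' A' : ℕ} (h₁ : σ.deg = d + 1) (h₂ : σ.lines = L + l + 2 * s) (h₃ : σ.crosses = C + c)
    (hC : C' = C + s) (hA : A' + 1 = l + 2 * c)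
    (hc : 6 * (L * (d + 1) + C' * (2 * d + 1)) + 3 * ((A' + 1) * A') =
      (d + 1) * (d + 2) * (d + 3) + 6 * c) : GoodStep K σ (typeB d L C' (A' + 1) c) := by
  obtain ⟨e, M, D, A, b, p⟩ := σ
  obtain rfl : e = d + 1 := h₁
  obtain rfl : M = L + l + 2 * s := h₂
  obtain rfl : D = C + c := h₃
  refine ⟨?_, conditions_typeB ?_ hc⟩
  · rw [hC, hA]
    exact step_typeB K d L C A b p l s c
  -- From A' + 1 = l + 2c: if A' = 0 then c = 0, and otherwise 2c is at most A' + 1, hence at most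
  -- (A' + 1) A'.
  · rcases Nat.eq_zero_or_pos A' with rfl | hA'
    · omega
    · exact le_trans (by omega) (Nat.le_mul_of_pos_right (A' + 1) hA')

theorem goodStep_typeY (K : Type*) [Field K] [IsAlgClosed K] (l : ℕ) {e M p d L s A' : ℕ}
    (h₁ : e = d + 1) (h₂ : M = L + l + 2 * s) (hA : A' + 1 = l)
    (hc : 6 * (L * (d + 1) + s * (2 * d + 1)) + 3 * ((A' + 1) * A') =
      (d + 1) * (d + 2) * (d + 3)) : GoodStep K (typeY e M p) (typeB d L s (A' + 1) 0) :=
  goodStep K l s 0 h₁ h₂ rfl (zero_add s).symm hA hc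

theorem goodStep_typeB (K : Type*) [Field K] [IsAlgClosed K] (l s C : ℕ)
    {e M D A b c d L C' A' : ℕ} (h₁ : e = d + 1) (h₂ : M = L + l + 2 * s) (h₃ : D = C + c)
    (hC : C' = C + s) (hA : A' + 1 = l + 2 * c)
    (hc : 6 * (L * (d + 1) + C' * (2 * d + 1)) + 3 * ((A' + 1) * A') =
      (d + 1) * (d + 2) * (d + 3) + 6 * c) :
    GoodStep K (typeB e M D A b) (typeB d L C' (A' + 1) c) :=
  goodStep K l s C h₁ h₂ h₃ hC hA hc

/-! ### Chains of at most three steps -/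

/-- There is a short chain of specialization steps from `Y` to the reductions. -/
def HasChain (K : Type*) [Field K] (Y : SchemeType) : Prop :=
  ∃ (n : ℕ) (σ : ℕ → SchemeType), n ≤ 3 ∧ σ 0 = Y ∧ (∀ i < n, Step K (σ i) (σ (i + 1))) ∧
    (∀ i ≤ n, (σ i).conditions = ((σ i).deg + 3).choose 3) ∧ OccursInReduction (σ n)

theorem exists_chain_two {K : Type*} [Field K] {Y a b : SchemeType}
    (hY : Y.conditions = (Y.deg + 3).choose 3) (h₁ : GoodStep K Y a) (h₂ : GoodStep K a b)
    (hb : OccursInReduction b) : HasChain K Y := by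
  refine ⟨2, fun | 0 => Y | 1 => a | _ => b, by norm_num, rfl, fun i hi => ?_, fun i hi => ?_, hb⟩
  · interval_cases i
    exacts [h₁.1, h₂.1]
  · interval_cases i
    exacts [hY, h₁.2, h₂.2]

theorem exists_chain_three {K : Type*} [Field K] {Y a b c : SchemeType}
    (hY : Y.conditions = (Y.deg + 3).choose 3) (h₁ : GoodStep K Y a) (h₂ : GoodStep K a b)
    (h₃ : GoodStep K b c) (hc : OccursInReduction c) : HasChain K Y := by
  refine ⟨3, fun | 0 => Y | 1 => a | 2 => b | _ => c, le_rfl, rfl, fun i hi => ?_, fun i hi => ?_, hc⟩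
  · interval_cases i
    exacts [h₁.1, h₂.1, h₃.1]
  · interval_cases i
    exacts [hY, h₁.2, h₂.2, h₃.2]

/-- Here k = 2i + 4. The first step moves l = k + 1 lines. As a cross imposes one condition fewer
than two lines, the required number of conditions then determines s. The second step moves k/2
crosses, which gives the k star lines and k/2 omitted nodes of R₂(k). -/
theorem exists_chain_even_zero (K : Type*) [Field K] [IsAlgClosed K] (i : ℕ) :
    HasChain K (typeY (6 * i + 12) (6 * i * i + 29 * i + 35) 0) := by
  refine exists_chain_two (conditions_typeY ?_)
    (goodStep_typeY K (2 * i + 5) ?_ ?_ ?_ ?_ :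
      GoodStep K _ (typeB (6 * i + 11) (2 * i * i + 13 * i + 18) (2 * i * i + 7 * i + 6) (2 * i + 5) 0))
    (goodStep_typeB K 0 0 (2 * i * i + 6 * i + 4) ?_ ?_ ?_ ?_ ?_ ?_ :
      GoodStep K _ (typeB (6 * i + 10) (2 * i * i + 13 * i + 18) (2 * i * i + 6 * i + 4) (2 * i + 4) (i + 2)))
    ⟨2 * (i + 1) + 2, by omega, .inr (.inr (.inl ?red))⟩
  case red => rw [reductionScheme₂_even (i + 1)]; congr 1 <;> ring
  all_goals ring

/-- Here k = 2i + 4. The steps move first k + 2 lines, then k lines, and finally k/2 crosses while k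
pairs become crosses; the end is again R₂(k), three degrees lower. -/
theorem exists_chain_even_one (K : Type*) [Field K] [IsAlgClosed K] (i : ℕ) :
    HasChain K (typeY (6 * i + 13) (6 * i * i + 31 * i + 40) 0) := by
  refine exists_chain_three (conditions_typeY ?_)
    (goodStep_typeY K (2 * i + 6) ?_ ?_ ?_ ?_ :
      GoodStep K _ (typeB (6 * i + 12) (2 * i * i + 19 * i + 30) (2 * i * i + 5 * i + 2) (2 * i + 6) 0))
    (goodStep_typeB K (2 * i + 4) 0 (2 * i * i + 5 * i + 2) ?_ ?_ ?_ ?_ ?_ ?_ :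
      GoodStep K _ (typeB (6 * i + 11) (2 * i * i + 17 * i + 26) (2 * i * i + 5 * i + 2) (2 * i + 4) 0))
    (goodStep_typeB K 0 (2 * i + 4) (2 * i * i + 4 * i) ?_ ?_ ?_ ?_ ?_ ?_ :
      GoodStep K _ (typeB (6 * i + 10) (2 * i * i + 13 * i + 18) (2 * i * i + 6 * i + 4) (2 * i + 4) (i + 2)))
    ⟨2 * (i + 1) + 2, by omega, .inr (.inr (.inl ?red))⟩
  case red => rw [reductionScheme₂_even (i + 1)]; congr 1 <;> ring
  all_goals ring

/-- Here k = 2i + 4. The first step moves k + 1 lines and absorbs the k + 1 collinear points into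
the trace. The second moves one line and k/2 crosses, giving the k + 1 star lines of R₀(k). -/
theorem exists_chain_even_two (K : Type*) [Field K] [IsAlgClosed K] (i : ℕ) :
    HasChain K (typeY (6 * i + 14) (6 * i * i + 33 * i + 45) (2 * i + 5)) := by
  refine exists_chain_two (conditions_typeY ?_)
    (goodStep_typeY K (2 * i + 5) ?_ ?_ ?_ ?_ :
      GoodStep K _ (typeB (6 * i + 13) (2 * i * i + 13 * i + 20) (2 * i * i + 9 * i + 10) (2 * i + 5) 0))
    (goodStep_typeB K 1 0 (2 * i * i + 8 * i + 8) ?_ ?_ ?_ ?_ ?_ ?_ :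
      GoodStep K _ (typeB (6 * i + 12) (2 * i * i + 13 * i + 19) (2 * i * i + 8 * i + 8) (2 * i + 5) (i + 2)))
    ⟨2 * (i + 2), by omega, .inl ?red⟩
  case red => rw [reductionScheme₀_even (i + 2)]; congr 1 <;> ring
  all_goals ring

/-- For odd k = 2i + 5 the last step to R₂(k) moves (k - 1)/2 crosses and one further line, since
the number k of star lines is odd. -/
theorem exists_chain_odd_zero (K : Type*) [Field K] [IsAlgClosed K] (i : ℕ) :
    HasChain K (typeY (6 * i + 15) (6 * i * i + 35 * i + 51) 0) := by
  refine exists_chain_two (conditions_typeY ?_)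
    (goodStep_typeY K (2 * i + 6) ?_ ?_ ?_ ?_ :
      GoodStep K _ (typeB (6 * i + 14) (2 * i * i + 15 * i + 25) (2 * i * i + 9 * i + 10) (2 * i + 6) 0))
    (goodStep_typeB K 1 0 (2 * i * i + 8 * i + 8) ?_ ?_ ?_ ?_ ?_ ?_ :
      GoodStep K _ (typeB (6 * i + 13) (2 * i * i + 15 * i + 24) (2 * i * i + 8 * i + 8) (2 * i + 5) (i + 2)))
    ⟨2 * (i + 2) + 1, by omega, .inr (.inr (.inl ?red))⟩
  case red => rw [reductionScheme₂_odd (i + 2)]; congr 1 <;> ring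
  all_goals ring

theorem exists_chain_odd_one (K : Type*) [Field K] [IsAlgClosed K] (i : ℕ) :
    HasChain K (typeY (6 * i + 16) (6 * i * i + 37 * i + 57) 0) := by
  refine exists_chain_three (conditions_typeY ?_)
    (goodStep_typeY K (2 * i + 7) ?_ ?_ ?_ ?_ :
      GoodStep K _ (typeB (6 * i + 15) (2 * i * i + 21 * i + 40) (2 * i * i + 7 * i + 5) (2 * i + 7) 0))
    (goodStep_typeB K (2 * i + 5) 0 (2 * i * i + 7 * i + 5) ?_ ?_ ?_ ?_ ?_ ?_ :
      GoodStep K _ (typeB (6 * i + 14) (2 * i * i + 19 * i + 35) (2 * i * i + 7 * i + 5) (2 * i + 5) 0))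
    (goodStep_typeB K 1 (2 * i + 5) (2 * i * i + 6 * i + 3) ?_ ?_ ?_ ?_ ?_ ?_ :
      GoodStep K _ (typeB (6 * i + 13) (2 * i * i + 15 * i + 24) (2 * i * i + 8 * i + 8) (2 * i + 5) (i + 2)))
    ⟨2 * (i + 2) + 1, by omega, .inr (.inr (.inl ?red))⟩
  case red => rw [reductionScheme₂_odd (i + 2)]; congr 1 <;> ring
  all_goals ring

/-- Here k = 2i + 5, and the k + 1 star lines of R₀(k) come from (k + 1)/2 crosses alone. -/
theorem exists_chain_odd_two (K : Type*) [Field K] [IsAlgClosed K] (i : ℕ) :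
    HasChain K (typeY (6 * i + 17) (6 * i * i + 39 * i + 63) (2 * i + 6)) := by
  refine exists_chain_two (conditions_typeY ?_)
    (goodStep_typeY K (2 * i + 6) ?_ ?_ ?_ ?_ :
      GoodStep K _ (typeB (6 * i + 16) (2 * i * i + 15 * i + 27) (2 * i * i + 11 * i + 15) (2 * i + 6) 0))
    (goodStep_typeB K 0 0 (2 * i * i + 10 * i + 12) ?_ ?_ ?_ ?_ ?_ ?_ :
      GoodStep K _ (typeB (6 * i + 15) (2 * i * i + 15 * i + 27) (2 * i * i + 10 * i + 12) (2 * i + 6) (i + 3)))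
    ⟨2 * (i + 2) + 1, by omega, .inl ?red⟩
  case red => rw [reductionScheme₀_odd (i + 2)]; congr 1 <;> ring
  all_goals ring


end LinesInSpace

theorem proposition4p3 (K : Type*) [Field K] [IsAlgClosed K] (d k ε : ℕ)
    (hε : ε ≤ 2) (hd : d = 3 * k + ε) (hd12 : 12 ≤ d) :
    ∃ (n : ℕ) (σ : ℕ → LinesInSpace.SchemeType), n ≤ 3 ∧
      σ 0 = LinesInSpace.typeY d ((3 * k + 5 + 2 * ε) * k / 2 + 1 + ε) (if ε = 2 then k + 1 else 0) ∧
      (∀ i < n, LinesInSpace.Step K (σ i) (σ (i + 1))) ∧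
      (∀ i ≤ n, (σ i).conditions = ((σ i).deg + 3).choose 3) ∧
      LinesInSpace.OccursInReduction (σ n) := by
  change LinesInSpace.HasChain K _
  -- The bound d ≥ 12 with ε ≤ 2 forces k ≥ 4.
  obtain ⟨i, hi⟩ : ∃ i, k = 2 * i + 4 ∨ k = 2 * i + 5 := ⟨(k - 4) / 2, by omega⟩
  have two {a b : ℕ} (h : a = 2 * b) : a / 2 = b := Nat.div_eq_of_eq_mul_right two_pos h
  subst hd
  interval_cases ε <;> rcases hi with rfl | rfl
  · convert LinesInSpace.exists_chain_even_zero K i using 2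
    · ring
    · rw [two (b := 6 * i * i + 29 * i + 34) (by ring)]
    · rfl
  · convert LinesInSpace.exists_chain_odd_zero K i using 2
    · ring
    · rw [two (b := 6 * i * i + 35 * i + 50) (by ring)]
    · rfl
  · convert LinesInSpace.exists_chain_even_one K i using 2
    · ring
    · rw [two (b := 6 * i * i + 31 * i + 38) (by ring)]
    · rfl
  · convert LinesInSpace.exists_chain_odd_one K i using 2
    · ring
    · rw [two (b := 6 * i * i + 37 * i + 55) (by ring)]
    · rfl
  · convert LinesInSpace.exists_chain_even_two K i using 2
    · ring
    · rw [two (b := 6 * i * i + 33 * i + 42) (by ring)]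
    · rfl
  · convert LinesInSpace.exists_chain_odd_two K i using 2
    · ring
    · rw [two (b := 6 * i * i + 39 * i + 60) (by ring)]
    · rfl
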